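/- Let $G$ be a finite simple graph with $n\ge 1$ vertices and treewidth $w$. Its incidence poset $P$ has as elements the vertices and the edges of $G$, with $x<y$ exactly when $x$ is a vertex, $y$ is an edge, and $x$ is an endpoint of $y$. Let each element $x$ of $P$ have a weight $\omega(x)\in\mathbb{R}^2$, and let $\mathrm{poly}(P)$ be the convex hull in $\mathbb{R}^2$ of the points $\sum_{x\in L}\omega(x)$, where $L$ ranges over all lower sets of $P$. Then, for all weights, $\mathrm{poly}(P)$ has $n^{O(w)}$ vertices and can be constructed in $n^{O(w)}$ time. Precisely: there are an absolute constant $C$ and a single program for the unit-cost real RAM (integer operations: addition, truncated subtraction, comparison; real operations: the four arithmetic operations and comparison; rational constants; indexed memory access) such that for all $G$, $n$, $w$, $\omega$ as above, - $\mathrm{poly}(P)$ has at most $C\,n^{C\max(w,1)}$ vertices, and - given $G$ (as the numbers of vertices and edges and the list of the endpoints of its edges, for any numbering of its vertices and edges) together with the weights, and without being given $w$ or a tree-decomposition, the program halts after at most $C\,n^{C\max(w,1)}$ steps and outputs the list of the vertices of $\mathrm{poly}(P)$, each once, in counterclockwise order. -/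

import Mathlib

/-! ### Tree-decompositions and treewidth -/

/-- A tree-decomposition of `G`: a finite tree on the nodes `Fin size`, each node carrying a bag of
vertices of `G`, such that the nodes whose bags contain a given vertex induce a connected
(in particular nonempty) subtree and every edge has both endpoints in a common bag. -/
structure TreeDecomposition {V : Type*} (G : SimpleGraph V) where
  size : ℕ
  tree : SimpleGraph (Fin size)
  isTree : tree.IsTree
  bag : Fin size → Finset V
  connected : ∀ v : V, (tree.induce {i | v ∈ bag i}).Connected
  covers : ∀ u v : V, G.Adj u v → ∃ i, u ∈ bag i ∧ v ∈ bag i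

/-- One less than the maximum number of vertices in a bag. -/
def TreeDecomposition.width {V : Type*} {G : SimpleGraph V} (D : TreeDecomposition G) : ℕ :=
  (Finset.univ.sup fun i => (D.bag i).card) - 1

/-- The minimum width of a tree-decomposition (used for finite nonempty graphs). -/
noncomputable def treewidth {V : Type*} (G : SimpleGraph V) : ℕ :=
  sInf (Set.range fun D : TreeDecomposition G => D.width)

/-! ### Incidence posets -/

/-- The elements of the incidence poset of `G` are the vertices and the edges of `G`. -/
inductive IncidencePoset {V : Type*} (G : SimpleGraph V) where
  | vertex (v : V) : IncidencePoset G
  | edge (e : G.edgeSet) : IncidencePoset G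

namespace IncidencePoset

variable {V : Type*} {G : SimpleGraph V}

/-- A vertex lies below exactly the edges of which it is an endpoint. -/
instance : PartialOrder (IncidencePoset G) where
  le x y := x = y ∨ ∃ (v : V) (e : G.edgeSet), x = vertex v ∧ y = edge e ∧ v ∈ (e : Sym2 V)
  le_refl x := Or.inl rfl
  le_trans x y z := by
    rintro (rfl | ⟨v, e, rfl, rfl, h⟩) (rfl | ⟨v', e', h1, h2, h3⟩)
    · exact Or.inl rfl
    · exact Or.inr ⟨v', e', h1, h2, h3⟩
    · exact Or.inr ⟨v, e, rfl, rfl, h⟩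
    · cases h1
  le_antisymm x y := by
    rintro (rfl | ⟨v, e, rfl, rfl, h⟩) (h' | ⟨v', e', h1, h2, h3⟩)
    · rfl
    · rfl
    · exact h'.symm
    · cases h1

instance [Finite V] : Finite (IncidencePoset G) :=
  Finite.of_surjective
    (fun s : V ⊕ G.edgeSet => Sum.elim vertex edge s) (by
      rintro (v | e)
      · exact ⟨Sum.inl v, rfl⟩
      · exact ⟨Sum.inr e, rfl⟩)

noncomputable instance [Finite V] : Fintype (IncidencePoset G) := Fintype.ofFinite _

end IncidencePoset

/-! ### The polygon of a weighted poset -/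

open Classical in
/-- The sum of the weights of the elements of a lower set. -/
noncomputable def lowerSetWeight {P : Type*} [PartialOrder P] [Fintype P]
    (wt : P → ℝ × ℝ) (L : LowerSet P) : ℝ × ℝ :=
  ∑ x : P with x ∈ L, wt x

/-- The convex hull of the planar point set formed by the weights of all lower sets. -/
noncomputable def polygon {P : Type*} [PartialOrder P] [Fintype P]
    (wt : P → ℝ × ℝ) : Set (ℝ × ℝ) :=
  convexHull ℝ (Set.range (lowerSetWeight wt))

/-- The points `p 0, …, p (k - 1)` are the vertices (extreme points) of `K`, each listed exactly
once, in counterclockwise cyclic order: every three of them, in the order of the list, make a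
strict left turn. -/
def ListsVerticesCCW {k : ℕ} (p : Fin k → ℝ × ℝ) (K : Set (ℝ × ℝ)) : Prop :=
  Function.Injective p ∧ Set.range p = K.extremePoints ℝ ∧
    ∀ a b c : Fin k, a < b → b < c →
      0 < ((p b).1 - (p a).1) * ((p c).2 - (p a).2) - ((p b).2 - (p a).2) * ((p c).1 - (p a).1)

/-! ### Real RAM programs with unit costs

The memory consists of arrays of natural numbers and arrays of real numbers.  Arrays are named by
numerals occurring in the program, so a program uses finitely many arrays; the index of an array
access is computed at run time.  There is neither a multiplication of natural numbers nor a
conversion of reals to integers (rounding), and the constants of a program are rational.  Each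
operation, memory access, comparison, assignment and branch costs one step. -/

namespace RealRAM

/-- `nat a i` and `real a i` are the contents of cell `i` of the array `a`. -/
structure State where
  nat : ℕ → ℕ → ℕ
  real : ℕ → ℕ → ℝ

/-- Expressions with natural number values; `sub` is truncated subtraction. -/
inductive NatExpr where
  | const (c : ℕ) : NatExpr
  | read (a : ℕ) (i : NatExpr) : NatExpr
  | add (e f : NatExpr) : NatExpr
  | sub (e f : NatExpr) : NatExpr

/-- Expressions with real values; the quotient by zero is zero. -/
inductive RealExpr where
  | const (q : ℚ) : RealExpr
  | read (a : ℕ) (i : NatExpr) : RealExpr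
  | add (e f : RealExpr) : RealExpr
  | sub (e f : RealExpr) : RealExpr
  | mul (e f : RealExpr) : RealExpr
  | div (e f : RealExpr) : RealExpr

/-- Tests, built from comparisons. -/
inductive Test where
  | natLe (e f : NatExpr) : Test
  | realLe (e f : RealExpr) : Test
  | not (b : Test) : Test
  | and (b c : Test) : Test

/-- Programs. `setNat a i e` assigns the value of `e` to cell `i` of the array `a` of naturals. -/
inductive Prog where
  | skip : Prog
  | setNat (a : ℕ) (i e : NatExpr) : Prog
  | setReal (a : ℕ) (i : NatExpr) (e : RealExpr) : Prog
  | seq (p q : Prog) : Prog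
  | branch (b : Test) (p q : Prog) : Prog
  | loop (b : Test) (p : Prog) : Prog

def NatExpr.eval (s : State) : NatExpr → ℕ
  | const c => c
  | read a i => s.nat a (i.eval s)
  | add e f => e.eval s + f.eval s
  | sub e f => e.eval s - f.eval s

def NatExpr.cost : NatExpr → ℕ
  | const _ => 1
  | read _ i => i.cost + 1
  | add e f => e.cost + f.cost + 1
  | sub e f => e.cost + f.cost + 1

noncomputable def RealExpr.eval (s : State) : RealExpr → ℝ
  | const q => (q : ℝ)
  | read a i => s.real a (i.eval s)
  | add e f => e.eval s + f.eval s
  | sub e f => e.eval s - f.eval s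
  | mul e f => e.eval s * f.eval s
  | div e f => e.eval s / f.eval s

def RealExpr.cost : RealExpr → ℕ
  | const _ => 1
  | read _ i => i.cost + 1
  | add e f => e.cost + f.cost + 1
  | sub e f => e.cost + f.cost + 1
  | mul e f => e.cost + f.cost + 1
  | div e f => e.cost + f.cost + 1

def Test.Holds (s : State) : Test → Prop
  | natLe e f => e.eval s ≤ f.eval s
  | realLe e f => e.eval s ≤ f.eval s
  | not b => ¬ b.Holds s
  | and b c => b.Holds s ∧ c.Holds s

def Test.cost : Test → ℕ
  | natLe e f => e.cost + f.cost + 1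
  | realLe e f => e.cost + f.cost + 1
  | not b => b.cost + 1
  | and b c => b.cost + c.cost + 1

def State.writeNat (s : State) (a i v : ℕ) : State :=
  { s with nat := fun a' i' => if a' = a ∧ i' = i then v else s.nat a' i' }

noncomputable def State.writeReal (s : State) (a i : ℕ) (v : ℝ) : State :=
  { s with real := fun a' i' => if a' = a ∧ i' = i then v else s.real a' i' }

/-- `Exec p s t s'`: the program `p`, started in `s`, halts in `s'` after exactly `t` steps. -/
inductive Exec : Prog → State → ℕ → State → Prop
  | skip (s : State) : Exec Prog.skip s 1 s
  | setNat (s : State) (a : ℕ) (i e : NatExpr) :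
      Exec (Prog.setNat a i e) s (i.cost + e.cost + 1) (s.writeNat a (i.eval s) (e.eval s))
  | setReal (s : State) (a : ℕ) (i : NatExpr) (e : RealExpr) :
      Exec (Prog.setReal a i e) s (i.cost + e.cost + 1) (s.writeReal a (i.eval s) (e.eval s))
  | seq {p q : Prog} {s s' s'' : State} {t t' : ℕ} :
      Exec p s t s' → Exec q s' t' s'' → Exec (Prog.seq p q) s (t + t') s''
  | branchTrue {b : Test} {p q : Prog} {s s' : State} {t : ℕ} :
      b.Holds s → Exec p s t s' → Exec (Prog.branch b p q) s (b.cost + 1 + t) s'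
  | branchFalse {b : Test} {p q : Prog} {s s' : State} {t : ℕ} :
      ¬ b.Holds s → Exec q s t s' → Exec (Prog.branch b p q) s (b.cost + 1 + t) s'
  | loopTrue {b : Test} {p : Prog} {s s' s'' : State} {t t' : ℕ} :
      b.Holds s → Exec p s t s' → Exec (Prog.loop b p) s' t' s'' →
      Exec (Prog.loop b p) s (b.cost + 1 + t + t') s''
  | loopFalse {b : Test} {p : Prog} {s : State} :
      ¬ b.Holds s → Exec (Prog.loop b p) s (b.cost + 1) s

end RealRAM

/-! ### Input and output conventions -/

/-- A numbering of the vertices and edges of a finite graph, where each edge is given by the numbers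
of its endpoints. -/
structure GraphCode {V : Type*} [Fintype V] (G : SimpleGraph V) where
  vtx : Fin (Fintype.card V) ≃ V
  numEdges : ℕ
  edg : Fin numEdges ≃ G.edgeSet
  src : Fin numEdges → Fin (Fintype.card V)
  tgt : Fin numEdges → Fin (Fintype.card V)
  endpoints : ∀ k, (edg k : Sym2 V) = s(vtx (src k), vtx (tgt k))

/-- The initial memory: array `0` of naturals holds the numbers of vertices and of edges, arrays `1`
and `2` the endpoints of the edges; arrays `0` and `1` of reals hold the coordinates of the weights
of the vertices, arrays `2` and `3` those of the edges. All other cells are zero. -/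
noncomputable def GraphCode.input {V : Type*} [Fintype V] {G : SimpleGraph V}
    (c : GraphCode G) (wt : IncidencePoset G → ℝ × ℝ) : RealRAM.State where
  nat := fun a i =>
    match a with
    | 0 => if i = 0 then Fintype.card V else if i = 1 then c.numEdges else 0
    | 1 => if h : i < c.numEdges then (c.src ⟨i, h⟩ : ℕ) else 0
    | 2 => if h : i < c.numEdges then (c.tgt ⟨i, h⟩ : ℕ) else 0
    | _ => 0
  real := fun a i =>
    match a with
    | 0 => if h : i < Fintype.card V then (wt (.vertex (c.vtx ⟨i, h⟩))).1 else 0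
    | 1 => if h : i < Fintype.card V then (wt (.vertex (c.vtx ⟨i, h⟩))).2 else 0
    | 2 => if h : i < c.numEdges then (wt (.edge (c.edg ⟨i, h⟩))).1 else 0
    | 3 => if h : i < c.numEdges then (wt (.edge (c.edg ⟨i, h⟩))).2 else 0
    | _ => 0

/-- The final memory describes `K` when cell `0` of array `3` of naturals holds the number of its
vertices, and arrays `4` and `5` of reals list the coordinates of its vertices in counterclockwise
order. -/
def RealRAM.State.Outputs (s : RealRAM.State) (K : Set (ℝ × ℝ)) : Prop :=
  ListsVerticesCCW (fun j : Fin (s.nat 3 0) => (s.real 4 j, s.real 5 j)) K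

/-! Number of vertices. Up to a reflection of the plane, every vertex of a polygon is the strict
maximiser of a functional x + l * y, and the ordinate of the maximiser grows with l. So it suffices
to count the ordinates that occur, `supportSlopes`. These counts are additive in two situations. A
strict maximiser of a union is one of the part that contains it, so the counts of the parts add up
(`ncard_supportSlopes_iUnion_le`). If the maximisers of one set are determined by those of several
others, the counts add up too, apart from one: as l grows all the ordinates grow together, so their
tuple runs through a chain and not through a whole product, just as for the edges of a Minkowski sum
(`ncard_supportSlopes_le_sum_add_one`).

For lower sets, prescribe which vertices are in and which are out. Some bag of a tree-decomposition
splits the undecided vertices into parts of at most half the size without edges between them.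
Deciding the bag gives a union of at most 2 ^ (w + 1) sets; afterwards the parts are independent and
their counts add up (`ncard_supportSlopes_le_of_parts`). The recursion has logarithmic depth, which
yields n ^ O(w) (`ncard_supportSlopes_weightsBetween_le`).

Running time. The program needs no tree-decomposition. Maximising a linear functional over the lower
sets is a maximum closure problem, solved in polynomial time by preflow-push. Since that algorithm
only uses an ordered abelian group, it runs over lexicographically ordered pairs, which breaks ties
so that the answer is always a vertex of the polygon (`runs_oracle`,
`mem_extremePoints_of_lexKey_max`). With this oracle, N vertices are found by O(N) queries: each
query either certifies a candidate edge or produces a new vertex beyond it (`runs_hullStep`). The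
treewidth enters the running time only through the bound on N. -/

/-! ### Strict maximisers of planar sets -/

/-- `a` is the only maximiser over `A` of the functional `(x, y) ↦ x + l * y`. -/
def IsStrictMaxAt (A : Set (ℝ × ℝ)) (l : ℝ) (a : ℝ × ℝ) : Prop :=
  a ∈ A ∧ ∀ b ∈ A, b ≠ a → b.1 + l * b.2 < a.1 + l * a.2

/-- The ordinates of the strict maximisers of functionals `(x, y) ↦ x + l * y`; these are the
slopes of the piecewise linear support function of `A`. -/
def supportSlopes (A : Set (ℝ × ℝ)) : Set ℝ :=
  {y | ∃ l a, IsStrictMaxAt A l a ∧ a.2 = y}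

theorem IsStrictMaxAt.le {A : Set (ℝ × ℝ)} {l : ℝ} {a b : ℝ × ℝ} (h : IsStrictMaxAt A l a)
    (hb : b ∈ A) : b.1 + l * b.2 ≤ a.1 + l * a.2 := by
  by_cases hba : b = a
  · rw [hba]
  · exact (h.2 b hb hba).le

/-- Adding the two optimality inequalities gives (l' - l) * (a'.2 - a.2) ≥ 0; for l = l' the
maximiser is unique. -/
theorem IsStrictMaxAt.snd_mono {A : Set (ℝ × ℝ)} {l l' : ℝ} {a a' : ℝ × ℝ}
    (h : IsStrictMaxAt A l a) (h' : IsStrictMaxAt A l' a') (hl : l ≤ l') : a.2 ≤ a'.2 := by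
  rcases hl.eq_or_lt with rfl | hl
  · by_contra hne
    have hne' : a' ≠ a := by
      rintro rfl
      exact hne le_rfl
    exact absurd (h.2 _ h'.1 hne') (not_lt.2 (h'.le h.1))
  · have h1 := h.le h'.1
    have h2 := h'.le h.1
    by_contra hlt
    push Not at hlt
    nlinarith [mul_pos (sub_pos.2 hl) (sub_pos.2 hlt)]

theorem supportSlopes_subset (A : Set (ℝ × ℝ)) : supportSlopes A ⊆ Prod.snd '' A := by
  rintro _ ⟨l, a, ha, rfl⟩
  exact ⟨a, ha.1, rfl⟩

theorem finite_supportSlopes {A : Set (ℝ × ℝ)} (hA : A.Finite) : (supportSlopes A).Finite :=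
  (hA.image _).subset (supportSlopes_subset A)

theorem IsStrictMaxAt.mem_supportSlopes {A : Set (ℝ × ℝ)} {l : ℝ} {a : ℝ × ℝ}
    (h : IsStrictMaxAt A l a) : a.2 ∈ supportSlopes A := ⟨l, a, h, rfl⟩

/-- If the ordinate of the strict maximiser of `A` in each direction is a function of those of the
strict maximisers of the sets `B j`, the numbers of slopes add up, since the tuple of ordinates
moves along a chain. -/
theorem ncard_supportSlopes_le_sum_add_one {ι : Type*} (J : Finset ι) (A : Set (ℝ × ℝ))
    (B : ι → Set (ℝ × ℝ)) (hB : ∀ j ∈ J, (B j).Finite) (φ : (ι → ℝ) → ℝ)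
    (h : ∀ l a, IsStrictMaxAt A l a → ∃ b : ι → ℝ × ℝ, (∀ j ∈ J, IsStrictMaxAt (B j) l (b j)) ∧
      ∀ y : ι → ℝ, (∀ j ∈ J, y j = (b j).2) → a.2 = φ y) :
    (supportSlopes A).ncard ≤ (∑ j ∈ J, (supportSlopes (B j)).ncard) + 1 := by
  classical
  have hex : ∀ y : supportSlopes A, ∃ l : ℝ, ∃ b : ι → ℝ × ℝ,
      (∀ j ∈ J, IsStrictMaxAt (B j) l (b j)) ∧
      ∀ z : ι → ℝ, (∀ j ∈ J, z j = (b j).2) → (y : ℝ) = φ z := by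
    rintro ⟨_, l, a, ha, rfl⟩
    obtain ⟨b, hb, hb'⟩ := h l a ha
    exact ⟨l, b, hb, hb'⟩
  choose l b hb hφ using hex
  let S : ι → ℝ → Set ℝ := fun j y => {u ∈ supportSlopes (B j) | u ≤ y}
  have hS : ∀ j ∈ J, ∀ y, (S j y).Finite := fun j hj y =>
    (finite_supportSlopes (hB j hj)).subset (Set.sep_subset _ _)
  -- The rank of the tuple in the product of the chains of slopes. It takes at most one value more
  -- than the total number of slopes, and comparable tuples of equal rank coincide.
  let r : supportSlopes A → ℕ := fun y => ∑ j ∈ J, (S j (b y j).2).ncard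
  have hr : ∀ y, r y ∈ Finset.range ((∑ j ∈ J, (supportSlopes (B j)).ncard) + 1) := by
    intro y
    rw [Finset.mem_range, Nat.lt_succ_iff]
    exact Finset.sum_le_sum fun j hj =>
      Set.ncard_le_ncard (Set.sep_subset _ _) (finite_supportSlopes (hB j hj))
  have key : ∀ y y', l y ≤ l y' → r y = r y' → y = y' := by
    intro y y' hl hrr
    have hmono : ∀ j ∈ J, (b y j).2 ≤ (b y' j).2 := fun j hj =>
      (hb y j hj).snd_mono (hb y' j hj) hl
    have hsub : ∀ j ∈ J, S j (b y j).2 ⊆ S j (b y' j).2 := fun j hj u hu =>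
      ⟨hu.1, hu.2.trans (hmono j hj)⟩
    have hle : ∀ j ∈ J, (S j (b y j).2).ncard ≤ (S j (b y' j).2).ncard := fun j hj =>
      Set.ncard_le_ncard (hsub j hj) (hS j hj _)
    have heq := (Finset.sum_eq_sum_iff_of_le hle).1 hrr
    have hy : ∀ j ∈ J, (b y' j).2 = (b y j).2 := by
      intro j hj
      have := Set.eq_of_subset_of_ncard_le (hsub j hj) (heq j hj).ge (hS j hj _)
      have hm : (b y' j).2 ∈ S j (b y j).2 := by
        rw [this]
        exact ⟨(hb y' j hj).mem_supportSlopes, le_rfl⟩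
      exact le_antisymm hm.2 (hmono j hj)
    apply Subtype.ext
    rw [hφ y (fun j => (b y j).2) (fun j _ => rfl),
      hφ y' (fun j => (b y j).2) (fun j hj => (hy j hj).symm)]
  have hinj : Function.Injective r := by
    intro y y' hrr
    rcases le_total (l y) (l y') with hl | hl
    · exact key y y' hl hrr
    · exact (key y' y hl hrr.symm).symm
  have := Finset.card_range ((∑ j ∈ J, (supportSlopes (B j)).ncard) + 1)
  have h2 : Nat.card (supportSlopes A) ≤
      Nat.card (Finset.range ((∑ j ∈ J, (supportSlopes (B j)).ncard) + 1)) :=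
    Nat.card_le_card_of_injective (fun y => ⟨r y, hr y⟩) fun y y' hyy =>
      hinj (congrArg Subtype.val hyy)
  rw [Nat.card_eq_fintype_card (α := Finset.range _), Fintype.card_coe, this] at h2
  rwa [← Nat.card_coe_set_eq]

theorem ncard_supportSlopes_iUnion_le {ι : Type*} (J : Finset ι) (A : Set (ℝ × ℝ))
    (B : ι → Set (ℝ × ℝ)) (hB : ∀ j ∈ J, (B j).Finite) (h : A = ⋃ j ∈ J, B j) :
    (supportSlopes A).ncard ≤ ∑ j ∈ J, (supportSlopes (B j)).ncard := by
  have hsub : supportSlopes A ⊆ ⋃ j ∈ J, supportSlopes (B j) := by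
    rintro _ ⟨l, a, ha, rfl⟩
    have haA := ha.1
    rw [h, Set.mem_iUnion₂] at haA
    obtain ⟨j, hj, haj⟩ := haA
    refine Set.mem_iUnion₂.2 ⟨j, hj, l, a, ⟨haj, fun b hb hne => ha.2 b ?_ hne⟩, rfl⟩
    rw [h]
    exact Set.mem_iUnion₂.2 ⟨j, hj, hb⟩
  refine (Set.ncard_le_ncard hsub ?_).trans (Finset.set_ncard_biUnion_le J _)
  exact J.finite_toSet.biUnion fun j hj => finite_supportSlopes (hB j hj)

/-! ### Extreme points and slopes -/

/-- Separate p from the hull of the other points. Strict separation from finitely many points is an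
open condition, so a vanishing coefficient of x can be perturbed to a nonzero one. -/
theorem exists_strict_functional_of_mem_extremePoints {A : Set (ℝ × ℝ)} (hA : A.Finite)
    {p : ℝ × ℝ} (hp : p ∈ (convexHull ℝ A).extremePoints ℝ) :
    p ∈ A ∧ ∃ α β : ℝ, α ≠ 0 ∧ ∀ b ∈ A, b ≠ p → α * b.1 + β * b.2 < α * p.1 + β * p.2 := by
  have hpA : p ∈ A := extremePoints_convexHull_subset hp
  refine ⟨hpA, ?_⟩
  have hnot : p ∉ convexHull ℝ (A \ {p}) := by
    have h1 := ((convex_convexHull ℝ A).mem_extremePoints_iff_mem_sdiff_convexHull_sdiff).1 hp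
    intro h2
    refine h1.2 (convexHull_mono ?_ h2)
    exact Set.sdiff_subset_sdiff_left (subset_convexHull ℝ A)
  have hfin : (A \ {p}).Finite := hA.subset Set.sdiff_subset
  obtain ⟨f, u, hfu, hu⟩ := geometric_hahn_banach_closed_point (convex_convexHull ℝ (A \ {p}))
    (hfin.isClosed_convexHull ℝ) hnot
  have hf : ∀ x : ℝ × ℝ, f x = f (1, 0) * x.1 + f (0, 1) * x.2 := by
    intro x
    have : x = x.1 • ((1 : ℝ), (0 : ℝ)) + x.2 • ((0 : ℝ), (1 : ℝ)) := by
      ext <;> simp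
    conv_lhs => rw [this]
    rw [map_add, map_smul, map_smul, smul_eq_mul, smul_eq_mul]
    ring
  have hev : ∀ᶠ α in nhds (f (1, 0)), ∀ b ∈ A \ {p},
      α * b.1 + f (0, 1) * b.2 < α * p.1 + f (0, 1) * p.2 := by
    rw [Filter.eventually_all_finite hfin]
    intro b hb
    have hlt : f (1, 0) * b.1 + f (0, 1) * b.2 < f (1, 0) * p.1 + f (0, 1) * p.2 := by
      rw [← hf, ← hf]
      exact (hfu b (subset_convexHull ℝ _ hb)).trans hu
    exact ContinuousAt.eventually_lt (by fun_prop) (by fun_prop) hlt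
  obtain ⟨α, hα, hα0⟩ : ∃ α, (∀ b ∈ A \ {p},
      α * b.1 + f (0, 1) * b.2 < α * p.1 + f (0, 1) * p.2) ∧ α ≠ 0 := by
    by_cases h0 : f (1, 0) = 0
    · rw [h0] at hev
      have h1 : ∀ᶠ α in nhdsWithin (0 : ℝ) {0}ᶜ, ∀ b ∈ A \ {p},
          α * b.1 + f (0, 1) * b.2 < α * p.1 + f (0, 1) * p.2 := hev.filter_mono nhdsWithin_le_nhds
      obtain ⟨α, h2, h3⟩ := (h1.and self_mem_nhdsWithin).exists
      exact ⟨α, h2, h3⟩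
    · exact ⟨_, hev.self_of_nhds, h0⟩
  exact ⟨α, f (0, 1), hα0, fun b hb hne => hα b ⟨hb, hne⟩⟩

/-- Two strict maximisers with the same ordinate have each at least the abscissa of the other, so
the ordinate determines the point. -/
theorem ncard_strictMax_le (A : Set (ℝ × ℝ)) (hA : A.Finite) :
    {a | ∃ l, IsStrictMaxAt A l a}.ncard ≤ (supportSlopes A).ncard := by
  refine Set.ncard_le_ncard_of_injOn Prod.snd ?_ ?_ (finite_supportSlopes hA)
  · rintro a ⟨l, ha⟩
    exact ha.mem_supportSlopes
  · rintro a ⟨l, ha⟩ b ⟨l', hb⟩ hab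
    have h1 := ha.le hb.1
    have h2 := hb.le ha.1
    rw [hab] at h1 h2
    exact Prod.ext (by linarith) hab

/-- Dividing α * x + β * y by |α| leaves x + l * y or -x + l * y; the second kind is counted in the
mirror image. -/
theorem ncard_extremePoints_le {A : Set (ℝ × ℝ)} (hA : A.Finite) :
    ((convexHull ℝ A).extremePoints ℝ).ncard ≤
      (supportSlopes A).ncard +
        (supportSlopes ((fun a : ℝ × ℝ => (-a.1, a.2)) '' A)).ncard := by
  set A' := (fun a : ℝ × ℝ => (-a.1, a.2)) '' A with hA'
  have hfin' : A'.Finite := hA.image _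
  have hsub : (convexHull ℝ A).extremePoints ℝ ⊆ {a | ∃ l, IsStrictMaxAt A l a} ∪
      (fun a : ℝ × ℝ => (-a.1, a.2)) '' {a | ∃ l, IsStrictMaxAt A' l a} := by
    intro p hp
    obtain ⟨hpA, α, β, hα, hlt⟩ := exists_strict_functional_of_mem_extremePoints hA hp
    have hscale : ∀ b ∈ A, b ≠ p →
        (α * b.1 + β * b.2) / |α| < (α * p.1 + β * p.2) / |α| := fun b hb hne =>
      div_lt_div_of_pos_right (hlt b hb hne) (abs_pos.2 hα)
    rcases lt_or_gt_of_ne hα with hneg | hpos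
    · right
      refine ⟨(-p.1, p.2), ⟨β / |α|, ⟨p, hpA, rfl⟩, ?_⟩, by simp⟩
      rintro _ ⟨b, hb, rfl⟩ hne
      have h1 := hscale b hb (fun h => hne (by rw [h]))
      have h2 : ∀ x y : ℝ, (α * x + β * y) / |α| = -x + β / |α| * y := by
        intro x y
        rw [abs_of_neg hneg]
        field_simp
        ring
      rw [h2, h2] at h1
      exact h1
    · left
      refine ⟨β / |α|, hpA, fun b hb hne => ?_⟩
      have h1 := hscale b hb hne
      have h2 : ∀ x y : ℝ, (α * x + β * y) / |α| = x + β / |α| * y := by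
        intro x y
        rw [abs_of_pos hpos]
        field_simp
      rw [h2, h2] at h1
      exact h1
  have hf1 : {a | ∃ l, IsStrictMaxAt A l a}.Finite := hA.subset fun a ⟨l, ha⟩ => ha.1
  have hf2 : {a | ∃ l, IsStrictMaxAt A' l a}.Finite := hfin'.subset fun a ⟨l, ha⟩ => ha.1
  refine (Set.ncard_le_ncard hsub (hf1.union (hf2.image _))).trans
    ((Set.ncard_union_le _ _).trans (Nat.add_le_add (ncard_strictMax_le A hA) ?_))
  exact (Set.ncard_image_le hf2).trans (ncard_strictMax_le A' hfin')

/-! ### Balanced separators from tree-decompositions -/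

/-- If every node `i` of a finite tree is assigned a component of the tree without `i`, the
components assigned to some two nodes are disjoint. -/
theorem SimpleGraph.IsTree.exists_disjoint_components {N : Type*} [Finite N] {T : SimpleGraph N}
    (hT : T.IsTree) (x : N → N) (hx : ∀ i, x i ≠ i) :
    ∃ i j, ∀ y, (T.deleteIncidenceSet i).Reachable (x i) y →
      ¬ (T.deleteIncidenceSet j).Reachable (x j) y := by
  classical
  by_contra hcon
  push Not at hcon
  have := hT.connected.nonempty
  let B : N → Set N := fun i => {y | (T.deleteIncidenceSet i).Reachable (x i) y}
  -- Choose i with the smallest assigned component, and a neighbour j of i in it. If the component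
  -- of j meets that of i, then either it contains i, and the edge between i and j lies on a cycle,
  -- or it is contained in the component of i and misses j, against minimality.
  obtain ⟨i, hi⟩ := Finite.exists_min fun i => (B i).ncard
  have hnot : ∀ i, i ∉ B i := by
    intro i hi
    have hstart : ∀ (u v : N) (_ : (T.deleteIncidenceSet i).Walk u v), u = i → v = i := by
      intro u v p hu
      cases p with
      | nil => exact hu
      | cons h p => exact absurd hu (SimpleGraph.deleteIncidenceSet_adj.1 h).2.1
    obtain ⟨p⟩ := SimpleGraph.Reachable.symm hi
    exact hx i (hstart _ _ p rfl)
  -- the component of `i` contains a neighbour of `i`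
  have hnb : ∃ j, T.Adj i j ∧ j ∈ B i := by
    have hwalk : ∀ (u v : N) (p : T.Walk u v), v = i → u ≠ i →
        ∃ j, T.Adj i j ∧ (T.deleteIncidenceSet i).Reachable u j := by
      intro u v p
      induction p with
      | nil => exact fun h1 h2 => absurd h1 h2
      | @cons u w v h p ih =>
        intro hv hu
        by_cases hw : w = i
        · subst hw
          exact ⟨u, h.symm, SimpleGraph.Reachable.refl _⟩
        · obtain ⟨j, hj, hr⟩ := ih hv hw
          exact ⟨j, hj, (SimpleGraph.Adj.reachable
            (SimpleGraph.deleteIncidenceSet_adj.2 ⟨h, hu, hw⟩)).trans hr⟩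
    obtain ⟨p⟩ := hT.connected.preconnected (x i) i
    exact hwalk _ _ p rfl (hx i)
  obtain ⟨j, hij, hj⟩ := hnb
  obtain ⟨y, hyi, hyj⟩ := hcon i j
  by_cases hiB : i ∈ B j
  · -- then the edge `ij` lies on a cycle
    have hbr := SimpleGraph.isAcyclic_iff_forall_adj_isBridge.1 hT.isAcyclic hij
    rw [SimpleGraph.isBridge_iff] at hbr
    have hle : ∀ k, k = i ∨ k = j → T.deleteIncidenceSet k ≤ T \ SimpleGraph.fromEdgeSet {s(i, j)} := by
      intro k hk u v huv
      obtain ⟨h1, h2, h3⟩ := SimpleGraph.deleteIncidenceSet_adj.1 huv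
      refine ⟨h1, fun h => ?_⟩
      have h4 := (SimpleGraph.fromEdgeSet_adj _).1 h
      have h5 := h4.1
      rw [Set.mem_singleton_iff, Sym2.eq_iff] at h5
      rcases hk with rfl | rfl <;> rcases h5 with h | h <;> simp_all
    have h1 : (T.deleteIncidenceSet i).Reachable y j := (SimpleGraph.Reachable.symm hyi).trans hj
    have h2 : (T.deleteIncidenceSet j).Reachable i y := (SimpleGraph.Reachable.symm hiB).trans hyj
    exact hbr ((h2.mono (hle j (Or.inr rfl))).trans (h1.mono (hle i (Or.inl rfl))))
  · have hsub : B j ⊆ B i := by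
      have hwalk : ∀ (u v : N) (p : (T.deleteIncidenceSet j).Walk u v), u ∈ B j →
          (T.deleteIncidenceSet i).Reachable u v := by
        intro u v p
        induction p with
        | nil => exact fun _ => SimpleGraph.Reachable.refl _
        | @cons u w v h p ih =>
          intro hu
          have hw : w ∈ B j := SimpleGraph.Reachable.trans hu h.reachable
          refine SimpleGraph.Reachable.trans (SimpleGraph.Adj.reachable ?_) (ih hw)
          refine SimpleGraph.deleteIncidenceSet_adj.2
            ⟨(SimpleGraph.deleteIncidenceSet_adj.1 h).1, ?_, ?_⟩
          · rintro rfl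
            exact hiB hu
          · rintro rfl
            exact hiB hw
      intro z hz
      obtain ⟨p⟩ := (SimpleGraph.Reachable.symm hyj).trans hz
      exact SimpleGraph.Reachable.trans hyi (hwalk _ _ p hyj)
    have hlt : (B j).ncard < (B i).ncard :=
      Set.ncard_lt_ncard ⟨hsub, fun h => hnot j (h hj)⟩ (Set.toFinite _)
    exact absurd (hi j) (not_le.2 hlt)

theorem TreeDecomposition.card_bag_le {V : Type*} {G : SimpleGraph V} (D : TreeDecomposition G)
    (i : Fin D.size) : (D.bag i).card ≤ D.width + 1 := by
  have := Finset.le_sup (f := fun i => (D.bag i).card) (Finset.mem_univ i)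
  unfold TreeDecomposition.width
  omega

/-- Some bag separates a vertex set into parts that contain at most half of it each. -/
theorem TreeDecomposition.exists_balanced_separator {V : Type*} [DecidableEq V]
    {G : SimpleGraph V} (D : TreeDecomposition G) (W : Finset V) :
    ∃ (X : Finset V) (f : V → Fin D.size), X.card ≤ D.width + 1 ∧
      (∀ u v, G.Adj u v → u ∉ X → v ∉ X → f u = f v) ∧
      ∀ k, 2 * (W.filter fun v => v ∉ X ∧ f v = k).card ≤ W.card := by
  classical
  have hne : ∀ v, ∃ i, v ∈ D.bag i := by
    intro v
    obtain ⟨⟨i, hi⟩⟩ := (D.connected v).nonempty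
    exact ⟨i, hi⟩
  choose node hnode using hne
  -- The nodes whose bags contain v form a connected set that avoids i, so they remain in one
  -- component when i is cut off.
  have hreach : ∀ i v, v ∉ D.bag i → ∀ y, v ∈ D.bag y →
      (D.tree.deleteIncidenceSet i).Reachable (node v) y := by
    intro i v hv y hy
    have h := (D.connected v).preconnected ⟨node v, hnode v⟩ ⟨y, hy⟩
    let hom : (D.tree.induce {i | v ∈ D.bag i}) →g D.tree.deleteIncidenceSet i :=
      { toFun := Subtype.val
        map_rel' := by
          rintro ⟨a, ha⟩ ⟨b, hb⟩ hab
          refine SimpleGraph.deleteIncidenceSet_adj.2 ⟨hab, ?_, ?_⟩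
          · rintro rfl
            exact hv ha
          · rintro rfl
            exact hv hb }
    exact h.map hom
  by_contra hcon
  push Not at hcon
  have hheavy : ∀ i, ∃ x, x ≠ i ∧ W.card < 2 * (W.filter fun v => v ∉ D.bag i ∧
      (D.tree.deleteIncidenceSet i).Reachable x (node v)).card := by
    intro i
    -- The part of a vertex is named by a representative node of its component in the tree without
    -- i.
    let f : V → Fin D.size := fun v =>
      ((D.tree.deleteIncidenceSet i).connectedComponentMk (node v)).out
    obtain ⟨k, hk⟩ := hcon (D.bag i) f (D.card_bag_le i) (by
      intro u v huv hu hv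
      obtain ⟨y, hyu, hyv⟩ := D.covers u v huv
      have : (D.tree.deleteIncidenceSet i).connectedComponentMk (node u) =
          (D.tree.deleteIncidenceSet i).connectedComponentMk (node v) :=
        SimpleGraph.ConnectedComponent.sound ((hreach i u hu y hyu).trans (hreach i v hv y hyv).symm)
      simp only [f, this])
    have hpos : 0 < (W.filter fun v => v ∉ D.bag i ∧ f v = k).card := by omega
    obtain ⟨v, hv⟩ := Finset.card_pos.1 hpos
    rw [Finset.mem_filter] at hv
    refine ⟨node v, ?_, hk.trans_le (Nat.mul_le_mul_left 2 (Finset.card_le_card ?_))⟩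
    · intro h
      exact hv.2.1 (h ▸ hnode v)
    · intro u hu
      rw [Finset.mem_filter] at hu ⊢
      refine ⟨hu.1, hu.2.1, ?_⟩
      have h1 : f v = f u := hv.2.2.trans hu.2.2.symm
      have h2 := congrArg (D.tree.deleteIncidenceSet i).connectedComponentMk h1
      simp only [f] at h2
      have h3 : ∀ C : (D.tree.deleteIncidenceSet i).ConnectedComponent,
          (D.tree.deleteIncidenceSet i).connectedComponentMk C.out = C := fun C => Quot.out_eq C
      rw [h3, h3] at h2
      exact SimpleGraph.ConnectedComponent.exact h2
  choose x hx hbig using hheavy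
  obtain ⟨i, j, hdisj⟩ := D.isTree.exists_disjoint_components x hx
  have hd : Disjoint (W.filter fun v => v ∉ D.bag i ∧
      (D.tree.deleteIncidenceSet i).Reachable (x i) (node v)) (W.filter fun v => v ∉ D.bag j ∧
      (D.tree.deleteIncidenceSet j).Reachable (x j) (node v)) := by
    rw [Finset.disjoint_left]
    intro v h1 h2
    rw [Finset.mem_filter] at h1 h2
    exact hdisj _ h1.2.2 h2.2.2
  have h1 := Finset.card_union_of_disjoint hd
  have h2 := Finset.card_le_card (Finset.union_subset
    (Finset.filter_subset (fun v => v ∉ D.bag i ∧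
      (D.tree.deleteIncidenceSet i).Reachable (x i) (node v)) W)
    (Finset.filter_subset (fun v => v ∉ D.bag j ∧
      (D.tree.deleteIncidenceSet j).Reachable (x j) (node v)) W))
  have h3 := hbig i
  have h4 := hbig j
  omega

/-- A graph on a finite nonempty vertex set has a tree-decomposition of optimal width, and this
width is less than the number of vertices. -/
theorem exists_treeDecomposition_width_eq {V : Type*} [Fintype V] [Nonempty V]
    (G : SimpleGraph V) : (∃ D : TreeDecomposition G, D.width = treewidth G) ∧
      treewidth G + 1 ≤ Fintype.card V := by
  let D : TreeDecomposition G :=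
    { size := 1
      tree := ⊥
      isTree := SimpleGraph.IsTree.of_subsingleton
      bag := fun _ => Finset.univ
      connected := by
        intro v
        have : Nonempty {i : Fin 1 | v ∈ (Finset.univ : Finset V)} := ⟨⟨0, Finset.mem_univ v⟩⟩
        exact SimpleGraph.IsTree.of_subsingleton.connected
      covers := fun u v _ => ⟨0, Finset.mem_univ u, Finset.mem_univ v⟩ }
  refine ⟨Nat.sInf_mem (s := Set.range fun D : TreeDecomposition G => D.width) ⟨_, D, rfl⟩, ?_⟩
  have h1 : treewidth G ≤ D.width := Nat.sInf_le ⟨D, rfl⟩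
  have h2 : D.width ≤ Fintype.card V - 1 := by
    refine Nat.sub_le_sub_right (Finset.sup_le fun i _ => ?_) 1
    exact Finset.card_le_univ _
  have h3 : 0 < Fintype.card V := Fintype.card_pos
  omega

/-! ### Lower sets with prescribed vertices -/

open Classical in
theorem lowerSetWeight_eq_sum_ite {P : Type*} [PartialOrder P] [Fintype P] (wt : P → ℝ × ℝ)
    (L : LowerSet P) : lowerSetWeight wt L = ∑ x, if x ∈ L then wt x else 0 := by
  rw [lowerSetWeight, Finset.sum_filter]

theorem finite_range_lowerSetWeight {P : Type*} [PartialOrder P] [Fintype P] (wt : P → ℝ × ℝ) :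
    (Set.range (lowerSetWeight wt)).Finite := by
  have : Finite (LowerSet P) :=
    Finite.of_injective (fun L : LowerSet P => (L : Set P)) SetLike.coe_injective
  exact Set.finite_range _

namespace IncidencePoset

variable {V : Type*} {G : SimpleGraph V}

theorem vertex_le_vertex_iff {u v : V} :
    (vertex u : IncidencePoset G) ≤ vertex v ↔ u = v := by
  constructor
  · rintro (h | ⟨v', e, h1, h2, h3⟩)
    · exact IncidencePoset.vertex.inj h
    · cases h2
  · rintro rfl
    exact le_rfl

theorem vertex_le_edge_iff {u : V} {e : G.edgeSet} :
    (vertex u : IncidencePoset G) ≤ edge e ↔ u ∈ (e : Sym2 V) := by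
  constructor
  · rintro (h | ⟨v', e', h1, h2, h3⟩)
    · cases h
    · cases h1
      cases h2
      exact h3
  · intro h
    exact Or.inr ⟨u, e, rfl, rfl, h⟩

theorem eq_or_eq_vertex_of_le {x y : IncidencePoset G} (h : x ≤ y) :
    x = y ∨ ∃ v, x = vertex v := by
  rcases h with h | ⟨v, e, h, -, -⟩
  · exact Or.inl h
  · exact Or.inr ⟨v, h⟩

theorem eq_or_adj_of_le_of_le {u v : V} {x : IncidencePoset G} (hu : vertex u ≤ x)
    (hv : vertex v ≤ x) : u = v ∨ G.Adj u v := by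
  cases x with
  | vertex w =>
    rw [vertex_le_vertex_iff] at hu hv
    exact Or.inl (hu.trans hv.symm)
  | edge e =>
    rw [vertex_le_edge_iff] at hu hv
    by_cases huv : u = v
    · exact Or.inl huv
    · right
      have he := e.2
      rw [(Sym2.mem_and_mem_iff huv).1 ⟨hu, hv⟩] at he
      exact he

/-- The elements of `L` above no vertex of `Z`. -/
def avoid (L : LowerSet (IncidencePoset G)) (Z : Finset V) : LowerSet (IncidencePoset G) where
  carrier := {x | x ∈ L ∧ ∀ z ∈ Z, ¬ vertex z ≤ x}
  lower' := fun _ _ hba ha => ⟨L.lower hba ha.1, fun z hz h => ha.2 z hz (h.trans hba)⟩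

theorem mem_avoid {L : LowerSet (IncidencePoset G)} {Z : Finset V} {x : IncidencePoset G} :
    x ∈ avoid L Z ↔ x ∈ L ∧ ∀ z ∈ Z, ¬ vertex z ≤ x := Iff.rfl

variable [Fintype V]

/-- The weights of the lower sets that contain the vertices of `I` and none of those of `O`. -/
def weightsBetween (wt : IncidencePoset G → ℝ × ℝ) (I O : Finset V) : Set (ℝ × ℝ) :=
  {p | ∃ L : LowerSet (IncidencePoset G), (∀ v ∈ I, vertex v ∈ L) ∧ (∀ v ∈ O, vertex v ∉ L) ∧
    lowerSetWeight wt L = p}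

theorem finite_weightsBetween (wt : IncidencePoset G → ℝ × ℝ) (I O : Finset V) :
    (weightsBetween wt I O).Finite :=
  (finite_range_lowerSetWeight wt).subset fun _ ⟨L, _, _, h⟩ => ⟨L, h⟩

theorem weightsBetween_empty (wt : IncidencePoset G → ℝ × ℝ) :
    weightsBetween wt ∅ ∅ = Set.range (lowerSetWeight wt) := by
  ext p
  simp [weightsBetween]

theorem weightsBetween_eq_iUnion [DecidableEq V] (wt : IncidencePoset G → ℝ × ℝ)
    (I O X : Finset V) : weightsBetween wt I O =
      ⋃ S ∈ X.powerset, weightsBetween wt (I ∪ S) (O ∪ (X \ S)) := by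
  classical
  ext p
  simp only [Set.mem_iUnion, exists_prop]
  constructor
  · rintro ⟨L, hI, hO, rfl⟩
    refine ⟨X.filter fun v => vertex v ∈ L, by simp, L, ?_, ?_, rfl⟩
    · intro v hv
      rcases Finset.mem_union.1 hv with h | h
      · exact hI v h
      · exact (Finset.mem_filter.1 h).2
    · intro v hv
      rcases Finset.mem_union.1 hv with h | h
      · exact hO v h
      · rw [Finset.mem_sdiff, Finset.mem_filter] at h
        exact fun h' => h.2 ⟨h.1, h'⟩
  · rintro ⟨S, -, L, hI, hO, rfl⟩
    exact ⟨L, fun v hv => hI v (Finset.mem_union_left _ hv),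
      fun v hv => hO v (Finset.mem_union_left _ hv), rfl⟩

/-- Exchange argument. Given a competitor L' without vertices of Z, add to it the elements of L
above Z. The hypothesis on the neighbours of Z makes the result M a lower set, and M and `avoid L Z`
together weigh as much as L and L'. Since M does not reach the value of L, L' does not reach that of
`avoid L Z`. -/
theorem isStrictMaxAt_avoid [DecidableEq V] (wt : IncidencePoset G → ℝ × ℝ) {I O Z : Finset V}
    (hIZ : Disjoint I Z) (hZ : ∀ u v, G.Adj u v → v ∈ Z → u ∈ I ∨ u ∈ O ∨ u ∈ Z) {l : ℝ}
    {L : LowerSet (IncidencePoset G)} (hI : ∀ v ∈ I, vertex v ∈ L) (hO : ∀ v ∈ O, vertex v ∉ L)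
    (hL : IsStrictMaxAt (weightsBetween wt I O) l (lowerSetWeight wt L)) :
    IsStrictMaxAt (weightsBetween wt I (O ∪ Z)) l (lowerSetWeight wt (avoid L Z)) := by
  classical
  refine ⟨⟨avoid L Z, ?_, ?_, rfl⟩, ?_⟩
  · intro v hv
    refine ⟨hI v hv, fun z hz h => ?_⟩
    rw [vertex_le_vertex_iff] at h
    exact Finset.disjoint_left.1 hIZ hv (h ▸ hz)
  · intro v hv h
    rcases Finset.mem_union.1 hv with hv | hv
    · exact hO v hv h.1
    · exact h.2 v hv le_rfl
  · rintro _ ⟨L', hI', hO', rfl⟩ hne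
    let M : LowerSet (IncidencePoset G) :=
      { carrier := {x | (x ∈ L ∧ ∃ z ∈ Z, vertex z ≤ x) ∨ x ∈ L'}
        lower' := by
          rintro x y hyx (⟨hx, z, hz, hzx⟩ | hx)
          · rcases eq_or_eq_vertex_of_le hyx with rfl | ⟨u, rfl⟩
            · exact Or.inl ⟨hx, z, hz, hzx⟩
            · have huL : vertex u ∈ L := L.lower hyx hx
              by_cases huZ : u ∈ Z
              · exact Or.inl ⟨huL, u, huZ, le_rfl⟩
              · rcases eq_or_adj_of_le_of_le hyx hzx with rfl | hadj
                · exact absurd hz huZ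
                · rcases hZ u z hadj hz with h | h | h
                  · exact Or.inr (hI' u h)
                  · exact absurd huL (hO u h)
                  · exact absurd h huZ
          · exact Or.inr (L'.lower hyx hx) }
    have hM : ∀ x, x ∈ M ↔ (x ∈ L ∧ ∃ z ∈ Z, vertex z ≤ x) ∨ x ∈ L' := fun x => Iff.rfl
    have hL' : ∀ x ∈ L', ∀ z ∈ Z, ¬ vertex z ≤ x := fun x hx z hz h =>
      hO' z (Finset.mem_union_right _ hz) (L'.lower h hx)
    have hsum : lowerSetWeight wt M + lowerSetWeight wt (avoid L Z) =
        lowerSetWeight wt L + lowerSetWeight wt L' := by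
      simp only [lowerSetWeight_eq_sum_ite, ← Finset.sum_add_distrib]
      refine Finset.sum_congr rfl fun x _ => ?_
      by_cases hx : x ∈ L <;> by_cases hx' : x ∈ L' <;> by_cases hz : ∃ z ∈ Z, vertex z ≤ x <;>
        simp_all [mem_avoid]
    have hMmem : lowerSetWeight wt M ∈ weightsBetween wt I O :=
      ⟨M, fun v hv => Or.inr (hI' v hv), fun v hv h => by
        rcases h with h | h
        · exact hO v hv h.1
        · exact hO' v (Finset.mem_union_left _ hv) h, rfl⟩
    have h := hL.2 _ hMmem (by
      intro h
      rw [h] at hsum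
      exact hne (add_left_cancel hsum).symm)
    have h1 := congrArg Prod.fst hsum
    have h2 := congrArg Prod.snd hsum
    simp only [Prod.fst_add, Prod.snd_add] at h1 h2
    have e1 : (lowerSetWeight wt M).1 = (lowerSetWeight wt L).1 + (lowerSetWeight wt L').1 -
      (lowerSetWeight wt (avoid L Z)).1 := by linarith
    have e2 : (lowerSetWeight wt M).2 = (lowerSetWeight wt L).2 + (lowerSetWeight wt L').2 -
      (lowerSetWeight wt (avoid L Z)).2 := by linarith
    rw [e1, e2] at h
    linarith

/-- The slopes for parts without edges between them add up. -/
theorem ncard_supportSlopes_le_of_parts [DecidableEq V] {ι : Type*} [DecidableEq ι]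
    (wt : IncidencePoset G → ℝ × ℝ) {I O W : Finset V} (hIW : Disjoint I W)
    (hcov : ∀ v, v ∈ I ∨ v ∈ O ∨ v ∈ W) (f : V → ι)
    (hf : ∀ u v, G.Adj u v → u ∈ W → v ∈ W → f u = f v) :
    (supportSlopes (weightsBetween wt I O)).ncard ≤
      (supportSlopes (weightsBetween wt I (O ∪ W))).ncard + 1 + ∑ k ∈ W.image f,
        (supportSlopes (weightsBetween wt I (O ∪ W.filter fun v => f v ≠ k))).ncard := by
  classical
  -- The index `none` stands for the base problem that excludes all of W, and `some k` for the
  -- problem that leaves only the part k undecided.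
  let Z : Option ι → Finset V := fun k => W.filter fun v => ∀ k', k = some k' → f v ≠ k'
  have hZn : Z none = W := by simp [Z]
  have hZs : ∀ k, Z (some k) = W.filter fun v => f v ≠ k := by
    intro k
    simp only [Z, Option.some.injEq, forall_eq']
  have hmain := ncard_supportSlopes_le_sum_add_one (Finset.insertNone (W.image f))
    (weightsBetween wt I O) (fun k => weightsBetween wt I (O ∪ Z k))
    (fun k _ => finite_weightsBetween _ _ _)
    -- An element of L above a vertex of W is above vertices of one part only. So the weight of L is
    -- that of the base plus the increments contributed by the parts.
    (fun y => y none + ∑ k ∈ W.image f, (y (some k) - y none)) ?_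
  · rw [Finset.sum_insertNone] at hmain
    simp only [hZn, hZs] at hmain
    omega
  · intro l a ha
    obtain ⟨L, hI, hO, rfl⟩ := ha.1
    refine ⟨fun k => lowerSetWeight wt (avoid L (Z k)), fun k _ => ?_, fun y hy => ?_⟩
    · refine isStrictMaxAt_avoid wt (hIW.mono_right (Finset.filter_subset _ _)) ?_ hI hO ha
      intro u v huv hv
      rcases hcov u with h | h | h
      · exact Or.inl h
      · exact Or.inr (Or.inl h)
      · refine Or.inr (Or.inr ?_)
        simp only [Finset.mem_filter] at hv ⊢
        refine ⟨h, fun k' hk' => ?_⟩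
        rw [hf u v huv h hv.1]
        exact hv.2 k' hk'
    · have hy0 := hy none (by simp)
      have hyk : ∀ k ∈ W.image f, y (some k) = (lowerSetWeight wt (avoid L (Z (some k)))).2 :=
        fun k hk => hy (some k) (by rwa [Finset.some_mem_insertNone])
      rw [hy0, Finset.sum_congr rfl fun k hk => by rw [hyk k hk]]
      simp only [lowerSetWeight_eq_sum_ite, Prod.snd_sum, ← Finset.sum_sub_distrib]
      rw [Finset.sum_comm, ← Finset.sum_add_distrib]
      refine Finset.sum_congr rfl fun x _ => ?_
      by_cases hx : x ∈ L
      · by_cases hw : ∃ w ∈ W, vertex w ≤ x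
        · obtain ⟨w, hw, hwx⟩ := hw
          have hnone : x ∉ avoid L (Z none) := fun h => h.2 w (by rwa [hZn]) hwx
          rw [Finset.sum_eq_single (f w)]
          · have hmem : x ∈ avoid L (Z (some (f w))) := by
              refine ⟨hx, fun z hz hzx => ?_⟩
              rw [hZs, Finset.mem_filter] at hz
              rcases eq_or_adj_of_le_of_le hzx hwx with rfl | hadj
              · exact hz.2 rfl
              · exact hz.2 (hf z w hadj hz.1 hw)
            simp [hx, hnone, hmem]
          · intro k _ hk
            have hmem : x ∉ avoid L (Z (some k)) := fun h =>
              h.2 w (by rw [hZs, Finset.mem_filter]; exact ⟨hw, hk.symm⟩) hwx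
            simp [hnone, hmem]
          · intro h
            exact absurd (Finset.mem_image_of_mem f hw) h
        · push Not at hw
          have hmem : ∀ k, x ∈ avoid L (Z k) := fun k =>
            ⟨hx, fun z hz => hw z (Finset.mem_filter.1 hz).1⟩
          simp [hx, hmem]
      · have hmem : ∀ k, x ∉ avoid L (Z k) := fun k h => hx h.1
        simp [hx, hmem]

/-- With all vertices prescribed, the polygon is a sum of segments. -/
theorem ncard_supportSlopes_le_of_cover [Nonempty V] (wt : IncidencePoset G → ℝ × ℝ)
    {I O : Finset V} (hcov : ∀ v, v ∈ I ∨ v ∈ O) :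
    (supportSlopes (weightsBetween wt I O)).ncard ≤ Fintype.card V ^ 2 := by
  classical
  -- The edges with all endpoints in I. Each of them can be taken or left independently, which
  -- contributes the segment from 0 to its weight.
  let J : Finset (IncidencePoset G) :=
    Finset.univ.filter fun x => (∃ e, x = edge e) ∧ ∀ v, vertex v ≤ x → v ∈ I
  have hmain := ncard_supportSlopes_le_sum_add_one J (weightsBetween wt I O)
    (fun x => {0, wt x}) (fun x _ => Set.toFinite _)
    (fun y => ∑ x, if x ∈ J then y x else if ∃ v ∈ I, x = vertex v then (wt x).2 else 0) ?_
  · have h2 : ∀ x ∈ J, (supportSlopes {0, wt x}).ncard ≤ 2 := by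
      intro x _
      refine (Set.ncard_le_ncard (supportSlopes_subset _) (Set.toFinite _)).trans ?_
      refine (Set.ncard_image_le (Set.toFinite _)).trans ?_
      exact (Set.ncard_insert_le _ _).trans (by simp)
    have h3 := Finset.sum_le_card_nsmul J _ 2 h2
    have h4 : J.card ≤ Fintype.card G.edgeSet := by
      have hsub : J ⊆ Finset.univ.image (edge : G.edgeSet → IncidencePoset G) := by
        intro x hx
        obtain ⟨e, rfl⟩ := (Finset.mem_filter.1 hx).2.1
        exact Finset.mem_image_of_mem _ (Finset.mem_univ e)
      exact (Finset.card_le_card hsub).trans (Finset.card_image_le.trans (by simp))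
    have h5 : Fintype.card G.edgeSet ≤ (Fintype.card V).choose 2 := by
      rw [← SimpleGraph.edgeFinset_card]
      exact G.card_edgeFinset_le_card_choose_two
    -- A segment has at most two slopes, so the additive bound is 2 * |J| + 1.
    have h6 : 2 * (Fintype.card V).choose 2 + 1 ≤ Fintype.card V ^ 2 := by
      have hpos : 0 < Fintype.card V := Fintype.card_pos
      obtain ⟨k, hk⟩ := Nat.exists_eq_succ_of_ne_zero hpos.ne'
      have := Nat.div_mul_le_self (Fintype.card V * (Fintype.card V - 1)) 2
      rw [Nat.choose_two_right, hk] at *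
      simp only [Nat.succ_eq_add_one, Nat.add_sub_cancel] at *
      nlinarith
    rw [smul_eq_mul] at h3
    omega
  · intro l a ha
    obtain ⟨L, hI, hO, rfl⟩ := ha.1
    refine ⟨fun x => if x ∈ L then wt x else 0, fun x hx => ?_, fun y hy => ?_⟩
    · obtain ⟨⟨e, rfl⟩, he⟩ := (Finset.mem_filter.1 hx).2
      refine ⟨by simp only []; split_ifs <;> simp, fun c hc hne => ?_⟩
      -- L with the edge e toggled; comparing it with L shows that L makes the strictly better of
      -- the two choices for e.
      let M : LowerSet (IncidencePoset G) :=
        { carrier := {x | (x ≠ edge e ∧ x ∈ L) ∨ (x = edge e ∧ edge e ∉ L)}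
          lower' := by
            rintro x y hyx hx
            rcases eq_or_eq_vertex_of_le hyx with rfl | ⟨u, rfl⟩
            · exact hx
            · rcases hx with hx | hx
              · exact Or.inl ⟨by simp, L.lower hyx hx.2⟩
              · refine Or.inl ⟨by simp, hI u (he u ?_)⟩
                rw [← hx.1]
                exact hyx }
      have hM : ∀ x, x ∈ M ↔ (x ≠ edge e ∧ x ∈ L) ∨ (x = edge e ∧ edge e ∉ L) := fun x => Iff.rfl
      have hsum : lowerSetWeight wt M + (if edge e ∈ L then wt (edge e) else 0) =
          lowerSetWeight wt L + (if edge e ∈ L then 0 else wt (edge e)) := by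
        simp only [lowerSetWeight_eq_sum_ite]
        rw [← Finset.add_sum_erase _ _ (Finset.mem_univ (edge e)),
          ← Finset.add_sum_erase (Finset.univ : Finset (IncidencePoset G))
            (fun x => if x ∈ L then wt x else 0) (Finset.mem_univ (edge e))]
        have hrest : ∑ x ∈ Finset.univ.erase (edge e), (if x ∈ M then wt x else 0) =
            ∑ x ∈ Finset.univ.erase (edge e), (if x ∈ L then wt x else 0) := by
          refine Finset.sum_congr rfl fun x hx => ?_
          have := Finset.ne_of_mem_erase hx
          simp [hM, this]
        rw [hrest]
        by_cases h : edge e ∈ L <;> simp [hM, h, add_comm]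
      have hMmem : lowerSetWeight wt M ∈ weightsBetween wt I O :=
        ⟨M, fun v hv => Or.inl ⟨by simp, hI v hv⟩, fun v hv h => by
          rcases h with h | h
          · exact hO v hv h.2
          · exact absurd h.1 (by simp), rfl⟩
      have hc' : c = if edge e ∈ L then 0 else wt (edge e) := by
        rw [Set.mem_insert_iff, Set.mem_singleton_iff] at hc
        by_cases h : edge e ∈ L
        · simp only [h, if_true] at hne ⊢
          exact hc.resolve_right hne
        · simp only [h, if_false] at hne ⊢
          exact hc.resolve_left hne
      rw [← hc'] at hsum
      have h := ha.2 _ hMmem (by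
        intro h
        rw [h] at hsum
        exact hne (add_left_cancel hsum).symm)
      have h1 := congrArg Prod.fst hsum
      have h2 := congrArg Prod.snd hsum
      simp only [Prod.fst_add, Prod.snd_add] at h1 h2
      have e1 := eq_sub_of_add_eq h1
      have e2 := eq_sub_of_add_eq h2
      rw [e1, e2] at h
      linarith
    · rw [lowerSetWeight_eq_sum_ite, Prod.snd_sum]
      refine Finset.sum_congr rfl fun x _ => ?_
      by_cases hxJ : x ∈ J
      · simp only [hxJ, if_true]
        exact (hy x hxJ).symm
      · simp only [hxJ, if_false]
        cases x with
        | vertex v =>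
          by_cases hv : v ∈ I
          · simp [hv, hI v hv]
          · have := hO v ((hcov v).resolve_left hv)
            simp [hv, this]
        | edge e =>
          have he : edge e ∉ L := by
            intro he
            refine hxJ (Finset.mem_filter.2 ⟨Finset.mem_univ _, ⟨e, rfl⟩, fun v hv => ?_⟩)
            exact (hcov v).resolve_right fun h => hO v h (L.lower hv he)
          simp [he]

/-- Divide and conquer on the number k of undecided vertices. Deciding the separator costs a factor
2 ^ (width + 1). Of the remaining problem, the fully decided base and the extra one cost at most K,
and the parts have sizes at most k / 2 with sum at most k. Halving the argument of a power with
exponent width + 3 pays for the separator and leaves a factor 4 to absorb K and the sum over the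
parts. -/
theorem ncard_supportSlopes_weightsBetween_le [DecidableEq V] [Nonempty V]
    (wt : IncidencePoset G → ℝ × ℝ) (D : TreeDecomposition G) :
    ∀ (k : ℕ) (I O : Finset V), Disjoint I O → (Finset.univ \ (I ∪ O)).card = k → 1 ≤ k →
      (supportSlopes (weightsBetween wt I O)).ncard ≤
        (Fintype.card V ^ 2 + 1) * (2 * k) ^ (D.width + 3) := by
  intro k
  induction k using Nat.strong_induction_on with
  | _ k ih =>
  intro I O hdisj hk hk1
  set K := Fintype.card V ^ 2 + 1 with hK
  set W := Finset.univ \ (I ∪ O) with hW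
  obtain ⟨X, f, hX, hf, hhalf⟩ := D.exists_balanced_separator W
  rw [weightsBetween_eq_iUnion wt I O (X ∩ W)]
  refine (ncard_supportSlopes_iUnion_le _ _ _ (fun S _ => finite_weightsBetween wt _ _) rfl).trans ?_
  have hone : ∀ S ∈ (X ∩ W).powerset,
      (supportSlopes (weightsBetween wt (I ∪ S) (O ∪ ((X ∩ W) \ S)))).ncard ≤
        K + K * (2 * k ^ (D.width + 3)) := by
    intro S hS
    rw [Finset.mem_powerset] at hS
    set I' := I ∪ S with hI'
    set O' := O ∪ ((X ∩ W) \ S) with hO'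
    have hmemW : ∀ v, v ∈ W ↔ v ∉ I ∧ v ∉ O := by
      intro v
      simp [hW]
    have hmem' : ∀ v, v ∈ W \ X ↔ v ∉ I' ∧ v ∉ O' := by
      intro v
      have h1 := hmemW v
      have h2 : v ∈ S → v ∈ X ∧ v ∈ W := fun h => Finset.mem_inter.1 (hS h)
      simp only [hI', hO', Finset.mem_sdiff, Finset.mem_union, Finset.mem_inter]
      tauto
    have hdisj' : Disjoint I' O' := by
      rw [Finset.disjoint_left] at hdisj ⊢
      intro v
      have h1 := hmemW v
      have h2 : v ∈ S → v ∈ X ∧ v ∈ W := fun h => Finset.mem_inter.1 (hS h)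
      have h3 := @hdisj v
      simp only [hI', hO', Finset.mem_sdiff, Finset.mem_union, Finset.mem_inter]
      tauto
    have hparts := ncard_supportSlopes_le_of_parts wt (I := I') (O := O') (W := W \ X)
      (Finset.disjoint_left.2 fun v h1 h2 => ((hmem' v).1 h2).1 h1)
      (fun v => by have := hmem' v; tauto) f
      (fun u v huv hu hv => hf u v huv (Finset.mem_sdiff.1 hu).2 (Finset.mem_sdiff.1 hv).2)
    have hbase := ncard_supportSlopes_le_of_cover wt (I := I') (O := O' ∪ W \ X)
      (fun v => by
        have := hmem' v
        rw [Finset.mem_union (s := O') (t := W \ X)]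
        tauto)
    have hpart : ∀ c ∈ (W \ X).image f,
        (supportSlopes (weightsBetween wt I' (O' ∪ (W \ X).filter fun v => f v ≠ c))).ncard ≤
          K * (2 * k ^ (D.width + 2)) * ((W \ X).filter fun v => f v = c).card := by
      intro c hc
      have hfree : Finset.univ \ (I' ∪ (O' ∪ (W \ X).filter fun v => f v ≠ c)) =
          (W \ X).filter fun v => f v = c := by
        ext v
        have := hmem' v
        simp only [Finset.mem_sdiff (s := Finset.univ), Finset.mem_univ, true_and,
          Finset.mem_union, Finset.mem_filter]
        tauto
      have hcard := hhalf c
      have hfilter : (W.filter fun v => v ∉ X ∧ f v = c) = (W \ X).filter fun v => f v = c := by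
        ext v
        simp only [Finset.mem_filter, Finset.mem_sdiff, and_assoc]
      rw [hfilter, hk] at hcard
      have hpos : 1 ≤ ((W \ X).filter fun v => f v = c).card := by
        obtain ⟨v, hv, hvc⟩ := Finset.mem_image.1 hc
        exact Finset.card_pos.2 ⟨v, Finset.mem_filter.2 ⟨hv, hvc⟩⟩
      set q := ((W \ X).filter fun v => f v = c).card with hq
      refine (ih q (by omega) I' _ ?_ (by rw [hfree]) hpos).trans ?_
      · rw [Finset.disjoint_union_right]
        refine ⟨hdisj', Finset.disjoint_left.2 fun v h1 h2 => ?_⟩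
        exact ((hmem' v).1 (Finset.mem_filter.1 h2).1).1 h1
      -- One factor 2 * q is kept aside, so that the bounds of the parts are linear in their sizes
      -- and can be summed; the other factors are at most k.
      · have h1 : (2 * q) ^ (D.width + 2) ≤ k ^ (D.width + 2) := Nat.pow_le_pow_left hcard _
        calc K * (2 * q) ^ (D.width + 3) = K * ((2 * q) ^ (D.width + 2) * (2 * q)) := by
              rw [pow_succ]
          _ ≤ K * (k ^ (D.width + 2) * (2 * q)) :=
              Nat.mul_le_mul_left _ (Nat.mul_le_mul_right _ h1)
          _ = K * (2 * k ^ (D.width + 2)) * q := by ring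
    have hsum := Finset.sum_le_sum hpart
    rw [← Finset.mul_sum, ← Finset.card_eq_sum_card_image] at hsum
    have hWX : (W \ X).card ≤ k := hk ▸ Finset.card_le_card Finset.sdiff_subset
    have h2 : K * (2 * k ^ (D.width + 2)) * (W \ X).card ≤ K * (2 * k ^ (D.width + 3)) := by
      calc _ ≤ K * (2 * k ^ (D.width + 2)) * k := Nat.mul_le_mul_left _ hWX
        _ = _ := by ring
    omega
  refine (Finset.sum_le_card_nsmul _ _ _ hone).trans ?_
  rw [Finset.card_powerset, smul_eq_mul]
  have hXW : (X ∩ W).card ≤ D.width + 1 := (Finset.card_le_card Finset.inter_subset_left).trans hX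
  have h2 : 2 ^ (X ∩ W).card ≤ 2 ^ (D.width + 1) := Nat.pow_le_pow_right (by norm_num) hXW
  have h3 : 1 ≤ k ^ (D.width + 3) := Nat.one_le_pow _ _ hk1
  calc _ ≤ 2 ^ (D.width + 1) * (K + K * (2 * k ^ (D.width + 3))) := Nat.mul_le_mul_right _ h2
    _ ≤ 2 ^ (D.width + 1) * (K * (4 * k ^ (D.width + 3))) := by
        refine Nat.mul_le_mul_left _ ?_
        nlinarith
    _ = K * (2 * k) ^ (D.width + 3) := by
        rw [mul_pow]
        ring

/-- The polygon of the incidence poset of a graph of treewidth `w` on `n` vertices has `n ^ O(w)`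
vertices. -/
theorem ncard_extremePoints_polygon_le [Nonempty V] (wt : IncidencePoset G → ℝ × ℝ) :
    ((polygon wt).extremePoints ℝ).ncard ≤
      32 * Fintype.card V ^ (7 * max (treewidth G) 1) := by
  classical
  obtain ⟨⟨D, hD⟩, hw⟩ := exists_treeDecomposition_width_eq G
  set n := Fintype.card V with hn
  set w := treewidth G with hwdef
  have hpos : 1 ≤ n := by omega
  have hslopes : ∀ wt' : IncidencePoset G → ℝ × ℝ,
      (supportSlopes (Set.range (lowerSetWeight wt'))).ncard ≤ (n ^ 2 + 1) * (2 * n) ^ (w + 3) := by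
    intro wt'
    rw [← weightsBetween_empty, ← hD]
    refine ncard_supportSlopes_weightsBetween_le wt' D n ∅ ∅ (Finset.disjoint_empty_left _) ?_ hpos
    simp [hn]
  -- The mirror image is the point set of the reflected weights, so the bound on slopes applies to
  -- it as well.
  have hrefl : (fun a : ℝ × ℝ => (-a.1, a.2)) '' Set.range (lowerSetWeight wt) =
      Set.range (lowerSetWeight fun x => (-(wt x).1, (wt x).2)) := by
    rw [← Set.range_comp]
    congr 1
    funext L
    simp only [Function.comp, lowerSetWeight]
    ext <;> simp [Prod.fst_sum, Prod.snd_sum]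
  have hext := ncard_extremePoints_le (finite_range_lowerSetWeight wt)
  rw [hrefl] at hext
  have h1 := hslopes wt
  have h2 := hslopes fun x => (-(wt x).1, (wt x).2)
  have h3 : (n ^ 2 + 1) * (2 * n) ^ (w + 3) ≤ 16 * n ^ (7 * max w 1) := by
    have h4 : n ^ 2 + 1 ≤ 2 * n ^ 2 := by nlinarith
    -- For w ≥ 1 there are at least two vertices. Trading the base 2 for n keeps the leading
    -- constant independent of w.
    have h5 : 2 ^ w ≤ n ^ w := by
      rcases Nat.eq_zero_or_pos w with h | h
      · simp [h]
      · exact Nat.pow_le_pow_left (by omega) _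
    calc (n ^ 2 + 1) * (2 * n) ^ (w + 3) = (n ^ 2 + 1) * (8 * 2 ^ w * n ^ (w + 3)) := by
          rw [mul_pow]
          ring
      _ ≤ (2 * n ^ 2) * (8 * n ^ w * n ^ (w + 3)) := by gcongr
      _ = 16 * n ^ (2 * w + 5) := by ring
      _ ≤ 16 * n ^ (7 * max w 1) := by
          refine Nat.mul_le_mul_left _ (Nat.pow_le_pow_right hpos ?_)
          have := le_max_left w 1
          have := le_max_right w 1
          omega
  rw [polygon]
  omega

end IncidencePoset

/-! ### Maximum closures by preflow-push

The gain `a j` of an edge `j`, obtained when both endpoints are selected, is split between them;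
the excess of a vertex is its own weight plus its shares. Shares are pushed along edges towards
vertices of lower label, as in the preflow-push algorithm for maximum flows. -/

/-- `ex` holds the excesses, `xs` and `xt` the shares of the sources and targets of the edges, and
`d` the labels. -/
structure EdgeSplit (Γ : Type*) where
  ex : ℕ → Γ
  xs : ℕ → Γ
  xt : ℕ → Γ
  d : ℕ → ℕ

set_option linter.unusedSectionVars false

namespace EdgeSplit

variable {Γ : Type*} [AddCommGroup Γ] [LinearOrder Γ] [IsOrderedAddMonoid Γ]

/-- Exchange the two shares of each edge. -/
def swap (f : EdgeSplit Γ) : EdgeSplit Γ := ⟨f.ex, f.xt, f.xs, f.d⟩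

/-- Move the amount `δ` of edge `j` from its source to its target. -/
def push (src tgt : ℕ → ℕ) (f : EdgeSplit Γ) (j : ℕ) (δ : Γ) : EdgeSplit Γ where
  ex v := if v = tgt j then f.ex v + δ else if v = src j then f.ex v - δ else f.ex v
  xs i := if i = j then f.xs i - δ else f.xs i
  xt i := if i = j then f.xt i + δ else f.xt i
  d := f.d

def relabel (f : EdgeSplit Γ) (v : ℕ) : EdgeSplit Γ where
  ex := f.ex
  xs := f.xs
  xt := f.xt
  d u := if u = v then f.d u + 1 else f.d u

/-- The invariant of the algorithm. A vertex with negative excess stays at label 0, and an edge with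
a positive share at one end descends by at most one level towards the other end. -/
structure Valid (n m D : ℕ) (src tgt : ℕ → ℕ) (c a : ℕ → Γ) (f : EdgeSplit Γ) : Prop where
  xs_nonneg : ∀ j < m, 0 ≤ f.xs j
  xt_nonneg : ∀ j < m, 0 ≤ f.xt j
  split : ∀ j < m, f.xs j + f.xt j = a j
  excess : ∀ v < n, f.ex v = c v + ∑ j ∈ Finset.range m,
    ((if src j = v then f.xs j else 0) + if tgt j = v then f.xt j else 0)
  deficit : ∀ v < n, f.ex v < 0 → f.d v = 0
  label_le : ∀ v < n, f.d v ≤ D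
  label_src : ∀ j < m, 0 < f.xs j → f.d (src j) ≤ f.d (tgt j) + 1
  label_tgt : ∀ j < m, 0 < f.xt j → f.d (tgt j) ≤ f.d (src j) + 1

structure IsNetwork (n m : ℕ) (src tgt : ℕ → ℕ) : Prop where
  src_lt : ∀ j < m, src j < n
  tgt_lt : ∀ j < m, tgt j < n
  ne : ∀ j < m, src j ≠ tgt j

variable {n m D : ℕ} {src tgt : ℕ → ℕ} {c a : ℕ → Γ} {f : EdgeSplit Γ}

theorem IsNetwork.swap (h : IsNetwork n m src tgt) : IsNetwork n m tgt src :=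
  ⟨h.tgt_lt, h.src_lt, fun j hj => (h.ne j hj).symm⟩

theorem Valid.swap (h : Valid n m D src tgt c a f) : Valid n m D tgt src c a f.swap where
  xs_nonneg := h.xt_nonneg
  xt_nonneg := h.xs_nonneg
  split j hj := (add_comm _ _).trans (h.split j hj)
  excess v hv := by
    simp only [EdgeSplit.swap]
    rw [h.excess v hv]
    simp only [add_comm]
  deficit := h.deficit
  label_le := h.label_le
  label_src := h.label_tgt
  label_tgt := h.label_src

/-! #### The potential -/

def admissible (m : ℕ) (src tgt : ℕ → ℕ) (f : EdgeSplit Γ) : ℕ :=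
  ∑ j ∈ Finset.range m, ((if 0 < f.xs j ∧ f.d (src j) = f.d (tgt j) + 1 then 1 else 0) +
    if 0 < f.xt j ∧ f.d (tgt j) = f.d (src j) + 1 then 1 else 0)

def activeLabels (n : ℕ) (f : EdgeSplit Γ) : ℕ :=
  ∑ v ∈ Finset.range n, if 0 < f.ex v then f.d v else 0

def labelRoom (n D : ℕ) (f : EdgeSplit Γ) : ℕ := ∑ v ∈ Finset.range n, (D - f.d v)

/-- A quantity that decreases with each push and each relabelling. -/
def potential (n m D : ℕ) (src tgt : ℕ → ℕ) (f : EdgeSplit Γ) : ℕ :=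
  (2 * m * (D + 2) + 2) * labelRoom n D f + (D + 2) * admissible m src tgt f + activeLabels n f

theorem admissible_swap : admissible m tgt src f.swap = admissible m src tgt f := by
  simp only [admissible, swap, add_comm]

theorem potential_swap : potential n m D tgt src f.swap = potential n m D src tgt f := by
  rw [potential, potential, admissible_swap]
  rfl

theorem admissible_le : admissible m src tgt f ≤ 2 * m := by
  refine (Finset.sum_le_card_nsmul _ _ 2 fun j _ => ?_).trans (by simp [mul_comm])
  split_ifs <;> omega

theorem Valid.potential_le (h : Valid n m D src tgt c a f) :
    potential n m D src tgt f ≤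
      (2 * m * (D + 2) + 2) * (n * D) + (D + 2) * (2 * m) + n * D := by
  have h1 : labelRoom n D f ≤ n * D :=
    (Finset.sum_le_card_nsmul _ _ D fun v _ => Nat.sub_le _ _).trans (by simp)
  have h2 : activeLabels n f ≤ n * D := by
    refine (Finset.sum_le_card_nsmul _ _ D fun v hv => ?_).trans (by simp)
    have := h.label_le v (Finset.mem_range.1 hv)
    split_ifs <;> omega
  exact Nat.add_le_add (Nat.add_le_add (Nat.mul_le_mul_left _ h1)
    (Nat.mul_le_mul_left _ admissible_le)) h2

/-! #### Pushes -/

theorem Valid.push (h : Valid n m D src tgt c a f) (hN : IsNetwork n m src tgt) {j : ℕ}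
    (hj : j < m) {δ : Γ} (hδ : 0 ≤ δ) (hex : δ ≤ f.ex (src j)) (hxs : δ ≤ f.xs j)
    (hd : f.d (src j) = f.d (tgt j) + 1) : Valid n m D src tgt c a (f.push src tgt j δ) where
  xs_nonneg i hi := by
    simp only [EdgeSplit.push]
    split_ifs with h1
    · subst h1
      exact sub_nonneg.2 hxs
    · exact h.xs_nonneg i hi
  xt_nonneg i hi := by
    simp only [EdgeSplit.push]
    split_ifs with h1
    · exact add_nonneg (h.xt_nonneg i hi) hδ
    · exact h.xt_nonneg i hi
  split i hi := by
    rw [← h.split i hi]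
    simp only [EdgeSplit.push]
    split_ifs <;> abel
  excess v hv := by
    have hterm : ∀ i ∈ Finset.range m,
        ((if src i = v then (f.push src tgt j δ).xs i else 0) +
          if tgt i = v then (f.push src tgt j δ).xt i else 0) =
        ((if src i = v then f.xs i else 0) + if tgt i = v then f.xt i else 0) +
          if i = j then ((if src j = v then -δ else 0) + if tgt j = v then δ else 0) else 0 := by
      intro i _
      simp only [EdgeSplit.push]
      by_cases hij : i = j
      · subst hij
        simp only [if_true]
        split_ifs <;> abel
      · simp [hij]
    rw [Finset.sum_congr rfl hterm, Finset.sum_add_distrib, Finset.sum_ite_eq', ← add_assoc,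
      ← h.excess v hv, if_pos (Finset.mem_range.2 hj)]
    simp only [EdgeSplit.push]
    have hne := hN.ne j hj
    by_cases h1 : tgt j = v
    · have h2 : src j ≠ v := fun h2 => hne (h2.trans h1.symm)
      simp [h1, h2]
    · by_cases h2 : src j = v
      · simp [h1, h2, Ne.symm h1, sub_eq_add_neg]
      · simp [h1, h2, Ne.symm h1, Ne.symm h2]
  deficit v hv := by
    simp only [EdgeSplit.push]
    split_ifs with h1 h2
    · exact fun hlt => h.deficit v hv ((le_add_of_nonneg_right hδ).trans_lt hlt)
    · subst h2
      exact fun hlt => absurd hlt (not_lt.2 (sub_nonneg.2 hex))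
    · exact h.deficit v hv
  label_le := h.label_le
  label_src i hi := by
    simp only [EdgeSplit.push]
    split_ifs with h1
    · exact fun hlt => h.label_src i hi (hlt.trans_le (sub_le_self _ hδ))
    · exact h.label_src i hi
  label_tgt i hi := by
    simp only [EdgeSplit.push]
    split_ifs with h1
    · subst h1
      intro _
      omega
    · exact h.label_tgt i hi

/-- A push that uses up the excess deactivates the source, whose label exceeds that of the target by
one. A push that uses up the share removes an admissible pair, and its weight D + 2 exceeds the
label that a newly active target can add. The reverse direction does not become admissible, because
the labels descend towards the target. -/
theorem Valid.potential_push_lt (h : Valid n m D src tgt c a f) (hN : IsNetwork n m src tgt)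
    {j : ℕ} (hj : j < m) (hex : 0 < f.ex (src j)) (hxs : 0 < f.xs j)
    (hd : f.d (src j) = f.d (tgt j) + 1) :
    potential n m D src tgt (f.push src tgt j (min (f.ex (src j)) (f.xs j))) <
      potential n m D src tgt f := by
  set δ := min (f.ex (src j)) (f.xs j) with hδ
  set g := f.push src tgt j δ with hg
  have hδpos : 0 < δ := lt_min hex hxs
  have hroom : labelRoom n D g = labelRoom n D f := rfl
  have hadm : admissible m src tgt g + (if 0 < f.xs j - δ then 0 else 1) ≤
      admissible m src tgt f := by
    have hj' := Finset.mem_range.2 hj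
    rw [admissible, admissible, ← Finset.add_sum_erase _ _ hj',
      ← Finset.add_sum_erase _ (fun i => ((if 0 < f.xs i ∧ f.d (src i) = f.d (tgt i) + 1 then 1
        else 0) + if 0 < f.xt i ∧ f.d (tgt i) = f.d (src i) + 1 then 1 else 0)) hj']
    have hrest : ∀ i ∈ (Finset.range m).erase j,
        ((if 0 < g.xs i ∧ g.d (src i) = g.d (tgt i) + 1 then 1 else 0) +
          if 0 < g.xt i ∧ g.d (tgt i) = g.d (src i) + 1 then 1 else 0) =
        ((if 0 < f.xs i ∧ f.d (src i) = f.d (tgt i) + 1 then 1 else 0) +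
          if 0 < f.xt i ∧ f.d (tgt i) = f.d (src i) + 1 then 1 else 0) := by
      intro i hi
      have hij := Finset.ne_of_mem_erase hi
      simp [hg, EdgeSplit.push, hij]
    rw [Finset.sum_congr rfl hrest]
    have h1 : ¬ (f.d (tgt j) = f.d (src j) + 1) := by omega
    have h2 : g.d = f.d := rfl
    have h3 : g.xs j = f.xs j - δ := by simp [hg, EdgeSplit.push]
    rw [h2, h3]
    simp only [hd, hxs, and_true, if_true]
    split_ifs <;> omega
  have hact : activeLabels n g + (if 0 < f.ex (src j) - δ then 0 else f.d (src j)) ≤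
      activeLabels n f + f.d (tgt j) := by
    have hsum : activeLabels n g + ∑ v ∈ Finset.range n,
        (if v = src j then (if 0 < f.ex (src j) - δ then 0 else f.d (src j)) else 0) ≤
        activeLabels n f + ∑ v ∈ Finset.range n, if v = tgt j then f.d (tgt j) else 0 := by
      rw [activeLabels, activeLabels, ← Finset.sum_add_distrib, ← Finset.sum_add_distrib]
      refine Finset.sum_le_sum fun v _ => ?_
      have hne := hN.ne j hj
      have h2 : g.d = f.d := rfl
      rw [h2]
      by_cases h1 : v = tgt j
      · subst h1
        simp only [if_true, Ne.symm hne, if_false]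
        split_ifs <;> omega
      · by_cases h3 : v = src j
        · subst h3
          have h4 : g.ex (src j) = f.ex (src j) - δ := by simp [hg, EdgeSplit.push, hne]
          simp only [if_true, hne, if_false, h4, hex]
          split_ifs <;> omega
        · have h4 : g.ex v = f.ex v := by simp [hg, EdgeSplit.push, h1, h3]
          simp [h1, h3, h4]
    rwa [Finset.sum_ite_eq', Finset.sum_ite_eq', if_pos (Finset.mem_range.2 (hN.src_lt j hj)),
      if_pos (Finset.mem_range.2 (hN.tgt_lt j hj))] at hsum
  have hle := h.label_le _ (hN.tgt_lt j hj)
  rw [potential, potential, hroom]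
  rcases le_total (f.ex (src j)) (f.xs j) with h1 | h1
  · have h2 : ¬ (0 < f.ex (src j) - δ) := by simp [hδ, min_eq_left h1]
    rw [if_neg h2] at hact
    have h3 : (D + 2) * admissible m src tgt g ≤ (D + 2) * admissible m src tgt f :=
      Nat.mul_le_mul_left _ (by omega)
    omega
  · have h2 : ¬ (0 < f.xs j - δ) := by simp [hδ, min_eq_right h1]
    rw [if_neg h2] at hadm
    have h3 : (D + 2) * (admissible m src tgt g + 1) ≤ (D + 2) * admissible m src tgt f :=
      Nat.mul_le_mul_left _ hadm
    rw [Nat.mul_add] at h3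
    omega

/-! #### Relabellings -/

/-- As no admissible push leaves v, the label conditions at its positive shares are not tight and
leave room for one more unit. -/
theorem Valid.relabel (h : Valid n m D src tgt c a f) {v : ℕ} (hex : 0 < f.ex v) (hD : f.d v < D)
    (hs : ∀ j < m, src j = v → 0 < f.xs j → f.d v ≠ f.d (tgt j) + 1)
    (ht : ∀ j < m, tgt j = v → 0 < f.xt j → f.d v ≠ f.d (src j) + 1) :
    Valid n m D src tgt c a (f.relabel v) where
  xs_nonneg := h.xs_nonneg
  xt_nonneg := h.xt_nonneg
  split := h.split
  excess := h.excess
  deficit u hu hlt := by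
    have h1 : u ≠ v := by
      rintro rfl
      exact lt_asymm hex hlt
    simp only [EdgeSplit.relabel, h1, if_false]
    exact h.deficit u hu hlt
  label_le u hu := by
    have := h.label_le u hu
    simp only [EdgeSplit.relabel]
    split_ifs with h1
    · subst h1
      omega
    · exact this
  label_src j hj hpos := by
    have h1 := h.label_src j hj hpos
    have h2 := hs j hj
    simp only [EdgeSplit.relabel] at hpos ⊢
    split_ifs with h3 h4 h4
    · omega
    · have := h2 h3 hpos
      rw [← h3] at this
      omega
    · omega
    · exact h1
  label_tgt j hj hpos := by
    have h1 := h.label_tgt j hj hpos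
    have h2 := ht j hj
    simp only [EdgeSplit.relabel] at hpos ⊢
    split_ifs with h3 h4 h4
    · omega
    · have := h2 h3 hpos
      rw [← h3] at this
      omega
    · omega
    · exact h1

/-- A relabelling may create up to 2 * m admissible pairs and raises one active label by one. The
weight 2 * m * (D + 2) + 2 of a unit of label room exceeds both together. -/
theorem potential_relabel_lt {v : ℕ} (hv : v < n) (hD : f.d v < D) :
    potential n m D src tgt (f.relabel v) < potential n m D src tgt f := by
  have hv' := Finset.mem_range.2 hv
  have hroom : labelRoom n D (f.relabel v) + 1 = labelRoom n D f := by
    have : labelRoom n D (f.relabel v) + ∑ u ∈ Finset.range n, (if u = v then 1 else 0) =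
        labelRoom n D f := by
      rw [labelRoom, labelRoom, ← Finset.sum_add_distrib]
      refine Finset.sum_congr rfl fun u _ => ?_
      simp only [EdgeSplit.relabel]
      split_ifs with h1
      · subst h1
        omega
      · rfl
    rwa [Finset.sum_ite_eq', if_pos hv'] at this
  have hact : activeLabels n (f.relabel v) ≤ activeLabels n f + 1 := by
    have : activeLabels n (f.relabel v) ≤
        activeLabels n f + ∑ u ∈ Finset.range n, (if u = v then 1 else 0) := by
      rw [activeLabels, activeLabels, ← Finset.sum_add_distrib]
      refine Finset.sum_le_sum fun u _ => ?_
      change (if 0 < f.ex u then (if u = v then f.d u + 1 else f.d u) else 0) ≤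
        (if 0 < f.ex u then f.d u else 0) + if u = v then 1 else 0
      split_ifs <;> omega
    rwa [Finset.sum_ite_eq', if_pos hv'] at this
  have hadm : (D + 2) * admissible m src tgt (f.relabel v) ≤ (D + 2) * (2 * m) :=
    Nat.mul_le_mul_left _ admissible_le
  rw [potential, potential, ← hroom, Nat.mul_succ (2 * m * (D + 2) + 2)]
  have : 2 * m * (D + 2) = (D + 2) * (2 * m) := by ring
  have h0 := Nat.zero_le ((D + 2) * admissible m src tgt f)
  omega

/-! #### Optimality -/

/-- The weight of a set of vertices together with the edges it spans. -/
def closureValue (n m : ℕ) (src tgt : ℕ → ℕ) (c a : ℕ → Γ) (S : Finset ℕ) : Γ :=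
  (∑ v ∈ Finset.range n, if v ∈ S then c v else 0) +
    ∑ j ∈ Finset.range m, if src j ∈ S ∧ tgt j ∈ S then a j else 0

/-- Summed over S, the excesses count an edge inside S with its whole gain, and an edge with one end
in S only with the share of that end. -/
theorem Valid.closureValue_add (h : Valid n m D src tgt c a f) (hN : IsNetwork n m src tgt)
    (S : Finset ℕ) : closureValue n m src tgt c a S + ∑ j ∈ Finset.range m,
      ((if src j ∈ S ∧ tgt j ∉ S then f.xs j else 0) +
        if tgt j ∈ S ∧ src j ∉ S then f.xt j else 0) =
      ∑ v ∈ Finset.range n, if v ∈ S then f.ex v else 0 := by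
  have h1 : ∀ v ∈ Finset.range n, (if v ∈ S then f.ex v else 0) = (if v ∈ S then c v else 0) +
      ∑ j ∈ Finset.range m, ((if v = src j then (if v ∈ S then f.xs j else 0) else 0) +
        if v = tgt j then (if v ∈ S then f.xt j else 0) else 0) := by
    intro v hv
    rw [h.excess v (Finset.mem_range.1 hv)]
    by_cases hvS : v ∈ S
    · simp only [hvS, if_true, eq_comm]
    · simp [hvS]
  rw [Finset.sum_congr rfl h1, closureValue, add_assoc, ← Finset.sum_add_distrib]
  conv_rhs => rw [Finset.sum_add_distrib, Finset.sum_comm]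
  congr 1
  refine Finset.sum_congr rfl fun j hj => ?_
  have hj' := Finset.mem_range.1 hj
  rw [Finset.sum_add_distrib, Finset.sum_ite_eq', Finset.sum_ite_eq',
    if_pos (Finset.mem_range.2 (hN.src_lt j hj')), if_pos (Finset.mem_range.2 (hN.tgt_lt j hj')),
    ← h.split j hj']
  by_cases h2 : src j ∈ S <;> by_cases h3 : tgt j ∈ S <;> simp [h2, h3]

/-- By `closureValue_add` the value of S is at most the sum of the excesses over S. For T equality
holds: positive shares descend by at most one level and the level k is empty, so no share crosses
the boundary of T. Moreover T contains every vertex of positive excess and none of negative excess,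
so its sum of excesses is the largest possible. -/
theorem Valid.closureValue_le (h : Valid n m D src tgt c a f) (hN : IsNetwork n m src tgt)
    (hlabel : ∀ v < n, 0 < f.ex v → D ≤ f.d v) {k : ℕ} (hk : k < D) (hgap : ∀ v < n, f.d v ≠ k)
    (S T : Finset ℕ) (hT : ∀ v < n, v ∈ T ↔ k < f.d v) :
    closureValue n m src tgt c a S ≤ closureValue n m src tgt c a T := by
  have hS := h.closureValue_add hN S
  have hTv := h.closureValue_add hN T
  have hcut : ∑ j ∈ Finset.range m, ((if src j ∈ T ∧ tgt j ∉ T then f.xs j else 0) +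
      if tgt j ∈ T ∧ src j ∉ T then f.xt j else 0) = 0 := by
    refine Finset.sum_eq_zero fun j hj => ?_
    rw [Finset.mem_range] at hj
    have hs := hN.src_lt j hj
    have ht := hN.tgt_lt j hj
    simp only [hT _ hs, hT _ ht]
    have h1 : ¬ (k < f.d (src j) ∧ ¬ k < f.d (tgt j)) ∨ f.xs j = 0 := by
      by_contra hcon
      push Not at hcon
      have := h.label_src j hj (lt_of_le_of_ne (h.xs_nonneg j hj) (Ne.symm hcon.2))
      have := hgap _ ht
      omega
    have h2 : ¬ (k < f.d (tgt j) ∧ ¬ k < f.d (src j)) ∨ f.xt j = 0 := by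
      by_contra hcon
      push Not at hcon
      have := h.label_tgt j hj (lt_of_le_of_ne (h.xt_nonneg j hj) (Ne.symm hcon.2))
      have := hgap _ hs
      omega
    have h3 : (if k < f.d (src j) ∧ ¬ k < f.d (tgt j) then f.xs j else 0) = 0 := by
      split_ifs with h4
      · exact h1.resolve_left (not_not.2 h4)
      · rfl
    have h5 : (if k < f.d (tgt j) ∧ ¬ k < f.d (src j) then f.xt j else 0) = 0 := by
      split_ifs with h4
      · exact h2.resolve_left (not_not.2 h4)
      · rfl
    rw [h3, h5, add_zero]
  rw [hcut, add_zero] at hTv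
  have hnonneg : 0 ≤ ∑ j ∈ Finset.range m, ((if src j ∈ S ∧ tgt j ∉ S then f.xs j else 0) +
      if tgt j ∈ S ∧ src j ∉ S then f.xt j else 0) := by
    refine Finset.sum_nonneg fun j hj => ?_
    rw [Finset.mem_range] at hj
    have h1 := h.xs_nonneg j hj
    have h2 := h.xt_nonneg j hj
    refine add_nonneg ?_ ?_ <;> split_ifs <;> first | assumption | exact le_rfl
  calc closureValue n m src tgt c a S ≤ _ := le_add_of_nonneg_right hnonneg
    _ = _ := hS
    _ ≤ ∑ v ∈ Finset.range n, if v ∈ T then f.ex v else 0 := by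
        refine Finset.sum_le_sum fun v hv => ?_
        rw [Finset.mem_range] at hv
        have h1 := hlabel v hv
        have h2 := h.deficit v hv
        simp only [hT v hv]
        rcases lt_trichotomy (f.ex v) 0 with h3 | h3 | h3
        · have h4 : ¬ k < f.d v := by
            have := h2 h3
            omega
          rw [if_neg h4]
          split_ifs
          · exact h3.le
          · exact le_rfl
        · simp [h3]
        · have h4 : k < f.d v := by
            have := h1 h3
            omega
          rw [if_pos h4]
          split_ifs
          · exact le_rfl
          · exact h3.le
    _ = closureValue n m src tgt c a T := hTv.symm

end EdgeSplit

/-! ### Reasoning about real RAM programs -/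

namespace RealRAM

/-- Started in `s`, the program `p` halts within `B` steps in a state satisfying `Q`. -/
def Runs (p : Prog) (s : State) (B : ℕ) (Q : State → Prop) : Prop :=
  ∃ t s', Exec p s t s' ∧ t ≤ B ∧ Q s'

theorem Runs.mono {p : Prog} {s : State} {B B' : ℕ} {Q Q' : State → Prop} (h : Runs p s B Q)
    (hB : B ≤ B') (hQ : ∀ s', Q s' → Q' s') : Runs p s B' Q' := by
  obtain ⟨t, s', he, ht, hq⟩ := h
  exact ⟨t, s', he, ht.trans hB, hQ _ hq⟩

theorem Runs.seq {p q : Prog} {s : State} {B B' : ℕ} {Q : State → Prop} {R : State → Prop}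
    (h : Runs p s B R) (h' : ∀ s', R s' → Runs q s' B' Q) : Runs (Prog.seq p q) s (B + B') Q := by
  obtain ⟨t, s', he, ht, hq⟩ := h
  obtain ⟨t', s'', he', ht', hq'⟩ := h' s' hq
  exact ⟨t + t', s'', Exec.seq he he', Nat.add_le_add ht ht', hq'⟩

theorem Runs.branch {b : Test} {p q : Prog} {s : State} {B : ℕ} {Q : State → Prop}
    (h : b.Holds s → Runs p s B Q) (h' : ¬ b.Holds s → Runs q s B Q) :
    Runs (Prog.branch b p q) s (b.cost + 1 + B) Q := by
  by_cases hb : b.Holds s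
  · obtain ⟨t, s', he, ht, hq⟩ := h hb
    exact ⟨_, s', Exec.branchTrue hb he, Nat.add_le_add_left ht _, hq⟩
  · obtain ⟨t, s', he, ht, hq⟩ := h' hb
    exact ⟨_, s', Exec.branchFalse hb he, Nat.add_le_add_left ht _, hq⟩

/-- The measure bounds the number of iterations; the summand 1 pays for the final test, which fails.
-/
theorem Runs.loop {b : Test} {p : Prog} {B : ℕ} (I : State → Prop) (μ : State → ℕ)
    (h : ∀ s, I s → b.Holds s → Runs p s B fun s' => I s' ∧ μ s' < μ s) (s : State) (hs : I s) :
    Runs (Prog.loop b p) s ((μ s + 1) * (b.cost + 1 + B)) fun s' => I s' ∧ ¬ b.Holds s' := by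
  induction hk : μ s using Nat.strong_induction_on generalizing s with
  | _ k ih =>
  subst hk
  by_cases hb : b.Holds s
  · obtain ⟨t, s', he, ht, hI, hμ⟩ := h s hs hb
    obtain ⟨t', s'', he', ht', hq⟩ := ih (μ s') hμ s' hI rfl
    refine ⟨_, s'', Exec.loopTrue hb he he', ?_, hq⟩
    have h1 : (μ s' + 1) * (b.cost + 1 + B) ≤ μ s * (b.cost + 1 + B) := Nat.mul_le_mul_right _ hμ
    rw [Nat.succ_mul]
    omega
  · refine ⟨_, s, Exec.loopFalse hb, ?_, hs, hb⟩
    rw [Nat.succ_mul]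
    omega

/-! #### Memory outside the written arrays -/

def Prog.natWrites : Prog → List ℕ
  | skip => []
  | setNat a _ _ => [a]
  | setReal _ _ _ => []
  | seq p q => p.natWrites ++ q.natWrites
  | branch _ p q => p.natWrites ++ q.natWrites
  | loop _ p => p.natWrites

def Prog.realWrites : Prog → List ℕ
  | skip => []
  | setNat _ _ _ => []
  | setReal a _ _ => [a]
  | seq p q => p.realWrites ++ q.realWrites
  | branch _ p q => p.realWrites ++ q.realWrites
  | loop _ p => p.realWrites

/-- The names of arrays are fixed in the program text, so the arrays that a program leaves alone can
be read off syntactically. -/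
theorem Exec.frame {p : Prog} {s s' : State} {t : ℕ} (h : Exec p s t s') :
    (∀ a, a ∉ p.natWrites → s'.nat a = s.nat a) ∧
      ∀ a, a ∉ p.realWrites → s'.real a = s.real a := by
  induction h with
  | skip s => exact ⟨fun _ _ => rfl, fun _ _ => rfl⟩
  | setNat s a i e =>
    refine ⟨fun b hb => ?_, fun _ _ => rfl⟩
    have hba : b ≠ a := by simpa [Prog.natWrites] using hb
    funext k
    simp [State.writeNat, hba]
  | setReal s a i e =>
    refine ⟨fun _ _ => rfl, fun b hb => ?_⟩
    have hba : b ≠ a := by simpa [Prog.realWrites] using hb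
    funext k
    simp [State.writeReal, hba]
  | seq _ _ ih ih' =>
    refine ⟨fun b hb => ?_, fun b hb => ?_⟩
    · simp only [Prog.natWrites, List.mem_append, not_or] at hb
      rw [ih'.1 b hb.2, ih.1 b hb.1]
    · simp only [Prog.realWrites, List.mem_append, not_or] at hb
      rw [ih'.2 b hb.2, ih.2 b hb.1]
  | branchTrue _ _ ih =>
    refine ⟨fun b hb => ih.1 b ?_, fun b hb => ih.2 b ?_⟩
    · simp only [Prog.natWrites, List.mem_append, not_or] at hb
      exact hb.1
    · simp only [Prog.realWrites, List.mem_append, not_or] at hb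
      exact hb.1
  | branchFalse _ _ ih =>
    refine ⟨fun b hb => ih.1 b ?_, fun b hb => ih.2 b ?_⟩
    · simp only [Prog.natWrites, List.mem_append, not_or] at hb
      exact hb.2
    · simp only [Prog.realWrites, List.mem_append, not_or] at hb
      exact hb.2
  | loopTrue _ _ _ ih ih' =>
    exact ⟨fun b hb => (ih'.1 b hb).trans (ih.1 b hb), fun b hb => (ih'.2 b hb).trans (ih.2 b hb)⟩
  | loopFalse _ => exact ⟨fun _ _ => rfl, fun _ _ => rfl⟩

theorem Runs.frame {p : Prog} {s : State} {B : ℕ} {Q : State → Prop} (h : Runs p s B Q) :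
    Runs p s B fun s' => Q s' ∧ (∀ a, a ∉ p.natWrites → s'.nat a = s.nat a) ∧
      ∀ a, a ∉ p.realWrites → s'.real a = s.real a := by
  obtain ⟨t, s', he, ht, hq⟩ := h
  exact ⟨t, s', he, ht, hq, he.frame⟩

/-! #### Code without loops -/

def Prog.loopFree : Prog → Bool
  | skip => true
  | setNat _ _ _ => true
  | setReal _ _ _ => true
  | seq p q => p.loopFree && q.loopFree
  | branch _ p q => p.loopFree && q.loopFree
  | loop _ _ => false

/-- An upper bound for the running time of code without loops. -/
def Prog.bound : Prog → ℕ
  | skip => 1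
  | setNat _ i e => i.cost + e.cost + 1
  | setReal _ i e => i.cost + e.cost + 1
  | seq p q => p.bound + q.bound
  | branch b p q => b.cost + 1 + max p.bound q.bound
  | loop _ _ => 0

open Classical in
/-- The effect of code without loops. -/
noncomputable def Prog.run : Prog → State → State
  | skip, s => s
  | setNat a i e, s => s.writeNat a (i.eval s) (e.eval s)
  | setReal a i e, s => s.writeReal a (i.eval s) (e.eval s)
  | seq p q, s => q.run (p.run s)
  | branch b p q, s => if b.Holds s then p.run s else q.run s
  | loop _ _, s => s

theorem Prog.exec_run {p : Prog} (hp : p.loopFree = true) (s : State) :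
    ∃ t, Exec p s t (p.run s) ∧ t ≤ p.bound := by
  induction p generalizing s with
  | skip => exact ⟨_, Exec.skip s, le_rfl⟩
  | setNat a i e => exact ⟨_, Exec.setNat s a i e, le_rfl⟩
  | setReal a i e => exact ⟨_, Exec.setReal s a i e, le_rfl⟩
  | seq p q ihp ihq =>
    simp only [Prog.loopFree, Bool.and_eq_true] at hp
    obtain ⟨t, h1, h2⟩ := ihp hp.1 s
    obtain ⟨t', h1', h2'⟩ := ihq hp.2 (p.run s)
    exact ⟨_, Exec.seq h1 h1', Nat.add_le_add h2 h2'⟩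
  | branch b p q ihp ihq =>
    simp only [Prog.loopFree, Bool.and_eq_true] at hp
    by_cases hb : b.Holds s
    · obtain ⟨t, h1, h2⟩ := ihp hp.1 s
      refine ⟨_, ?_, Nat.add_le_add_left (h2.trans (le_max_left _ _)) _⟩
      simp only [Prog.run, if_pos hb]
      exact Exec.branchTrue hb h1
    · obtain ⟨t, h1, h2⟩ := ihq hp.2 s
      refine ⟨_, ?_, Nat.add_le_add_left (h2.trans (le_max_right _ _)) _⟩
      simp only [Prog.run, if_neg hb]
      exact Exec.branchFalse hb h1
  | loop b p ih => exact absurd hp (by simp [Prog.loopFree])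

/-- Correctness of loop-free code becomes a computation with `Prog.run`, and its cost a comparison
with the syntactic `Prog.bound`. -/
theorem Runs.of_loopFree {p : Prog} (hp : p.loopFree = true) {s : State} {B : ℕ}
    (hB : p.bound ≤ B) {Q : State → Prop} (hQ : Q (p.run s)) : Runs p s B Q := by
  obtain ⟨t, h1, h2⟩ := Prog.exec_run hp s
  exact ⟨t, _, h1, h2.trans hB, hQ⟩

theorem Prog.run_nat {p : Prog} (hp : p.loopFree = true) (s : State) {a : ℕ}
    (ha : a ∉ p.natWrites) : (p.run s).nat a = s.nat a := by
  obtain ⟨t, h, -⟩ := Prog.exec_run hp s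
  exact h.frame.1 a ha

/-! #### Counting loops -/

/-- Cell `0` of the array `i` of naturals. -/
def NatExpr.var (i : ℕ) : NatExpr := NatExpr.read i (NatExpr.const 0)

/-- Run `body` with `i = 0, …, N - 1`. -/
def Prog.forLoop (i : ℕ) (N : NatExpr) (body : Prog) : Prog :=
  Prog.seq (Prog.setNat i (NatExpr.const 0) (NatExpr.const 0))
    (Prog.loop (Test.not (Test.natLe N (NatExpr.var i)))
      (Prog.seq body (Prog.setNat i (NatExpr.const 0)
        (NatExpr.add (NatExpr.var i) (NatExpr.const 1)))))

/-- The invariant has to be insensitive to the counter cell (`hI`), as the loop overwrites it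
between two runs of the body. -/
theorem Runs.forLoop {i : ℕ} {N : NatExpr} {body : Prog} (hi : i ∉ body.natWrites) (n B : ℕ)
    (I : ℕ → State → Prop) (hI : ∀ k s v, I k s → I k (s.writeNat i 0 v))
    (hN : ∀ k s, I k s → N.eval s = n)
    (hbody : ∀ k < n, ∀ s, I k s → s.nat i 0 = k → Runs body s B (I (k + 1)))
    (s : State) (hs : I 0 s) :
    Runs (Prog.forLoop i N body) s ((n + 1) * (B + N.cost + 14)) (I n) := by
  have hinit : Runs (Prog.setNat i (NatExpr.const 0) (NatExpr.const 0)) s 3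
      fun s' => I 0 s' ∧ s'.nat i 0 = 0 := by
    refine Runs.of_loopFree rfl le_rfl ⟨hI _ _ _ hs, ?_⟩
    simp [Prog.run, State.writeNat, NatExpr.eval]
  have hloop := fun s' (h : I 0 s' ∧ s'.nat i 0 = 0) => Runs.loop
    (b := Test.not (Test.natLe N (NatExpr.var i)))
    (p := Prog.seq body (Prog.setNat i (NatExpr.const 0)
      (NatExpr.add (NatExpr.var i) (NatExpr.const 1)))) (B := B + 6)
    (fun s => s.nat i 0 ≤ n ∧ I (s.nat i 0) s) (fun s => n - s.nat i 0) (by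
      rintro s ⟨-, hIs⟩ hb
      have hlt : s.nat i 0 < n := by
        simp only [Test.Holds, hN _ _ hIs, NatExpr.var, NatExpr.eval, not_le] at hb
        exact hb
      refine Runs.seq (hbody _ hlt s hIs rfl).frame fun s' hs' => ?_
      refine Runs.of_loopFree rfl le_rfl ?_
      have hi' := congrFun (hs'.2.1 i hi) 0
      have heq : (Prog.setNat i (NatExpr.const 0)
          (NatExpr.add (NatExpr.var i) (NatExpr.const 1))).run s' =
          s'.writeNat i 0 (s.nat i 0 + 1) := by
        simp [Prog.run, NatExpr.eval, NatExpr.var, hi']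
      rw [heq]
      have hval : (s'.writeNat i 0 (s.nat i 0 + 1)).nat i 0 = s.nat i 0 + 1 := by
        simp [State.writeNat]
      rw [hval]
      exact ⟨⟨hlt, hI _ _ _ hs'.1⟩, by omega⟩) s' ⟨by omega, h.2.symm ▸ h.1⟩
  refine (Runs.seq hinit fun s' h => ((hloop s' h).mono (B' := (n + 1) * (N.cost + 5 + (B + 6)))
    ?_ (Q' := I n) ?_)).mono ?_ fun _ h => h
  · refine Nat.mul_le_mul (by omega) ?_
    simp only [Test.cost, NatExpr.var, NatExpr.cost]
    omega
  · rintro s'' ⟨⟨h1, h2⟩, h3⟩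
    simp only [Test.Holds, not_not, hN _ _ h2, NatExpr.var, NatExpr.eval] at h3
    have : s''.nat i 0 = n := le_antisymm h1 h3
    rwa [this] at h2
  -- The test costs N.cost + 5 and the increment 6 per round. The initialisation costs 3 once, and
  -- is charged to every round: 5 + 6 + 3 = 14.
  · have : (n + 1) * (B + N.cost + 14) = (n + 1) * (N.cost + 5 + (B + 6)) + (n + 1) * 3 := by ring
    omega

/-! #### Lexicographic comparison -/

def Test.lexLt (a b a' b' : RealExpr) : Test :=
  Test.not (Test.and (Test.realLe a' a)
    (Test.not (Test.and (Test.realLe a a') (Test.not (Test.realLe b' b)))))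

theorem Test.lexLt_holds {s : State} {a b a' b' : RealExpr} :
    (Test.lexLt a b a' b').Holds s ↔
      toLex (a.eval s, b.eval s) < toLex (a'.eval s, b'.eval s) := by
  rw [Prod.Lex.toLex_lt_toLex]
  simp only [Test.lexLt, Test.Holds]
  constructor
  · intro h
    by_cases h1 : a.eval s < a'.eval s
    · exact Or.inl h1
    · push Not at h h1
      obtain ⟨h2, h3⟩ := h h1
      exact Or.inr ⟨le_antisymm h2 h1, h3⟩
  · rintro (h | ⟨h1, h2⟩)
    · push Not
      exact fun h1 => absurd h (not_lt.2 h1)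
    · push Not
      exact fun _ => ⟨h1.le, h2⟩

end RealRAM

/-! ### A program for maximum closures -/

namespace RealRAM

@[simp] theorem State.writeNat_nat (s : State) (a i v a' i' : ℕ) :
    (s.writeNat a i v).nat a' i' = if a' = a ∧ i' = i then v else s.nat a' i' := rfl

@[simp] theorem State.writeNat_real (s : State) (a i v : ℕ) :
    (s.writeNat a i v).real = s.real := rfl

@[simp] theorem State.writeReal_nat (s : State) (a i : ℕ) (v : ℝ) :
    (s.writeReal a i v).nat = s.nat := rfl

@[simp] theorem State.writeReal_real (s : State) (a i : ℕ) (v : ℝ) (a' i' : ℕ) :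
    (s.writeReal a i v).real a' i' = if a' = a ∧ i' = i then v else s.real a' i' := rfl

@[simp] theorem NatExpr.eval_var (s : State) (i : ℕ) : (NatExpr.var i).eval s = s.nat i 0 := rfl

/-! #### Input and memory layout

The direction of optimisation is stored in the real arrays `6` and `7`. The natural arrays are:
`4` loop counter, `6` flag, `7` labels, `8` gap, `9` marks. The real arrays are: `8`, `9` excesses,
`10`, `11` and `12`, `13` the two shares of the edges, `14`, `15` amount of a push, `16`, `17`
resulting point. -/

/-- `s` has the same graph, weights and direction as `s₀`. -/
structure Agree (s₀ s : State) : Prop where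
  nat : ∀ a < 3, s.nat a = s₀.nat a
  real : ∀ a < 4, s.real a = s₀.real a
  dirX : s.real 6 = s₀.real 6
  dirY : s.real 7 = s₀.real 7

theorem Agree.refl (s : State) : Agree s s := ⟨fun _ _ => rfl, fun _ _ => rfl, rfl, rfl⟩

theorem Agree.trans {s s' s'' : State} (h : Agree s s') (h' : Agree s' s'') : Agree s s'' :=
  ⟨fun a ha => (h'.nat a ha).trans (h.nat a ha), fun a ha => (h'.real a ha).trans (h.real a ha),
    h'.dirX.trans h.dirX, h'.dirY.trans h.dirY⟩

theorem Agree.writeNat {s₀ s : State} (h : Agree s₀ s) {a : ℕ} (ha : 3 ≤ a) (i v : ℕ) :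
    Agree s₀ (s.writeNat a i v) :=
  ⟨fun b hb => by
    rw [← h.nat b hb]
    funext k
    have : b ≠ a := by omega
    simp [this], h.real, h.dirX, h.dirY⟩

def Prog.keepsInput (p : Prog) : Bool :=
  p.natWrites.all (fun a => Nat.ble 3 a) &&
    p.realWrites.all fun a => Nat.ble 4 a && !Nat.beq a 6 && !Nat.beq a 7

theorem Exec.agree {p : Prog} (hp : p.keepsInput = true) {s s' : State} {t : ℕ}
    (h : Exec p s t s') : Agree s s' := by
  obtain ⟨hn, hr⟩ := h.frame
  simp only [Prog.keepsInput, Bool.and_eq_true, List.all_eq_true, Nat.ble_eq,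
    Bool.not_eq_true'] at hp
  refine ⟨fun a ha => hn a fun h => ?_, fun a ha => hr a fun h => ?_,
    hr 6 fun h => ?_, hr 7 fun h => ?_⟩
  · have := hp.1 a h
    omega
  · have := (hp.2 a h).1.1
    omega
  · exact absurd (hp.2 6 h).1.2 (by decide)
  · exact absurd (hp.2 7 h).2 (by decide)

theorem Runs.agree {p : Prog} (hp : p.keepsInput = true) {s₀ s : State} (hs : Agree s₀ s)
    {B : ℕ} {Q : State → Prop} (h : Runs p s B Q) :
    Runs p s B fun s' => Agree s₀ s' ∧ Q s' := by
  obtain ⟨t, s', he, ht, hq⟩ := h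
  exact ⟨t, s', he, ht, hs.trans (he.agree hp), hq⟩

theorem Agree.run {p : Prog} (hp : p.keepsInput = true) (hf : p.loopFree = true) {s₀ s : State}
    (hs : Agree s₀ s) : Agree s₀ (p.run s) := by
  obtain ⟨t, h, -⟩ := Prog.exec_run hf s
  exact hs.trans (h.agree hp)

abbrev numVertices : NatExpr := NatExpr.read 0 (NatExpr.const 0)
abbrev numEdges : NatExpr := NatExpr.read 0 (NatExpr.const 1)
abbrev ctr : NatExpr := NatExpr.var 4
abbrev zeroReal : RealExpr := RealExpr.const 0

/-- The components of the lexicographic objective. -/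
def keyFst (x y : RealExpr) : RealExpr :=
  RealExpr.add (RealExpr.mul (RealExpr.read 6 (NatExpr.const 0)) x)
    (RealExpr.mul (RealExpr.read 7 (NatExpr.const 0)) y)

def keySnd (x y : RealExpr) : RealExpr :=
  RealExpr.sub (RealExpr.mul (RealExpr.read 6 (NatExpr.const 0)) y)
    (RealExpr.mul (RealExpr.read 7 (NatExpr.const 0)) x)

/-- The objective in direction `(p, q)`, with ties broken in the direction `(-q, p)`. -/
def lexKey (p q : ℝ) (z : ℝ × ℝ) : ℝ ×ₗ ℝ := toLex (p * z.1 + q * z.2, p * z.2 - q * z.1)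

/-- Additivity allows the keys to serve as gains in the ordered group ℝ ×ₗ ℝ. -/
theorem lexKey_add (p q : ℝ) (z z' : ℝ × ℝ) : lexKey p q (z + z') = lexKey p q z + lexKey p q z' := by
  simp only [lexKey, ← toLex_add]
  congr 1
  ext <;> simp <;> ring

theorem lexKey_zero (p q : ℝ) : lexKey p q 0 = 0 := by
  simp only [lexKey]
  simp

namespace State

/-- The current objective. -/
def key (s : State) (z : ℝ × ℝ) : ℝ ×ₗ ℝ := lexKey (s.real 6 0) (s.real 7 0) z

def vertexWeight (s : State) (v : ℕ) : ℝ × ℝ := (s.real 0 v, s.real 1 v)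

def edgeWeight (s : State) (j : ℕ) : ℝ × ℝ := (s.real 2 j, s.real 3 j)

def vertexKey (s : State) (v : ℕ) : ℝ ×ₗ ℝ := s.key (s.vertexWeight v)

/-- Edges are maximal in the poset, so a spanned edge is worth taking only if its key is positive;
hence the positive part. -/
noncomputable def edgeGain (s : State) (j : ℕ) : ℝ ×ₗ ℝ := max (s.key (s.edgeWeight j)) 0

def edgeSplit (s : State) : EdgeSplit (ℝ ×ₗ ℝ) where
  ex v := toLex (s.real 8 v, s.real 9 v)
  xs j := toLex (s.real 10 j, s.real 11 j)
  xt j := toLex (s.real 12 j, s.real 13 j)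
  d := s.nat 7

theorem edgeSplit_congr {s s' : State} (h7 : s'.nat 7 = s.nat 7) (h8 : s'.real 8 = s.real 8)
    (h9 : s'.real 9 = s.real 9) (h10 : s'.real 10 = s.real 10) (h11 : s'.real 11 = s.real 11)
    (h12 : s'.real 12 = s.real 12) (h13 : s'.real 13 = s.real 13) :
    s'.edgeSplit = s.edgeSplit := by
  simp only [edgeSplit, h7, h8, h9, h10, h11, h12, h13]

theorem edgeSplit_writeNat (s : State) {a : ℕ} (ha : a ≠ 7) (i v : ℕ) :
    (s.writeNat a i v).edgeSplit = s.edgeSplit := by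
  refine edgeSplit_congr ?_ rfl rfl rfl rfl rfl rfl
  funext k
  simp [ha.symm]

end State

theorem Agree.key_eq {s₀ s : State} (h : Agree s₀ s) : s.key = s₀.key := by
  funext z
  simp only [State.key, h.dirX, h.dirY]

theorem Agree.vertexWeight_eq {s₀ s : State} (h : Agree s₀ s) :
    s.vertexWeight = s₀.vertexWeight := by
  funext z
  simp only [State.vertexWeight, h.real 0 (by norm_num), h.real 1 (by norm_num)]

theorem Agree.edgeWeight_eq {s₀ s : State} (h : Agree s₀ s) : s.edgeWeight = s₀.edgeWeight := by
  funext z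
  simp only [State.edgeWeight, h.real 2 (by norm_num), h.real 3 (by norm_num)]

theorem Agree.vertexKey_eq {s₀ s : State} (h : Agree s₀ s) : s.vertexKey = s₀.vertexKey := by
  funext v
  simp only [State.vertexKey, h.key_eq, h.vertexWeight_eq]

theorem Agree.edgeGain_eq {s₀ s : State} (h : Agree s₀ s) : s.edgeGain = s₀.edgeGain := by
  funext v
  simp only [State.edgeGain, h.key_eq, h.edgeWeight_eq]

theorem Agree.numVertices_eval {s₀ s : State} (h : Agree s₀ s) :
    numVertices.eval s = s₀.nat 0 0 := by
  simp only [NatExpr.eval, h.nat 0 (by norm_num)]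

theorem Agree.numEdges_eval {s₀ s : State} (h : Agree s₀ s) : numEdges.eval s = s₀.nat 0 1 := by
  simp only [NatExpr.eval, h.nat 0 (by norm_num)]

/-! #### Initialisation -/

def initVertex : Prog :=
  Prog.seq (Prog.setReal 8 ctr (keyFst (RealExpr.read 0 ctr) (RealExpr.read 1 ctr)))
    (Prog.seq (Prog.setReal 9 ctr (keySnd (RealExpr.read 0 ctr) (RealExpr.read 1 ctr)))
      (Prog.setNat 7 ctr (NatExpr.const 0)))

def isPos (a b : RealExpr) : Test := Test.lexLt zeroReal zeroReal a b

theorem isPos_holds {s : State} {a b : RealExpr} :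
    (isPos a b).Holds s ↔ 0 < toLex (a.eval s, b.eval s) := by
  rw [isPos, Test.lexLt_holds]
  simp only [RealExpr.eval, Rat.cast_zero]
  rfl

def edgeKeyFst : RealExpr := keyFst (RealExpr.read 2 ctr) (RealExpr.read 3 ctr)

def edgeKeySnd : RealExpr := keySnd (RealExpr.read 2 ctr) (RealExpr.read 3 ctr)

/-- The whole gain goes to the source. As all labels are zero at the start, this division satisfies
every label condition. -/
def initEdge : Prog :=
  Prog.seq (Prog.branch (isPos edgeKeyFst edgeKeySnd)
      (Prog.seq (Prog.setReal 10 ctr edgeKeyFst) (Prog.setReal 11 ctr edgeKeySnd))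
      (Prog.seq (Prog.setReal 10 ctr zeroReal) (Prog.setReal 11 ctr zeroReal)))
    (Prog.seq (Prog.setReal 12 ctr zeroReal) (Prog.seq (Prog.setReal 13 ctr zeroReal)
      (Prog.seq
        (Prog.setReal 8 (NatExpr.read 1 ctr)
          (RealExpr.add (RealExpr.read 8 (NatExpr.read 1 ctr)) (RealExpr.read 10 ctr)))
        (Prog.setReal 9 (NatExpr.read 1 ctr)
          (RealExpr.add (RealExpr.read 9 (NatExpr.read 1 ctr)) (RealExpr.read 11 ctr))))))

theorem edgeKey_holds {s : State} : (isPos edgeKeyFst edgeKeySnd).Holds s ↔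
    0 < s.key (s.edgeWeight (s.nat 4 0)) := by
  rw [isPos_holds]
  rfl

theorem initEdge_run (s : State) : (initEdge.run s).edgeSplit =
    { ex := fun v => if v = s.nat 1 (s.nat 4 0) then s.edgeSplit.ex v + s.edgeGain (s.nat 4 0)
        else s.edgeSplit.ex v
      xs := fun j => if j = s.nat 4 0 then s.edgeGain j else s.edgeSplit.xs j
      xt := fun j => if j = s.nat 4 0 then 0 else s.edgeSplit.xt j
      d := s.nat 7 } := by
  have hz : toLex ((0 : ℝ), (0 : ℝ)) = 0 := rfl
  by_cases h : 0 < s.key (s.edgeWeight (s.nat 4 0))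
  · have hg : s.edgeGain (s.nat 4 0) = s.key (s.edgeWeight (s.nat 4 0)) := max_eq_left h.le
    simp only [initEdge, Prog.run, if_pos (edgeKey_holds.2 h), State.edgeSplit]
    congr 1 <;> funext v
    · split_ifs with hv
      · subst hv
        rw [hg]
        simp [NatExpr.eval, RealExpr.eval, State.key, lexKey, State.edgeWeight, edgeKeyFst,
          edgeKeySnd, keyFst, keySnd, ← toLex_add]
      · simp [NatExpr.eval, RealExpr.eval, hv]
    · split_ifs with hv
      · subst hv
        rw [hg]
        simp [NatExpr.eval, RealExpr.eval, State.key, lexKey, State.edgeWeight, edgeKeyFst,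
          edgeKeySnd, keyFst, keySnd]
      · simp [NatExpr.eval, RealExpr.eval, hv]
    · split_ifs with hv
      · subst hv
        simp [NatExpr.eval, RealExpr.eval]
      · simp [NatExpr.eval, RealExpr.eval, hv]
  · have hg : s.edgeGain (s.nat 4 0) = 0 := max_eq_right (not_lt.1 h)
    simp only [initEdge, Prog.run, if_neg (mt edgeKey_holds.1 h), State.edgeSplit]
    congr 1 <;> funext v
    · split_ifs with hv
      · subst hv
        rw [hg]
        simp [NatExpr.eval, RealExpr.eval]
      · simp [NatExpr.eval, RealExpr.eval, hv]
    · split_ifs with hv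
      · subst hv
        rw [hg]
        simp [NatExpr.eval, RealExpr.eval]
      · simp [NatExpr.eval, RealExpr.eval, hv]
    · split_ifs with hv
      · subst hv
        simp [NatExpr.eval, RealExpr.eval]
      · simp [NatExpr.eval, RealExpr.eval, hv]

def initSplit : Prog :=
  Prog.seq (Prog.forLoop 4 numVertices initVertex) (Prog.forLoop 4 numEdges initEdge)

/-- The graph stored in `s` is loopless with endpoints in range. -/
def State.IsNetwork (s : State) : Prop :=
  EdgeSplit.IsNetwork (s.nat 0 0) (s.nat 0 1) (s.nat 1) (s.nat 2)

def State.Valid (s₀ s : State) : Prop :=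
  EdgeSplit.Valid (s₀.nat 0 0) (s₀.nat 0 1) (s₀.nat 0 0 + 1) (s₀.nat 1) (s₀.nat 2)
    s₀.vertexKey s₀.edgeGain s.edgeSplit

theorem runs_initSplit {s₀ : State} (hN : s₀.IsNetwork) :
    Runs initSplit s₀ (200 * (s₀.nat 0 0 + s₀.nat 0 1 + 2)) fun s => Agree s₀ s ∧ s₀.Valid s := by
  have h1 : Runs (Prog.forLoop 4 numVertices initVertex) s₀ ((s₀.nat 0 0 + 1) * (60 + 2 + 14))
      fun s => Agree s₀ s ∧ ∀ v < s₀.nat 0 0, s.edgeSplit.ex v = s₀.vertexKey v ∧ s.nat 7 v = 0 := by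
    refine Runs.forLoop (by decide) (s₀.nat 0 0) 60 (fun k s => Agree s₀ s ∧
      ∀ v < k, s.edgeSplit.ex v = s₀.vertexKey v ∧ s.nat 7 v = 0) ?_ ?_ ?_ s₀ ?_
    · rintro k s v ⟨hA, h⟩
      refine ⟨hA.writeNat (by norm_num) _ _, ?_⟩
      rw [State.edgeSplit_writeNat _ (by norm_num)]
      simpa using h
    · exact fun k s h => h.1.numVertices_eval
    · rintro k hk s ⟨hA, h⟩ hc
      refine Runs.agree rfl hA (Runs.of_loopFree rfl (by decide) ?_)
      intro v hv
      rw [← hA.vertexKey_eq]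
      by_cases hvk : v = k
      · subst hvk
        subst hc
        simp [initVertex, Prog.run, NatExpr.eval, RealExpr.eval, State.edgeSplit, keyFst, keySnd,
          State.vertexKey, State.key, lexKey, State.vertexWeight]
      · have := h v (by omega)
        rw [← hA.vertexKey_eq] at this
        rw [← hc] at hvk
        simpa [initVertex, Prog.run, NatExpr.eval, State.edgeSplit, hvk] using this
    · exact ⟨Agree.refl _, fun v hv => absurd hv (by omega)⟩
  have h2 : ∀ s, (Agree s₀ s ∧ ∀ v < s₀.nat 0 0, s.edgeSplit.ex v = s₀.vertexKey v ∧ s.nat 7 v = 0) →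
      Runs (Prog.forLoop 4 numEdges initEdge) s ((s₀.nat 0 1 + 1) * (150 + 2 + 14))
        fun s => Agree s₀ s ∧ (∀ v < s₀.nat 0 0, s.nat 7 v = 0 ∧
          s.edgeSplit.ex v = s₀.vertexKey v + ∑ j ∈ Finset.range (s₀.nat 0 1),
            if s₀.nat 1 j = v then s₀.edgeGain j else 0) ∧
          ∀ j < s₀.nat 0 1, s.edgeSplit.xs j = s₀.edgeGain j ∧ s.edgeSplit.xt j = 0 := by
    rintro s ⟨hA, h⟩
    refine Runs.forLoop (by decide) (s₀.nat 0 1) 150 (fun k s => Agree s₀ s ∧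
      (∀ v < s₀.nat 0 0, s.nat 7 v = 0 ∧ s.edgeSplit.ex v =
        s₀.vertexKey v + ∑ j ∈ Finset.range k, if s₀.nat 1 j = v then s₀.edgeGain j else 0) ∧
      ∀ j < k, s.edgeSplit.xs j = s₀.edgeGain j ∧ s.edgeSplit.xt j = 0) ?_ ?_ ?_ s ?_
    · rintro k s v ⟨hA, h⟩
      refine ⟨hA.writeNat (by norm_num) _ _, ?_⟩
      rw [State.edgeSplit_writeNat _ (by norm_num)]
      simpa using h
    · exact fun k s h => h.1.numEdges_eval
    · rintro k hk s ⟨hA, h, h'⟩ hc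
      refine Runs.agree rfl hA (Runs.of_loopFree rfl (by decide) ?_)
      have hd : (initEdge.run s).nat 7 = s.nat 7 := congrArg EdgeSplit.d (initEdge_run s)
      rw [hd, initEdge_run, hc, hA.nat 1 (by norm_num), hA.edgeGain_eq]
      refine ⟨fun v hv => ⟨(h v hv).1, ?_⟩, fun j hj => ?_⟩
      · rw [Finset.sum_range_succ, ← add_assoc, ← (h v hv).2]
        simp only [eq_comm (a := v)]
        split_ifs <;> simp
      · by_cases hjk : j = k
        · simp [hjk]
        · have := h' j (by omega)
          simp [hjk, this]
    · exact ⟨hA, fun v hv => ⟨(h v hv).2, by simpa using (h v hv).1⟩, fun j hj => absurd hj (by omega)⟩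
  refine (Runs.seq h1 h2).mono (by ring_nf; omega) ?_
  rintro s ⟨hA, hv, hj⟩
  have hpos : ∀ j, 0 ≤ s₀.edgeGain j := fun j => le_max_right _ _
  refine ⟨hA, ⟨?_, ?_, ?_, ?_, ?_, ?_, ?_, ?_⟩⟩
  · exact fun j hj' => (hj j hj').1 ▸ hpos j
  · exact fun j hj' => (hj j hj').2.ge
  · exact fun j hj' => by rw [(hj j hj').1, (hj j hj').2, add_zero]
  · intro v hv'
    rw [(hv v hv').2]
    congr 1
    refine Finset.sum_congr rfl fun j hj' => ?_
    rw [(hj j (Finset.mem_range.1 hj')).1, (hj j (Finset.mem_range.1 hj')).2]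
    simp
  · exact fun v hv' _ => (hv v hv').1
  · exact fun v hv' => by
      have : s.edgeSplit.d v = 0 := (hv v hv').1
      omega
  · intro j hj' _
    have : s.edgeSplit.d (s₀.nat 1 j) = 0 := (hv _ (hN.src_lt j hj')).1
    omega
  · intro j hj' _
    have : s.edgeSplit.d (s₀.nat 2 j) = 0 := (hv _ (hN.tgt_lt j hj')).1
    omega

end RealRAM

set_option linter.unusedSimpArgs false

namespace RealRAM

/-! #### Pushes and relabellings -/

/-- Replace the pair in cell `i` of the arrays `a`, `b` by its sum or difference with the pair in
the arrays `14`, `15`. -/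
def updatePair (a b : ℕ) (i : NatExpr) (op : RealExpr → RealExpr → RealExpr) : Prog :=
  Prog.seq
    (Prog.setReal a i (op (RealExpr.read a i) (RealExpr.read 14 (NatExpr.const 0))))
    (Prog.setReal b i (op (RealExpr.read b i) (RealExpr.read 15 (NatExpr.const 0))))

def setAmount (a b : ℕ) (i : NatExpr) : Prog :=
  Prog.seq (Prog.setReal 14 (NatExpr.const 0) (RealExpr.read a i))
    (Prog.setReal 15 (NatExpr.const 0) (RealExpr.read b i))

/-- A push along the current edge from its endpoint in the array `S` to that in the array `T` is
admissible; the share of the former endpoint is in the arrays `X`, `X'`. -/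
def pushTest (S T X X' : ℕ) : Test :=
  Test.and
    (Test.and (isPos (RealExpr.read 8 (NatExpr.read S ctr)) (RealExpr.read 9 (NatExpr.read S ctr)))
      (isPos (RealExpr.read X ctr) (RealExpr.read X' ctr)))
    (Test.and
      (Test.natLe (NatExpr.read 7 (NatExpr.read S ctr))
        (NatExpr.add (NatExpr.read 7 (NatExpr.read T ctr)) (NatExpr.const 1)))
      (Test.natLe (NatExpr.add (NatExpr.read 7 (NatExpr.read T ctr)) (NatExpr.const 1))
        (NatExpr.read 7 (NatExpr.read S ctr))))

def excessLtShare (S X X' : ℕ) : Test :=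
  Test.lexLt (RealExpr.read 8 (NatExpr.read S ctr)) (RealExpr.read 9 (NatExpr.read S ctr))
    (RealExpr.read X ctr) (RealExpr.read X' ctr)

def pushEdge (S T X X' Y Y' : ℕ) : Prog :=
  Prog.branch (pushTest S T X X')
    (Prog.seq
      (Prog.branch (excessLtShare S X X') (setAmount 8 9 (NatExpr.read S ctr)) (setAmount X X' ctr))
      (Prog.seq (updatePair 8 9 (NatExpr.read S ctr) RealExpr.sub)
      (Prog.seq (updatePair 8 9 (NatExpr.read T ctr) RealExpr.add)
      (Prog.seq (updatePair X X' ctr RealExpr.sub)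
      (Prog.seq (updatePair Y Y' ctr RealExpr.add)
        (Prog.setNat 6 (NatExpr.const 0) (NatExpr.const 1)))))))
    Prog.skip

/-- The division of the gains with the shares read from the given arrays. -/
def State.splitFrom (X X' Y Y' : ℕ) (s : State) : EdgeSplit (ℝ ×ₗ ℝ) where
  ex v := toLex (s.real 8 v, s.real 9 v)
  xs j := toLex (s.real X j, s.real X' j)
  xt j := toLex (s.real Y j, s.real Y' j)
  d := s.nat 7

/-- The two tuples of arrays are the two directions of a push. Read through `splitFrom`, the
backward push is a forward push in the swapped division. -/
theorem pushEdge_run {S T X X' Y Y' : ℕ}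
    (h : (S = 1 ∧ T = 2 ∧ X = 10 ∧ X' = 11 ∧ Y = 12 ∧ Y' = 13) ∨
      (S = 2 ∧ T = 1 ∧ X = 12 ∧ X' = 13 ∧ Y = 10 ∧ Y' = 11)) (s : State)
    (hne : s.nat S (s.nat 4 0) ≠ s.nat T (s.nat 4 0)) (f : EdgeSplit (ℝ ×ₗ ℝ))
    (hf : s.splitFrom X X' Y Y' = f) :
    ((0 < f.ex (s.nat S (s.nat 4 0)) ∧ 0 < f.xs (s.nat 4 0) ∧
        f.d (s.nat S (s.nat 4 0)) = f.d (s.nat T (s.nat 4 0)) + 1) ∧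
      ((pushEdge S T X X' Y Y').run s).splitFrom X X' Y Y' =
        f.push (s.nat S) (s.nat T) (s.nat 4 0)
          (min (f.ex (s.nat S (s.nat 4 0))) (f.xs (s.nat 4 0))) ∧
      ((pushEdge S T X X' Y Y').run s).nat 6 0 = 1) ∨
    (¬ (0 < f.ex (s.nat S (s.nat 4 0)) ∧ 0 < f.xs (s.nat 4 0) ∧
        f.d (s.nat S (s.nat 4 0)) = f.d (s.nat T (s.nat 4 0)) + 1) ∧
      (pushEdge S T X X' Y Y').run s = s) := by
  have htest : (pushTest S T X X').Holds s ↔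
      (0 < f.ex (s.nat S (s.nat 4 0)) ∧ 0 < f.xs (s.nat 4 0) ∧
        f.d (s.nat S (s.nat 4 0)) = f.d (s.nat T (s.nat 4 0)) + 1) := by
    subst hf
    simp only [pushTest, Test.Holds, isPos_holds, RealExpr.eval, NatExpr.eval, NatExpr.eval_var,
      State.splitFrom, and_assoc, le_antisymm_iff]
  have hlt : (excessLtShare S X X').Holds s ↔
      f.ex (s.nat S (s.nat 4 0)) < f.xs (s.nat 4 0) := by
    subst hf
    rw [excessLtShare, Test.lexLt_holds]
    rfl
  by_cases ht : (pushTest S T X X').Holds s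
  · refine Or.inl ⟨htest.1 ht, ?_, ?_⟩
    · rcases lt_or_ge (f.ex (s.nat S (s.nat 4 0))) (f.xs (s.nat 4 0)) with h1 | h1
      · rw [min_eq_left h1.le]
        rw [← hlt] at h1
        simp only [pushEdge, Prog.run, if_pos ht, if_pos h1]
        subst hf
        rcases h with ⟨rfl, rfl, rfl, rfl, rfl, rfl⟩ | ⟨rfl, rfl, rfl, rfl, rfl, rfl⟩ <;>
        · simp only [State.splitFrom, EdgeSplit.push]
          congr 1 <;> funext v
          · split_ifs with h2 h3
            · subst h2
              simp [Prog.run, updatePair, setAmount, RealExpr.eval, NatExpr.eval, hne, hne.symm,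
                ← toLex_add]
            · subst h3
              simp [Prog.run, updatePair, setAmount, RealExpr.eval, NatExpr.eval, hne, hne.symm,
                ← toLex_sub]
            · simp [Prog.run, updatePair, setAmount, RealExpr.eval, NatExpr.eval, h2, h3]
          · split_ifs with h2
            · subst h2
              simp [Prog.run, updatePair, setAmount, RealExpr.eval, NatExpr.eval, hne, hne.symm,
                ← toLex_sub]
            · simp [Prog.run, updatePair, setAmount, RealExpr.eval, NatExpr.eval, h2]
          · split_ifs with h2
            · subst h2
              simp [Prog.run, updatePair, setAmount, RealExpr.eval, NatExpr.eval, hne, hne.symm,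
                ← toLex_add]
            · simp [Prog.run, updatePair, setAmount, RealExpr.eval, NatExpr.eval, h2]
      · rw [min_eq_right h1]
        rw [← not_lt, ← hlt] at h1
        simp only [pushEdge, Prog.run, if_pos ht, if_neg h1]
        subst hf
        rcases h with ⟨rfl, rfl, rfl, rfl, rfl, rfl⟩ | ⟨rfl, rfl, rfl, rfl, rfl, rfl⟩ <;>
        · simp only [State.splitFrom, EdgeSplit.push]
          congr 1 <;> funext v
          · split_ifs with h2 h3
            · subst h2
              simp [Prog.run, updatePair, setAmount, RealExpr.eval, NatExpr.eval, hne, hne.symm,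
                ← toLex_add]
            · subst h3
              simp [Prog.run, updatePair, setAmount, RealExpr.eval, NatExpr.eval, hne, hne.symm,
                ← toLex_sub]
            · simp [Prog.run, updatePair, setAmount, RealExpr.eval, NatExpr.eval, h2, h3]
          · split_ifs with h2
            · subst h2
              simp [Prog.run, updatePair, setAmount, RealExpr.eval, NatExpr.eval, hne, hne.symm,
                ← toLex_sub]
            · simp [Prog.run, updatePair, setAmount, RealExpr.eval, NatExpr.eval, h2]
          · split_ifs with h2
            · subst h2
              simp [Prog.run, updatePair, setAmount, RealExpr.eval, NatExpr.eval, hne, hne.symm,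
                ← toLex_add]
            · simp [Prog.run, updatePair, setAmount, RealExpr.eval, NatExpr.eval, h2]
    · simp [pushEdge, Prog.run, if_pos ht, NatExpr.eval]
  · refine Or.inr ⟨mt htest.2 ht, ?_⟩
    simp only [pushEdge, Prog.run, if_neg ht]

/-- The flag in array `6` is tested and then set, so a pass relabels at most one vertex, and none
after a push. -/
def relabelVertex : Prog :=
  Prog.branch
    (Test.and (Test.natLe (NatExpr.var 6) (NatExpr.const 0))
      (Test.and (isPos (RealExpr.read 8 ctr) (RealExpr.read 9 ctr))
        (Test.not (Test.natLe (NatExpr.add numVertices (NatExpr.const 1)) (NatExpr.read 7 ctr)))))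
    (Prog.seq (Prog.setNat 7 ctr (NatExpr.add (NatExpr.read 7 ctr) (NatExpr.const 1)))
      (Prog.setNat 6 (NatExpr.const 0) (NatExpr.const 1)))
    Prog.skip

theorem relabelVertex_run (s : State) :
    ((s.nat 6 0 = 0 ∧ 0 < s.edgeSplit.ex (s.nat 4 0) ∧ s.edgeSplit.d (s.nat 4 0) < s.nat 0 0 + 1) ∧
      (relabelVertex.run s).edgeSplit = s.edgeSplit.relabel (s.nat 4 0) ∧
      (relabelVertex.run s).nat 6 0 = 1) ∨
    (¬ (s.nat 6 0 = 0 ∧ 0 < s.edgeSplit.ex (s.nat 4 0) ∧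
        s.edgeSplit.d (s.nat 4 0) < s.nat 0 0 + 1) ∧ relabelVertex.run s = s) := by
  have htest : (Test.and (Test.natLe (NatExpr.var 6) (NatExpr.const 0))
      (Test.and (isPos (RealExpr.read 8 ctr) (RealExpr.read 9 ctr))
        (Test.not (Test.natLe (NatExpr.add numVertices (NatExpr.const 1))
          (NatExpr.read 7 ctr))))).Holds s ↔
      (s.nat 6 0 = 0 ∧ 0 < s.edgeSplit.ex (s.nat 4 0) ∧
        s.edgeSplit.d (s.nat 4 0) < s.nat 0 0 + 1) := by
    simp only [Test.Holds, isPos_holds, RealExpr.eval, NatExpr.eval, NatExpr.eval_var,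
      State.edgeSplit, not_le, Nat.le_zero]
  by_cases h : (s.nat 6 0 = 0 ∧ 0 < s.edgeSplit.ex (s.nat 4 0) ∧
      s.edgeSplit.d (s.nat 4 0) < s.nat 0 0 + 1)
  · refine Or.inl ⟨h, ?_, ?_⟩
    · simp only [relabelVertex, Prog.run, if_pos (htest.2 h), State.edgeSplit, EdgeSplit.relabel]
      congr 1
      funext v
      split_ifs with h1
      · subst h1
        simp [NatExpr.eval]
      · simp [NatExpr.eval, h1]
    · simp [relabelVertex, Prog.run, if_pos (htest.2 h), NatExpr.eval]
  · refine Or.inr ⟨h, ?_⟩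
    simp only [relabelVertex, Prog.run, if_neg (mt htest.1 h)]

/-- Push along all edges; if nothing has changed, relabel a vertex. -/
def improveStep : Prog :=
  Prog.seq (Prog.setNat 6 (NatExpr.const 0) (NatExpr.const 0))
    (Prog.seq
      (Prog.forLoop 4 numEdges
        (Prog.seq (pushEdge 1 2 10 11 12 13) (pushEdge 2 1 12 13 10 11)))
      (Prog.branch (Test.natLe (NatExpr.var 6) (NatExpr.const 0))
        (Prog.forLoop 4 numVertices relabelVertex) Prog.skip))

noncomputable def State.potential (s₀ s : State) : ℕ :=
  EdgeSplit.potential (s₀.nat 0 0) (s₀.nat 0 1) (s₀.nat 0 0 + 1) (s₀.nat 1) (s₀.nat 2) s.edgeSplit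

/-- No push or relabelling is possible. -/
def State.Stable (s₀ s : State) : Prop :=
  ∀ v < s₀.nat 0 0, 0 < s.edgeSplit.ex v → s₀.nat 0 0 + 1 ≤ s.edgeSplit.d v

def State.PushAt (s₀ : State) (f : EdgeSplit (ℝ ×ₗ ℝ)) (j : ℕ) : Prop :=
  (0 < f.ex (s₀.nat 1 j) ∧ 0 < f.xs j ∧ f.d (s₀.nat 1 j) = f.d (s₀.nat 2 j) + 1) ∨
  (0 < f.ex (s₀.nat 2 j) ∧ 0 < f.xt j ∧ f.d (s₀.nat 2 j) = f.d (s₀.nat 1 j) + 1)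

theorem push_forward {s₀ s : State} (hN : s₀.IsNetwork) (hA : Agree s₀ s) (hV : s₀.Valid s)
    (hj : s.nat 4 0 < s₀.nat 0 1) (s' : State) (hs' : s' = (pushEdge 1 2 10 11 12 13).run s) :
    (s₀.Valid s' ∧ s'.nat 6 0 = 1 ∧ s₀.potential s' < s₀.potential s) ∨
    (s' = s ∧ ¬ (0 < s.edgeSplit.ex (s₀.nat 1 (s.nat 4 0)) ∧ 0 < s.edgeSplit.xs (s.nat 4 0) ∧
      s.edgeSplit.d (s₀.nat 1 (s.nat 4 0)) = s.edgeSplit.d (s₀.nat 2 (s.nat 4 0)) + 1)) := by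
  have h1 := hA.nat 1 (by norm_num)
  have h2 := hA.nat 2 (by norm_num)
  have hr := pushEdge_run (Or.inl ⟨rfl, rfl, rfl, rfl, rfl, rfl⟩) s
    (by rw [h1, h2]; exact hN.ne _ hj) s.edgeSplit rfl
  rw [h1, h2, ← hs'] at hr
  rcases hr with ⟨⟨he, hx, hd⟩, hs, hfl⟩ | ⟨hn, hs⟩
  · have hs1 : s'.edgeSplit = _ := hs
    refine Or.inl ⟨?_, hfl, ?_⟩
    · rw [State.Valid, hs1]
      exact EdgeSplit.Valid.push hV hN hj (le_min he.le hx.le) (min_le_left _ _)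
        (min_le_right _ _) hd
    · rw [State.potential, hs1]
      exact EdgeSplit.Valid.potential_push_lt hV hN hj he hx hd
  · exact Or.inr ⟨hs, hn⟩

theorem push_backward {s₀ s : State} (hN : s₀.IsNetwork) (hA : Agree s₀ s) (hV : s₀.Valid s)
    (hj : s.nat 4 0 < s₀.nat 0 1) (s' : State) (hs' : s' = (pushEdge 2 1 12 13 10 11).run s) :
    (s₀.Valid s' ∧ s'.nat 6 0 = 1 ∧ s₀.potential s' < s₀.potential s) ∨
    (s' = s ∧ ¬ (0 < s.edgeSplit.ex (s₀.nat 2 (s.nat 4 0)) ∧ 0 < s.edgeSplit.xt (s.nat 4 0) ∧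
      s.edgeSplit.d (s₀.nat 2 (s.nat 4 0)) = s.edgeSplit.d (s₀.nat 1 (s.nat 4 0)) + 1)) := by
  have h1 := hA.nat 1 (by norm_num)
  have h2 := hA.nat 2 (by norm_num)
  have hr := pushEdge_run (Or.inr ⟨rfl, rfl, rfl, rfl, rfl, rfl⟩) s
    (by rw [h1, h2]; exact (hN.ne _ hj).symm) s.edgeSplit.swap rfl
  rw [h1, h2, ← hs'] at hr
  rcases hr with ⟨⟨he, hx, hd⟩, hs, hfl⟩ | ⟨hn, hs⟩
  · have hs1 : s'.edgeSplit.swap = _ := hs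
    have hV' : EdgeSplit.Valid _ _ _ _ _ _ _ s.edgeSplit.swap := EdgeSplit.Valid.swap hV
    refine Or.inl ⟨?_, hfl, ?_⟩
    · have : EdgeSplit.Valid _ _ _ _ _ _ _ s'.edgeSplit.swap := hs1 ▸
        EdgeSplit.Valid.push hV' (EdgeSplit.IsNetwork.swap hN) hj (le_min he.le hx.le)
          (min_le_left _ _) (min_le_right _ _) hd
      exact this.swap
    · rw [State.potential, State.potential, ← EdgeSplit.potential_swap, hs1,
        ← EdgeSplit.potential_swap (f := s.edgeSplit)]
      exact EdgeSplit.Valid.potential_push_lt hV' (EdgeSplit.IsNetwork.swap hN) hj he hx hd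
  · exact Or.inr ⟨hs, hn⟩

theorem push_step {s₀ s : State} (hN : s₀.IsNetwork) (hA : Agree s₀ s) (hV : s₀.Valid s)
    (hj : s.nat 4 0 < s₀.nat 0 1) (s' : State)
    (hs' : s' = (Prog.seq (pushEdge 1 2 10 11 12 13) (pushEdge 2 1 12 13 10 11)).run s) :
    (s₀.Valid s' ∧ s'.nat 6 0 = 1 ∧ s₀.potential s' < s₀.potential s) ∨
      (s' = s ∧ ¬ s₀.PushAt s.edgeSplit (s.nat 4 0)) := by
  have h4 : ((pushEdge 1 2 10 11 12 13).run s).nat 4 = s.nat 4 := Prog.run_nat rfl _ (by decide)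
  have hA1 : Agree s₀ ((pushEdge 1 2 10 11 12 13).run s) := hA.run rfl rfl
  rcases push_forward hN hA hV hj _ rfl with ⟨hV1, hf1, hp1⟩ | ⟨hs1, hn1⟩
  · rcases push_backward hN hA1 hV1 (h4 ▸ hj) s' hs' with ⟨hV2, hf2, hp2⟩ | ⟨hs2, -⟩
    · exact Or.inl ⟨hV2, hf2, hp2.trans hp1⟩
    · rw [hs2]
      exact Or.inl ⟨hV1, hf1, hp1⟩
  · rw [Prog.run, hs1] at hs'
    rcases push_backward hN hA hV hj s' hs' with h2 | ⟨hs2, hn2⟩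
    · exact Or.inl h2
    · exact Or.inr ⟨hs2, fun h => h.elim hn1 hn2⟩

/-- The flag records progress. If it is still 0 after all edges were scanned, the division is
unchanged, so every edge was found inadmissible for the current labels; this is what makes the
relabelling valid. If it is 0 at the end, every vertex of positive excess has reached the top label.
-/
theorem runs_improveStep {s₀ s : State} (hN : s₀.IsNetwork) (hA : Agree s₀ s) (hV : s₀.Valid s) :
    Runs improveStep s (1000 * (s₀.nat 0 0 + s₀.nat 0 1 + 2)) fun s' => Agree s₀ s' ∧
      s₀.Valid s' ∧ ((s'.nat 6 0 = 1 ∧ s₀.potential s' < s₀.potential s) ∨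
        (s'.nat 6 0 = 0 ∧ s₀.potential s' = s₀.potential s ∧ s₀.Stable s')) := by
  have h1 : Runs (Prog.setNat 6 (NatExpr.const 0) (NatExpr.const 0)) s 3 fun s' =>
      Agree s₀ s' ∧ s'.edgeSplit = s.edgeSplit ∧ s'.nat 6 0 = 0 := by
    refine Runs.agree rfl hA (Runs.of_loopFree rfl (by decide) ⟨?_, ?_⟩)
    · exact State.edgeSplit_writeNat s (by norm_num) _ _
    · simp [Prog.run, NatExpr.eval]
  have h2 : ∀ s₁, (Agree s₀ s₁ ∧ s₁.edgeSplit = s.edgeSplit ∧ s₁.nat 6 0 = 0) →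
      Runs (Prog.forLoop 4 numEdges
        (Prog.seq (pushEdge 1 2 10 11 12 13) (pushEdge 2 1 12 13 10 11))) s₁
        ((s₀.nat 0 1 + 1) * (400 + 2 + 14)) fun s' => Agree s₀ s' ∧ s₀.Valid s' ∧
        ((s'.nat 6 0 = 1 ∧ s₀.potential s' < s₀.potential s) ∨ (s'.nat 6 0 = 0 ∧
          s'.edgeSplit = s.edgeSplit ∧ ∀ j < s₀.nat 0 1, ¬ s₀.PushAt s.edgeSplit j)) := by
    rintro s₁ ⟨hA1, he1, hf1⟩
    refine Runs.forLoop (by decide) (s₀.nat 0 1) 400 (fun k s' => Agree s₀ s' ∧ s₀.Valid s' ∧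
        ((s'.nat 6 0 = 1 ∧ s₀.potential s' < s₀.potential s) ∨ (s'.nat 6 0 = 0 ∧
          s'.edgeSplit = s.edgeSplit ∧ ∀ j < k, ¬ s₀.PushAt s.edgeSplit j))) ?_ ?_ ?_ s₁ ?_
    · rintro k s' v ⟨hA', h⟩
      refine ⟨hA'.writeNat (by norm_num) _ _, ?_⟩
      simpa [State.Valid, State.potential, State.edgeSplit_writeNat] using h
    · exact fun k s' h => h.1.numEdges_eval
    · rintro k hk s' ⟨hA', hV', h⟩ hc
      refine Runs.agree rfl hA' (Runs.of_loopFree rfl (by decide) ?_)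
      rcases push_step hN hA' hV' (hc ▸ hk) _ rfl with ⟨hV2, hf2, hp2⟩ | ⟨hs2, hn2⟩
      · refine ⟨hV2, Or.inl ⟨hf2, ?_⟩⟩
        rcases h with h | h
        · exact hp2.trans h.2
        · rwa [State.potential, State.potential, h.2.1] at hp2
      · rw [hs2]
        refine ⟨hV', h.imp id fun h => ⟨h.1, h.2.1, fun j hj => ?_⟩⟩
        rcases Nat.lt_succ_iff_lt_or_eq.1 hj with hj | rfl
        · exact h.2.2 j hj
        · rwa [h.2.1, hc] at hn2
    · refine ⟨hA1, ?_, Or.inr ⟨hf1, he1, fun j hj => absurd hj (by omega)⟩⟩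
      rwa [State.Valid, he1]
  refine (Runs.seq h1 fun s₁ hs₁ => Runs.seq (h2 s₁ hs₁)
    (B' := 6 + ((s₀.nat 0 0 + 1) * (100 + 2 + 14))) ?_).mono (by ring_nf; omega) fun _ h => h
  rintro s₂ ⟨hA2, hV2, h⟩
  refine (Runs.branch (B := (s₀.nat 0 0 + 1) * (100 + 2 + 14)) ?_ ?_).mono (by
    simp only [Test.cost, NatExpr.var, NatExpr.cost]
    omega) fun _ h => h
  · intro hb
    have hf : s₂.nat 6 0 = 0 := by simpa [Test.Holds, NatExpr.eval] using hb
    have h' := h.resolve_left (by omega)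
    refine (Runs.forLoop (by decide) (s₀.nat 0 0) 100 (fun k s' => Agree s₀ s' ∧ s₀.Valid s' ∧
        ((s'.nat 6 0 = 1 ∧ s₀.potential s' < s₀.potential s) ∨ (s'.nat 6 0 = 0 ∧
          s'.edgeSplit = s.edgeSplit ∧ ∀ v < k, 0 < s.edgeSplit.ex v →
            s₀.nat 0 0 + 1 ≤ s.edgeSplit.d v))) ?_ ?_ ?_ s₂ ?_).mono le_rfl ?_
    · rintro k s' v ⟨hA', h⟩
      refine ⟨hA'.writeNat (by norm_num) _ _, ?_⟩
      simpa [State.Valid, State.potential, State.edgeSplit_writeNat] using h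
    · exact fun k s' h => h.1.numVertices_eval
    · rintro k hk s' ⟨hA', hV', h⟩ hc
      refine Runs.agree rfl hA' (Runs.of_loopFree rfl (by decide) ?_)
      have hn := congrFun (hA'.nat 0 (by norm_num)) 0
      rcases relabelVertex_run s' with ⟨⟨hf1, he, hd⟩, hs1, hf2⟩ | ⟨hn1, hs1⟩
      · rw [hc] at he hd hs1
        rw [hn] at hd
        have h3 := h.resolve_left (by omega)
        refine ⟨?_, Or.inl ⟨hf2, ?_⟩⟩
        · rw [State.Valid, hs1]
          refine EdgeSplit.Valid.relabel hV' he hd ?_ ?_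
          · intro j hj hjk hx hdd
            refine h'.2.2 j hj (Or.inl ?_)
            rw [← h3.2.1, hjk]
            exact ⟨he, hx, hdd⟩
          · intro j hj hjk hx hdd
            refine h'.2.2 j hj (Or.inr ?_)
            rw [← h3.2.1, hjk]
            exact ⟨he, hx, hdd⟩
        · rw [State.potential, hs1, State.potential, ← h3.2.1]
          exact EdgeSplit.potential_relabel_lt hk hd
      · rw [hs1]
        refine ⟨hV', h.imp id fun h => ⟨h.1, h.2.1, fun v hv hev => ?_⟩⟩
        rcases Nat.lt_succ_iff_lt_or_eq.1 hv with hv | rfl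
        · exact h.2.2 v hv hev
        · rw [hc, h.2.1, hn] at hn1
          by_contra hcon
          exact hn1 ⟨h.1, hev, by omega⟩
    · exact ⟨hA2, hV2, Or.inr ⟨hf, h'.2.1, fun v hv => absurd hv (by omega)⟩⟩
    · rintro s' ⟨hA', hV', h⟩
      refine ⟨hA', hV', h.imp id fun h => ⟨h.1, ?_, ?_⟩⟩
      · rw [State.potential, State.potential, h.2.1]
      · rw [State.Stable, h.2.1]
        exact h.2.2
  · intro hb
    have hf : s₂.nat 6 0 ≠ 0 := by simpa [Test.Holds, NatExpr.eval] using hb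
    refine Runs.of_loopFree rfl ?_ ⟨hA2, hV2, Or.inl (h.resolve_right fun h => hf h.1)⟩
    simp only [Prog.bound]
    nlinarith

/-- Push and relabel as long as possible. -/
def stabilise : Prog :=
  Prog.seq (Prog.setNat 6 (NatExpr.const 0) (NatExpr.const 1))
    (Prog.loop (Test.natLe (NatExpr.const 1) (NatExpr.var 6)) improveStep)

theorem runs_stabilise {s₀ s : State} (hN : s₀.IsNetwork) (hA : Agree s₀ s) (hV : s₀.Valid s) :
    Runs stabilise s (3 + (s₀.potential s + 2) * (5 + 1000 * (s₀.nat 0 0 + s₀.nat 0 1 + 2)))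
      fun s' => Agree s₀ s' ∧ s₀.Valid s' ∧ s₀.Stable s' := by
  have h1 : Runs (Prog.setNat 6 (NatExpr.const 0) (NatExpr.const 1)) s 3 fun s' =>
      Agree s₀ s' ∧ s'.edgeSplit = s.edgeSplit ∧ s'.nat 6 0 = 1 := by
    refine Runs.agree rfl hA (Runs.of_loopFree rfl (by decide) ⟨?_, ?_⟩)
    · exact State.edgeSplit_writeNat s (by norm_num) _ _
    · simp [Prog.run, NatExpr.eval]
  refine Runs.seq h1 ?_
  rintro s₁ ⟨hA1, he1, hf1⟩
  -- The flag is part of the measure: the last pass leaves the potential unchanged and only lowers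
  -- the flag from 1 to 0.
  refine (Runs.loop (fun s' => Agree s₀ s' ∧ s₀.Valid s' ∧
    (s'.nat 6 0 = 1 ∨ (s'.nat 6 0 = 0 ∧ s₀.Stable s')))
    (fun s' => s₀.potential s' + s'.nat 6 0) (B := 1000 * (s₀.nat 0 0 + s₀.nat 0 1 + 2)) ?_ s₁
    ⟨hA1, by rwa [State.Valid, he1], Or.inl hf1⟩).mono ?_ ?_
  · rintro s' ⟨hA', hV', h⟩ hb
    have hf : s'.nat 6 0 ≠ 0 := by
      simp only [Test.Holds, NatExpr.eval, NatExpr.eval_var] at hb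
      omega
    have hf' := h.resolve_right fun h => hf h.1
    refine (runs_improveStep hN hA' hV').mono le_rfl ?_
    rintro s'' ⟨hA2, hV2, h2⟩
    refine ⟨⟨hA2, hV2, h2.imp And.left fun h => ⟨h.1, h.2.2⟩⟩, ?_⟩
    rcases h2 with h2 | h2 <;> omega
  · have : s₀.potential s₁ = s₀.potential s := by rw [State.potential, he1]; rfl
    rw [this, hf1]
    simp only [Test.cost, NatExpr.var, NatExpr.cost]
    exact Nat.mul_le_mul le_rfl (by omega)
  · rintro s' ⟨⟨hA', hV', h⟩, hb⟩
    refine ⟨hA', hV', (h.resolve_left fun h => hb ?_).2⟩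
    simp [Test.Holds, NatExpr.eval, h]

end RealRAM

namespace RealRAM

/-! #### Reading off a maximum closure -/

def gapIndex : NatExpr := NatExpr.var 8

/-- Store in the array `8` a label between `0` and the number of vertices that does not occur. -/
def findGap : Prog :=
  Prog.seq (Prog.forLoop 4 (NatExpr.add numVertices (NatExpr.const 1))
      (Prog.setNat 9 ctr (NatExpr.const 0)))
    (Prog.seq (Prog.forLoop 4 numVertices (Prog.setNat 9 (NatExpr.read 7 ctr) (NatExpr.const 1)))
      (Prog.seq (Prog.setNat 8 (NatExpr.const 0) (NatExpr.const 0))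
        (Prog.loop (Test.natLe (NatExpr.const 1) (NatExpr.read 9 gapIndex))
          (Prog.setNat 8 (NatExpr.const 0) (NatExpr.add gapIndex (NatExpr.const 1))))))

/-- Pigeonhole: n vertices cannot carry all the n + 1 labels 0, …, n. -/
theorem exists_label_gap (n : ℕ) (d : ℕ → ℕ) : ∃ g ≤ n, ∀ v < n, d v ≠ g := by
  by_contra hcon
  push Not at hcon
  have hsub : Finset.range (n + 1) ⊆ (Finset.range n).image d := by
    intro g hg
    obtain ⟨v, hv, hvg⟩ := hcon g (Nat.lt_succ_iff.1 (Finset.mem_range.1 hg))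
    exact Finset.mem_image.2 ⟨v, Finset.mem_range.2 hv, hvg⟩
  have h1 := (Finset.card_le_card hsub).trans Finset.card_image_le
  simp at h1

theorem runs_findGap {s₀ s : State} (hA : Agree s₀ s) :
    Runs findGap s (100 * (s₀.nat 0 0 + 2)) fun s' => Agree s₀ s' ∧ s'.nat 7 = s.nat 7 ∧
      s'.nat 8 0 ≤ s₀.nat 0 0 ∧ ∀ v < s₀.nat 0 0, s.nat 7 v ≠ s'.nat 8 0 := by
  set n := s₀.nat 0 0 with hn
  have h1 : Runs (Prog.forLoop 4 (NatExpr.add numVertices (NatExpr.const 1))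
      (Prog.setNat 9 ctr (NatExpr.const 0))) s ((n + 1 + 1) * (10 + 4 + 14)) fun s' =>
      (Agree s₀ s' ∧ s'.nat 7 = s.nat 7) ∧ ∀ i < n + 1, s'.nat 9 i = 0 := by
    refine Runs.forLoop (by decide) (n + 1) 10 (fun k s' =>
      (Agree s₀ s' ∧ s'.nat 7 = s.nat 7) ∧ ∀ i < k, s'.nat 9 i = 0) ?_ ?_ ?_ s ?_
    · rintro k s' v ⟨⟨hA', h7⟩, h⟩
      exact ⟨⟨hA'.writeNat (by norm_num) _ _, by rw [← h7]; funext i; simp⟩, by simpa using h⟩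
    · intro k s' h
      have := h.1.1.numVertices_eval
      simp only [NatExpr.eval] at this ⊢
      omega
    · rintro k hk s' ⟨⟨hA', h7⟩, h⟩ hc
      refine Runs.of_loopFree rfl (by decide) ⟨⟨hA'.run rfl rfl, ?_⟩, fun i hi => ?_⟩
      · rw [← h7]
        exact Prog.run_nat rfl _ (by decide)
      · by_cases hik : i = k
        · subst hik
          subst hc
          simp [Prog.run, NatExpr.eval]
        · have := h i (by omega)
          simp [Prog.run, NatExpr.eval, hc, hik, this]
    · exact ⟨⟨hA, rfl⟩, fun i hi => absurd hi (by omega)⟩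
  have h2 : ∀ s₁, ((Agree s₀ s₁ ∧ s₁.nat 7 = s.nat 7) ∧ ∀ i < n + 1, s₁.nat 9 i = 0) →
      Runs (Prog.forLoop 4 numVertices (Prog.setNat 9 (NatExpr.read 7 ctr) (NatExpr.const 1))) s₁
        ((n + 1) * (10 + 2 + 14)) fun s' => (Agree s₀ s' ∧ s'.nat 7 = s.nat 7) ∧
          ∀ i < n + 1, (1 ≤ s'.nat 9 i ↔ ∃ v < n, s.nat 7 v = i) := by
    rintro s₁ ⟨hA1, h⟩
    refine Runs.forLoop (by decide) n 10 (fun k s' => (Agree s₀ s' ∧ s'.nat 7 = s.nat 7) ∧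
          ∀ i < n + 1, (1 ≤ s'.nat 9 i ↔ ∃ v < k, s.nat 7 v = i)) ?_ ?_ ?_ s₁ ?_
    · rintro k s' v ⟨⟨hA', h7⟩, h⟩
      exact ⟨⟨hA'.writeNat (by norm_num) _ _, by rw [← h7]; funext i; simp⟩, by simpa using h⟩
    · exact fun k s' h => h.1.1.numVertices_eval
    · rintro k hk s' ⟨⟨hA', h7⟩, h⟩ hc
      refine Runs.of_loopFree rfl (by decide) ⟨⟨hA'.run rfl rfl, ?_⟩, fun i hi => ?_⟩
      · rw [← h7]
        exact Prog.run_nat rfl _ (by decide)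
      · have h3 := h i hi
        simp only [Prog.run, NatExpr.eval, NatExpr.eval_var, State.writeNat_nat, true_and, h7, hc]
        split_ifs with h4
        · exact ⟨fun _ => ⟨k, Nat.lt_succ_self k, h4.symm⟩, fun _ => le_rfl⟩
        · rw [h3]
          constructor
          · rintro ⟨v, hv, hvi⟩
            exact ⟨v, by omega, hvi⟩
          · rintro ⟨v, hv, hvi⟩
            refine ⟨v, ?_, hvi⟩
            rcases Nat.lt_succ_iff_lt_or_eq.1 hv with hv | rfl
            · exact hv
            · exact absurd hvi.symm h4
    · refine ⟨hA1, fun i hi => ?_⟩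
      simp [h i hi]
  have h3 : ∀ s₂, ((Agree s₀ s₂ ∧ s₂.nat 7 = s.nat 7) ∧
      ∀ i < n + 1, (1 ≤ s₂.nat 9 i ↔ ∃ v < n, s.nat 7 v = i)) →
      Runs (Prog.seq (Prog.setNat 8 (NatExpr.const 0) (NatExpr.const 0))
        (Prog.loop (Test.natLe (NatExpr.const 1) (NatExpr.read 9 gapIndex))
          (Prog.setNat 8 (NatExpr.const 0) (NatExpr.add gapIndex (NatExpr.const 1))))) s₂
        (3 + (n + 1) * 20) fun s' => Agree s₀ s' ∧ s'.nat 7 = s.nat 7 ∧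
          s'.nat 8 0 ≤ n ∧ ∀ v < n, s.nat 7 v ≠ s'.nat 8 0 := by
    rintro s₂ ⟨hA2, h⟩
    obtain ⟨g, hgn, hg⟩ := exists_label_gap n (s.nat 7)
    refine Runs.seq (R := fun s' => s' = s₂.writeNat 8 0 0) (Runs.of_loopFree rfl (by decide) rfl) ?_
    rintro _ rfl
    -- The distance to some absent label g is the measure; the search cannot move past g.
    refine (Runs.loop (fun s' => (Agree s₀ s' ∧ s'.nat 7 = s.nat 7) ∧ s'.nat 9 = s₂.nat 9 ∧
      s'.nat 8 0 ≤ g) (fun s' => g - s'.nat 8 0) (B := 6) ?_ _ ?_).mono ?_ ?_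
    · rintro s' ⟨⟨hA', h7⟩, h9, h8⟩ hb
      have hne : s'.nat 8 0 ≠ g := by
        intro hne
        simp only [Test.Holds, NatExpr.eval, gapIndex, NatExpr.eval_var, hne, h9] at hb
        obtain ⟨v, hv, hvg⟩ := (h g (by omega)).1 hb
        exact hg v hv hvg
      refine Runs.of_loopFree rfl (by decide) ⟨⟨⟨hA'.run rfl rfl, ?_⟩, ?_, ?_⟩, ?_⟩
      · rw [← h7]
        exact Prog.run_nat rfl _ (by decide)
      · rw [← h9]
        exact Prog.run_nat rfl _ (by decide)
      · simp [Prog.run, NatExpr.eval, gapIndex]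
        omega
      · simp [Prog.run, NatExpr.eval, gapIndex]
        omega
    · refine ⟨⟨hA2.1.writeNat (by norm_num) _ _, ?_⟩, ?_, by simp⟩
      · rw [← hA2.2]
        funext i
        simp
      · funext i
        simp
    · refine Nat.mul_le_mul ?_ ?_
      · omega
      · decide
    · rintro s' ⟨⟨hA', h9, h8⟩, hb⟩
      refine ⟨hA'.1, hA'.2, h8.trans hgn, fun v hv hvg => hb ?_⟩
      simp only [Test.Holds, NatExpr.eval, gapIndex, NatExpr.eval_var, h9]
      exact (h _ (by omega)).2 ⟨v, hv, hvg⟩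
  exact (Runs.seq h1 fun s₁ hs₁ => Runs.seq (h2 s₁ hs₁) h3).mono (by ring_nf; omega) fun _ h => h

def addToPoint (a b : ℕ) : Prog :=
  Prog.seq
    (Prog.setReal 16 (NatExpr.const 0)
      (RealExpr.add (RealExpr.read 16 (NatExpr.const 0)) (RealExpr.read a ctr)))
    (Prog.setReal 17 (NatExpr.const 0)
      (RealExpr.add (RealExpr.read 17 (NatExpr.const 0)) (RealExpr.read b ctr)))

def addVertex : Prog :=
  Prog.branch (Test.not (Test.natLe (NatExpr.read 7 ctr) gapIndex)) (addToPoint 0 1) Prog.skip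

def addEdge : Prog :=
  Prog.branch
    (Test.and (Test.and (Test.not (Test.natLe (NatExpr.read 7 (NatExpr.read 1 ctr)) gapIndex))
        (Test.not (Test.natLe (NatExpr.read 7 (NatExpr.read 2 ctr)) gapIndex)))
      (isPos edgeKeyFst edgeKeySnd)) (addToPoint 2 3) Prog.skip

/-- Sum the weights of the vertices with labels above the gap, and of the edges of positive weight
that they span. -/
def sumPoint : Prog :=
  Prog.seq (Prog.seq (Prog.setReal 16 (NatExpr.const 0) zeroReal)
      (Prog.setReal 17 (NatExpr.const 0) zeroReal))
    (Prog.seq (Prog.forLoop 4 numVertices addVertex) (Prog.forLoop 4 numEdges addEdge))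

def State.point (s : State) : ℝ × ℝ := (s.real 16 0, s.real 17 0)

open Classical in
/-- The weight of a set of vertices with the edges of positive weight that it spans. -/
noncomputable def State.selection (s : State) (S : ℕ → Prop) : ℝ × ℝ :=
  (∑ v ∈ Finset.range (s.nat 0 0), if S v then s.vertexWeight v else 0) +
    ∑ j ∈ Finset.range (s.nat 0 1),
      if S (s.nat 1 j) ∧ S (s.nat 2 j) ∧ 0 < s.key (s.edgeWeight j) then s.edgeWeight j else 0

theorem addToPoint_run {a b : ℕ} (ha : a < 16) (hb : b < 16) (s : State) :
    ((addToPoint a b).run s).point = s.point + (s.real a (s.nat 4 0), s.real b (s.nat 4 0)) := by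
  have h1 : a ≠ 16 := by omega
  have h2 : b ≠ 16 := by omega
  simp [addToPoint, Prog.run, RealExpr.eval, NatExpr.eval, State.point, h2]

open Classical in
theorem runs_sumPoint {s₀ s : State} (hA : Agree s₀ s) :
    Runs sumPoint s (200 * (s₀.nat 0 0 + s₀.nat 0 1 + 2)) fun s' => Agree s₀ s' ∧
      s'.point = s₀.selection fun v => s.nat 8 0 < s.nat 7 v := by
  set n := s₀.nat 0 0 with hn
  set m := s₀.nat 0 1 with hm
  have h1 : Runs (Prog.seq (Prog.setReal 16 (NatExpr.const 0) zeroReal)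
      (Prog.setReal 17 (NatExpr.const 0) zeroReal)) s 6 fun s' =>
      (Agree s₀ s' ∧ s'.nat 7 = s.nat 7 ∧ s'.nat 8 = s.nat 8) ∧ s'.point = 0 := by
    refine Runs.of_loopFree rfl (by decide) ⟨⟨hA.run rfl rfl, ?_, ?_⟩, ?_⟩
    · exact Prog.run_nat rfl _ (by decide)
    · exact Prog.run_nat rfl _ (by decide)
    · simp [Prog.run, State.point, RealExpr.eval, NatExpr.eval]
  have h2 : ∀ s₁, ((Agree s₀ s₁ ∧ s₁.nat 7 = s.nat 7 ∧ s₁.nat 8 = s.nat 8) ∧ s₁.point = 0) →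
      Runs (Prog.forLoop 4 numVertices addVertex) s₁ ((n + 1) * (60 + 2 + 14)) fun s' =>
        (Agree s₀ s' ∧ s'.nat 7 = s.nat 7 ∧ s'.nat 8 = s.nat 8) ∧
        s'.point = ∑ v ∈ Finset.range n,
          if s.nat 8 0 < s.nat 7 v then s₀.vertexWeight v else 0 := by
    rintro s₁ ⟨hA1, h⟩
    refine Runs.forLoop (by decide) n 60 (fun k s' =>
      (Agree s₀ s' ∧ s'.nat 7 = s.nat 7 ∧ s'.nat 8 = s.nat 8) ∧
        s'.point = ∑ v ∈ Finset.range k,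
          if s.nat 8 0 < s.nat 7 v then s₀.vertexWeight v else 0) ?_ ?_ ?_ s₁ ?_
    · rintro k s' v ⟨⟨hA', h7, h8⟩, h⟩
      refine ⟨⟨hA'.writeNat (by norm_num) _ _, ?_, ?_⟩, h⟩
      · rw [← h7]
        funext i
        simp
      · rw [← h8]
        funext i
        simp
    · exact fun k s' h => h.1.1.numVertices_eval
    · rintro k hk s' ⟨⟨hA', h7, h8⟩, h⟩ hc
      refine Runs.of_loopFree rfl (by decide) ⟨⟨hA'.run rfl rfl, ?_, ?_⟩, ?_⟩
      · rw [← h7]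
        exact Prog.run_nat rfl _ (by decide)
      · rw [← h8]
        exact Prog.run_nat rfl _ (by decide)
      · have ht : (Test.not (Test.natLe (NatExpr.read 7 ctr) gapIndex)).Holds s' ↔
            s.nat 8 0 < s.nat 7 k := by
          simp only [Test.Holds, NatExpr.eval, gapIndex, NatExpr.eval_var, h7, h8, hc, not_le]
        rw [Finset.sum_range_succ, ← h, addVertex, Prog.run]
        by_cases hk' : s.nat 8 0 < s.nat 7 k
        · rw [if_pos (ht.2 hk'), if_pos hk', addToPoint_run (by norm_num) (by norm_num), hc,
            ← hA'.vertexWeight_eq]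
          rfl
        · rw [if_neg (mt ht.1 hk'), if_neg hk', add_zero]
          rfl
    · exact ⟨hA1, by simpa using h⟩
  have h3 : ∀ s₂, ((Agree s₀ s₂ ∧ s₂.nat 7 = s.nat 7 ∧ s₂.nat 8 = s.nat 8) ∧
      s₂.point = ∑ v ∈ Finset.range n, if s.nat 8 0 < s.nat 7 v then s₀.vertexWeight v else 0) →
      Runs (Prog.forLoop 4 numEdges addEdge) s₂ ((m + 1) * (120 + 2 + 14)) fun s' =>
        (Agree s₀ s' ∧ s'.nat 7 = s.nat 7 ∧ s'.nat 8 = s.nat 8) ∧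
        s'.point = (∑ v ∈ Finset.range n,
          if s.nat 8 0 < s.nat 7 v then s₀.vertexWeight v else 0) +
          ∑ j ∈ Finset.range m, if s.nat 8 0 < s.nat 7 (s₀.nat 1 j) ∧
            s.nat 8 0 < s.nat 7 (s₀.nat 2 j) ∧ 0 < s₀.key (s₀.edgeWeight j)
          then s₀.edgeWeight j else 0 := by
    rintro s₂ ⟨hA2, h⟩
    refine Runs.forLoop (by decide) m 120 (fun k s' =>
      (Agree s₀ s' ∧ s'.nat 7 = s.nat 7 ∧ s'.nat 8 = s.nat 8) ∧
        s'.point = (∑ v ∈ Finset.range n,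
          if s.nat 8 0 < s.nat 7 v then s₀.vertexWeight v else 0) +
          ∑ j ∈ Finset.range k, if s.nat 8 0 < s.nat 7 (s₀.nat 1 j) ∧
            s.nat 8 0 < s.nat 7 (s₀.nat 2 j) ∧ 0 < s₀.key (s₀.edgeWeight j)
          then s₀.edgeWeight j else 0) ?_ ?_ ?_ s₂ ?_
    · rintro k s' v ⟨⟨hA', h7, h8⟩, h⟩
      refine ⟨⟨hA'.writeNat (by norm_num) _ _, ?_, ?_⟩, h⟩
      · rw [← h7]
        funext i
        simp
      · rw [← h8]
        funext i
        simp
    · exact fun k s' h => h.1.1.numEdges_eval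
    · rintro k hk s' ⟨⟨hA', h7, h8⟩, h⟩ hc
      refine Runs.of_loopFree rfl (by decide) ⟨⟨hA'.run rfl rfl, ?_, ?_⟩, ?_⟩
      · rw [← h7]
        exact Prog.run_nat rfl _ (by decide)
      · rw [← h8]
        exact Prog.run_nat rfl _ (by decide)
      · have ht : (Test.and (Test.and
            (Test.not (Test.natLe (NatExpr.read 7 (NatExpr.read 1 ctr)) gapIndex))
            (Test.not (Test.natLe (NatExpr.read 7 (NatExpr.read 2 ctr)) gapIndex)))
            (isPos edgeKeyFst edgeKeySnd)).Holds s' ↔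
            (s.nat 8 0 < s.nat 7 (s₀.nat 1 k) ∧ s.nat 8 0 < s.nat 7 (s₀.nat 2 k) ∧
              0 < s₀.key (s₀.edgeWeight k)) := by
          simp only [Test.Holds, NatExpr.eval, gapIndex, NatExpr.eval_var, edgeKey_holds, h7, h8,
            hc, not_le, hA'.nat 1 (by norm_num), hA'.nat 2 (by norm_num), hA'.key_eq,
            hA'.edgeWeight_eq, and_assoc]
        rw [Finset.sum_range_succ, ← add_assoc, ← h, addEdge, Prog.run]
        split_ifs with h5 h6 h6
        · rw [addToPoint_run (by norm_num) (by norm_num), hc, ← hA'.edgeWeight_eq]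
          rfl
        · exact absurd (ht.1 h5) h6
        · exact absurd (ht.2 h6) h5
        · rw [add_zero]
          rfl
    · exact ⟨hA2, by simpa using h⟩
  exact (Runs.seq h1 fun s₁ hs₁ => Runs.seq (h2 s₁ hs₁) h3).mono (by ring_nf; omega)
    fun s' h => ⟨h.1.1, by
      rw [State.selection, h.2]
      congr!⟩

/-- Compute the lexicographically largest weight of a closed set in the current direction. -/
def oracle : Prog :=
  Prog.seq initSplit (Prog.seq stabilise (Prog.seq findGap sumPoint))

theorem key_sum (s : State) {ι : Type*} (J : Finset ι) (f : ι → ℝ × ℝ) :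
    s.key (∑ i ∈ J, f i) = ∑ i ∈ J, s.key (f i) :=
  map_sum (⟨⟨s.key, lexKey_zero _ _⟩, lexKey_add _ _⟩ : (ℝ × ℝ) →+ ℝ ×ₗ ℝ) f J

open Classical in
theorem key_selection (s : State) (S : Finset ℕ) : s.key (s.selection fun v => v ∈ S) =
    EdgeSplit.closureValue (s.nat 0 0) (s.nat 0 1) (s.nat 1) (s.nat 2) s.vertexKey s.edgeGain S := by
  have h0 : s.key 0 = 0 := lexKey_zero _ _
  have hadd : ∀ z z', s.key (z + z') = s.key z + s.key z' := lexKey_add _ _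
  rw [State.selection, hadd, key_sum, key_sum, EdgeSplit.closureValue]
  congr 1
  · refine Finset.sum_congr rfl fun v _ => ?_
    split_ifs
    · rfl
    · exact h0
  · refine Finset.sum_congr rfl fun j _ => ?_
    rw [State.edgeGain]
    by_cases h1 : s.nat 1 j ∈ S ∧ s.nat 2 j ∈ S
    · rw [if_pos h1]
      by_cases h2 : 0 < s.key (s.edgeWeight j)
      · rw [if_pos ⟨h1.1, h1.2, h2⟩, max_eq_left h2.le]
      · rw [if_neg (fun h => h2 h.2.2), max_eq_right (not_lt.1 h2), h0]
    · rw [if_neg (fun h => h1 ⟨h.1, h.2.1⟩), if_neg h1, h0]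

/-- The potential is at most of order n ^ 5 and a pass costs at most of order n ^ 2, as m ≤ n ^ 2;
this gives the seventh power. Optimality is `EdgeSplit.Valid.closureValue_le`, applied to the gap
that was found. -/
theorem runs_oracle {s₀ : State} (hN : s₀.IsNetwork) (hn : 1 ≤ s₀.nat 0 0)
    (hm : s₀.nat 0 1 ≤ s₀.nat 0 0 ^ 2) :
    Runs oracle s₀ (200000 * s₀.nat 0 0 ^ 7) fun s => Agree s₀ s ∧
      ∃ T : Finset ℕ, s.point = s₀.selection (fun v => v ∈ T) ∧
        ∀ S : Finset ℕ, s₀.key (s₀.selection fun v => v ∈ S) ≤ s₀.key s.point := by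
  set n := s₀.nat 0 0 with hn'
  set m := s₀.nat 0 1 with hm'
  have hlin : n + m + 2 ≤ 4 * n ^ 2 := by nlinarith
  have hpot : ∀ s, s₀.Valid s → s₀.potential s + 2 ≤ 32 * n ^ 5 := by
    intro s hV
    refine (Nat.add_le_add_right (EdgeSplit.Valid.potential_le hV) 2).trans ?_
    rw [← hn', ← hm']
    have h2 : n ^ 2 ≤ n ^ 5 := Nat.pow_le_pow_right hn (by norm_num)
    have h3 : n ^ 3 ≤ n ^ 5 := Nat.pow_le_pow_right hn (by norm_num)
    have h0 : 1 ≤ n ^ 3 := Nat.one_le_pow _ _ hn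
    have h4 : 2 * m * (n + 1 + 2) ≤ 8 * n ^ 3 := by
      calc 2 * m * (n + 1 + 2) ≤ 2 * n ^ 2 * (4 * n) :=
            Nat.mul_le_mul (Nat.mul_le_mul_left 2 hm) (by omega)
        _ = 8 * n ^ 3 := by ring
    have h5 : n * (n + 1) ≤ 2 * n ^ 2 := by nlinarith
    have h6 : (2 * m * (n + 1 + 2) + 2) * (n * (n + 1)) ≤ 20 * n ^ 5 := by
      calc (2 * m * (n + 1 + 2) + 2) * (n * (n + 1)) ≤ (10 * n ^ 3) * (2 * n ^ 2) :=
            Nat.mul_le_mul (by omega) h5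
        _ = 20 * n ^ 5 := by ring
    have h7 : (n + 1 + 2) * (2 * m) = 2 * m * (n + 1 + 2) := by ring
    omega
  refine (Runs.seq (runs_initSplit hN) (B' := 3 + 32 * n ^ 5 * (5 + 1000 * (4 * n ^ 2)) +
    (100 * (n + 2) + 200 * (n + m + 2))) ?_).mono ?_ fun _ h => h
  · rintro s₁ ⟨hA1, hV1⟩
    refine Runs.seq ((runs_stabilise hN hA1 hV1).mono ?_ fun _ h => h) ?_
    · refine Nat.add_le_add_left (Nat.mul_le_mul (hpot _ hV1) ?_) 3
      omega
    rintro s₂ ⟨hA2, hV2, hS2⟩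
    refine Runs.seq (runs_findGap hA2) ?_
    rintro s₃ ⟨hA3, h7, h8, hgap⟩
    refine (runs_sumPoint hA3).mono le_rfl ?_
    rintro s₄ ⟨hA4, hp⟩
    set T := (Finset.range n).filter fun v => s₃.nat 8 0 < s₂.nat 7 v with hT
    have hsel : s₄.point = s₀.selection fun v => v ∈ T := by
      rw [hp, h7]
      have hmem : ∀ v < n, (s₃.nat 8 0 < s₂.nat 7 v ↔ v ∈ T) := by
        intro v hv
        simp [hT, hv]
      classical
      rw [State.selection, State.selection]
      congr 1
      · refine Finset.sum_congr rfl fun v hv => ?_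
        simp only [hmem v (Finset.mem_range.1 hv)]
        congr!
      · refine Finset.sum_congr rfl fun j hj => ?_
        have hj' := Finset.mem_range.1 hj
        simp only [hmem _ (hN.src_lt j hj'), hmem _ (hN.tgt_lt j hj')]
        congr!
    refine ⟨hA4, T, hsel, fun S => ?_⟩
    rw [hsel, key_selection, key_selection]
    refine EdgeSplit.Valid.closureValue_le hV2 hN hS2 (Nat.lt_succ_of_le h8) hgap S T ?_
    intro v hv
    rw [hT, Finset.mem_filter, Finset.mem_range]
    exact and_iff_right hv
  · have h1 : n ^ 2 ≤ n ^ 7 := Nat.pow_le_pow_right hn (by norm_num)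
    have h2 : n ^ 5 ≤ n ^ 7 := Nat.pow_le_pow_right hn (by norm_num)
    have h3 : n ≤ n ^ 7 := Nat.le_self_pow (by norm_num) n
    have h4 : 32 * n ^ 5 * (5 + 1000 * (4 * n ^ 2)) = 160 * n ^ 5 + 128000 * n ^ 7 := by ring
    omega

end RealRAM

/-! ### Convex polygons -/

open RealRAM

/-- Twice the signed area of the triangle `a b c`. -/
def orient (a b c : ℝ × ℝ) : ℝ :=
  (b.1 - a.1) * (c.2 - a.2) - (b.2 - a.2) * (c.1 - a.1)

/-- For (p, q) ≠ 0 this is an open half-plane together with a closed ray of its boundary. -/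
theorem convex_lexKey_le (p q : ℝ) (c : ℝ ×ₗ ℝ) : Convex ℝ {z | lexKey p q z ≤ c} := by
  obtain ⟨c, rfl⟩ := toLex.surjective c
  intro x hx y hy a b ha hb hab
  simp only [Set.mem_ofPred_eq, lexKey, Prod.Lex.toLex_le_toLex] at hx hy ⊢
  simp only [Prod.fst_add, Prod.snd_add, Prod.smul_fst, Prod.smul_snd, smul_eq_mul]
  have e1 : p * (a * x.1 + b * y.1) + q * (a * x.2 + b * y.2) =
      a * (p * x.1 + q * x.2) + b * (p * y.1 + q * y.2) := by ring
  have e2 : p * (a * x.2 + b * y.2) - q * (a * x.1 + b * y.1) =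
      a * (p * x.2 - q * x.1) + b * (p * y.2 - q * y.1) := by ring
  rw [e1, e2]
  generalize p * x.1 + q * x.2 = f at *
  generalize p * y.1 + q * y.2 = g at *
  generalize p * x.2 - q * x.1 = f' at *
  generalize p * y.2 - q * y.1 = g' at *
  have hb' : b = 1 - a := by linarith
  subst hb'
  rcases ha.eq_or_lt with rfl | ha
  · simpa using hy
  rcases hb.eq_or_lt with h0 | hb
  · rw [← h0, (by linarith : a = 1)]
    simpa using hx
  rcases hx with hx | ⟨hx, hx'⟩ <;> rcases hy with hy | ⟨hy, hy'⟩
  · left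
    nlinarith
  · left
    nlinarith
  · left
    nlinarith
  · right
    subst hx
    rw [hy]
    exact ⟨by ring, by nlinarith⟩

/-- Maximality passes from A to its hull by convexity of `lexKey` sublevel sets. If r is inside a
segment of the hull, both ends attain the maximum in the first component, then in the second, and so
equal r. -/
theorem mem_extremePoints_of_lexKey_max {A : Set (ℝ × ℝ)} {p q : ℝ} (hpq : p ≠ 0 ∨ q ≠ 0)
    {r : ℝ × ℝ} (hr : r ∈ A) (hmax : ∀ z ∈ A, lexKey p q z ≤ lexKey p q r) :
    r ∈ (convexHull ℝ A).extremePoints ℝ ∧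
      ∀ z ∈ convexHull ℝ A, lexKey p q z ≤ lexKey p q r := by
  have hall : ∀ z ∈ convexHull ℝ A, lexKey p q z ≤ lexKey p q r := fun z hz =>
    convexHull_min (s := A) (t := {z | lexKey p q z ≤ lexKey p q r}) hmax
      (convex_lexKey_le p q _) hz
  refine ⟨mem_extremePoints.2 ⟨subset_convexHull ℝ A hr, ?_⟩, hall⟩
  -- The two components of the key form a linear map of determinant p ^ 2 + q ^ 2.
  have hinj : ∀ z, p * z.1 + q * z.2 = p * r.1 + q * r.2 → p * z.2 - q * z.1 = p * r.2 - q * r.1 →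
      z = r := by
    intro z h1 h2
    have hpos : p ^ 2 + q ^ 2 ≠ 0 := by
      rcases hpq with h | h <;> positivity
    refine Prod.ext (mul_left_cancel₀ hpos ?_) (mul_left_cancel₀ hpos ?_)
    · linear_combination p * h1 - q * h2
    · linear_combination q * h1 + p * h2
  rintro x hx y hy ⟨a, b, ha, hb, hab, hxy⟩
  have h1 := congrArg Prod.fst hxy
  have h2 := congrArg Prod.snd hxy
  simp only [Prod.fst_add, Prod.snd_add, Prod.smul_fst, Prod.smul_snd, smul_eq_mul] at h1 h2
  have hx' := hall x hx
  have hy' := hall y hy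
  simp only [lexKey, Prod.Lex.toLex_le_toLex] at hx' hy'
  have e1 : a * (p * x.1 + q * x.2) + b * (p * y.1 + q * y.2) = p * r.1 + q * r.2 := by
    rw [← h1, ← h2]
    ring
  have e2 : a * (p * x.2 - q * x.1) + b * (p * y.2 - q * y.1) = p * r.2 - q * r.1 := by
    rw [← h1, ← h2]
    ring
  have key : ∀ f g c : ℝ, a * f + b * g = c → f ≤ c → g ≤ c → f = c ∧ g = c := by
    intro f g c h hf hg
    have hb' : b = 1 - a := by linarith
    subst hb'
    constructor <;> nlinarith
  have hf := key _ _ _ e1 (hx'.elim le_of_lt fun h => h.1.le) (hy'.elim le_of_lt fun h => h.1.le)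
  have hx2 := hx'.resolve_left (by rw [hf.1]; exact lt_irrefl _)
  have hy2 := hy'.resolve_left (by rw [hf.2]; exact lt_irrefl _)
  have hg := key _ _ _ e2 hx2.2 hy2.2
  exact ⟨hinj x hf.1 hg.1, hinj y hf.2 hg.2⟩

theorem eq_of_mem_extremePoints_of_combination {K : Set (ℝ × ℝ)} (hK : Convex ℝ K)
    {x a b c : ℝ × ℝ} (hx : x ∈ K.extremePoints ℝ) (ha : a ∈ K) (hb : b ∈ K) (hc : c ∈ K)
    {l m n : ℝ} (hl : 0 < l) (hm : 0 ≤ m) (hn : 0 ≤ n) (hsum : l + m + n = 1)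
    (h1 : x.1 = l * a.1 + m * b.1 + n * c.1) (h2 : x.2 = l * a.2 + m * b.2 + n * c.2) : a = x := by
  rcases (add_nonneg hm hn).eq_or_lt with h0 | hpos
  · have hm0 : m = 0 := by linarith
    have hn0 : n = 0 := by linarith
    have hl1 : l = 1 := by linarith
    subst hm0 hn0 hl1
    exact Prod.ext (by rw [h1]; ring) (by rw [h2]; ring)
  · have hd : (m / (m + n)) • b + (n / (m + n)) • c ∈ K :=
      hK hb hc (by positivity) (by positivity) (by field_simp)
    refine ((mem_extremePoints.1 hx).2 a ha _ hd ⟨l, m + n, hl, hpos, by linarith, ?_⟩).1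
    ext
    · simp only [Prod.fst_add, Prod.smul_fst, smul_eq_mul, h1]
      field_simp
      ring
    · simp only [Prod.snd_add, Prod.smul_snd, smul_eq_mul, h2]
      field_simp
      ring

/-- An extreme point lies in a triangle only as a vertex. -/
theorem eq_of_mem_extremePoints_of_orient {K : Set (ℝ × ℝ)} (hK : Convex ℝ K)
    {x a b c : ℝ × ℝ} (hx : x ∈ K.extremePoints ℝ) (ha : a ∈ K) (hb : b ∈ K) (hc : c ∈ K)
    (h : 0 < orient a b c) (h1 : 0 < orient x b c) (h2 : 0 ≤ orient a x c)
    (h3 : 0 ≤ orient a b x) : a = x := by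
  -- The barycentric coordinates of x are quotients of signed areas.
  refine eq_of_mem_extremePoints_of_combination hK hx ha hb hc (l := orient x b c / orient a b c)
    (m := orient a x c / orient a b c) (n := orient a b x / orient a b c) (by positivity)
    (by positivity) (by positivity) ?_ ?_ ?_
  · field_simp
    simp only [orient]
    ring
  · field_simp
    simp only [orient]
    ring
  · field_simp
    simp only [orient]
    ring

/-- A chain of extreme points `g 0, …, g (P - 1)` of `K`, sorted by angle around the lowest of the
leftmost points `g 0` of `K`; the first `M` of them span consecutive edges of `K`. -/
structure HullChain (K : Set (ℝ × ℝ)) (g : ℕ → ℝ × ℝ) (P M : ℕ) : Prop where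
  one_le : 1 ≤ M
  le : M ≤ P
  extreme : ∀ i < P, g i ∈ K.extremePoints ℝ
  ccw : ∀ i j, 1 ≤ i → i < j → j < P → 0 < orient (g 0) (g i) (g j)
  ne : ∀ i, 1 ≤ i → i < P → g i ≠ g 0
  leftmost : ∀ z ∈ K, z ≠ g 0 → (g 0).1 < z.1 ∨ ((g 0).1 = z.1 ∧ (g 0).2 < z.2)
  support : ∀ i, i + 1 < M → ∀ z ∈ K, 0 ≤ orient (g i) (g (i + 1)) z

namespace HullChain

variable {K : Set (ℝ × ℝ)} {g : ℕ → ℝ × ℝ} {P M : ℕ}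

theorem congr (h : HullChain K g P M) {g' : ℕ → ℝ × ℝ} (hg : ∀ i < P, g' i = g i) :
    HullChain K g' P M := by
  have hM := h.one_le
  have hle := h.le
  have h0 : g' 0 = g 0 := hg 0 (by omega)
  refine ⟨h.one_le, h.le, fun i hi => hg i hi ▸ h.extreme i hi, fun i j hi hij hj => ?_,
    fun i hi hi' => ?_, h0 ▸ h.leftmost, fun i hi z hz => ?_⟩
  · rw [h0, hg i (by omega), hg j hj]
    exact h.ccw i j hi hij hj
  · rw [h0, hg i hi']
    exact h.ne i hi hi'
  · rw [hg i (by omega), hg (i + 1) (by omega)]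
    exact h.support i hi z hz

theorem mem (h : HullChain K g P M) {i : ℕ} (hi : i < P) : g i ∈ K := (h.extreme i hi).1

/-- Seen from `g 0`, the other points of K lie to the right or straight above, and there the
comparison of angles is transitive. Only w can lie straight above. -/
theorem orient_trans (h : HullChain K g P M) {u v w : ℝ × ℝ} (hu : u ∈ K) (hv : v ∈ K)
    (hw : w ∈ K) (hu0 : u ≠ g 0) (hv0 : v ≠ g 0) (hw0 : w ≠ g 0) (huv : 0 < orient (g 0) u v)
    (hvw : 0 < orient (g 0) v w) : 0 < orient (g 0) u w := by
  have h1 := h.leftmost u hu hu0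
  have h2 := h.leftmost v hv hv0
  have h3 := h.leftmost w hw hw0
  have hv1 : 0 < v.1 - (g 0).1 := by
    rcases h2 with h2 | ⟨h2, h2'⟩
    · linarith
    · exfalso
      have : (g 0).1 ≤ w.1 := h3.elim le_of_lt fun h => h.1.le
      simp only [orient, ← h2, sub_self] at hvw
      nlinarith
  have hu1 : 0 < u.1 - (g 0).1 := by
    rcases h1 with h1 | ⟨h1, h1'⟩
    · linarith
    · exfalso
      simp only [orient, ← h1, sub_self] at huv
      nlinarith
  have hw1 : 0 ≤ w.1 - (g 0).1 := by
    have : (g 0).1 ≤ w.1 := h3.elim le_of_lt fun h => h.1.le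
    linarith
  have hid : orient (g 0) u w * (v.1 - (g 0).1) =
      orient (g 0) v w * (u.1 - (g 0).1) + orient (g 0) u v * (w.1 - (g 0).1) := by
    simp only [orient]
    ring
  have hpos : 0 < orient (g 0) u w * (v.1 - (g 0).1) := by
    rw [hid]
    positivity
  exact (mul_pos_iff_of_pos_right hv1).1 hpos

theorem advance (h : HullChain K g P M) (hM : M < P)
    (hs : ∀ z ∈ K, 0 ≤ orient (g (M - 1)) (g M) z) : HullChain K g P (M + 1) := by
  refine ⟨by omega, hM, h.extreme, h.ccw, h.ne, h.leftmost, fun i hi z hz => ?_⟩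
  have h1 := h.one_le
  rcases Nat.lt_succ_iff_lt_or_eq.1 hi with hi | rfl
  · exact h.support i hi z hz
  · exact hs z hz

/-- A point r beyond the candidate edge lies between its ends in the angular order; otherwise one
end would lie in the triangle of `g 0`, r and the other end, against extremality. The remaining
comparisons follow by `orient_trans`. For M = P the candidate is the closing edge back to `g 0`. -/
theorem insert (h : HullChain K g P M) (hK : Convex ℝ K) {r : ℝ × ℝ}
    (hr : r ∈ K.extremePoints ℝ)
    (ho : orient (g (M - 1)) (if M < P then g M else g 0) r < 0) :
    HullChain K (fun i => if i < M then g i else if i = M then r else g (i - 1)) (P + 1) M := by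
  have hM := h.one_le
  have hMP := h.le
  have hne : r ≠ g 0 := by
    rintro rfl
    split_ifs at ho with hlt
    · rcases hM.eq_or_lt with rfl | hM'
      · simp [orient] at ho
      · have := h.ccw (M - 1) M (by omega) (by omega) hlt
        simp only [orient] at this ho
        linarith
    · simp only [orient] at ho
      linarith
  have hfour : ∀ a b, a ∈ K.extremePoints ℝ → b ∈ K.extremePoints ℝ → a ≠ g 0 → b ≠ g 0 →
      0 < orient (g 0) a b → orient a b r < 0 → 0 < orient (g 0) a r ∧ 0 < orient (g 0) r b := by
    intro a b ha hb ha0 hb0 hab habr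
    have h0 := h.mem (i := 0) (by omega)
    have hid : orient (g 0) a b = orient (g 0) a r + orient a b r + orient (g 0) r b := by
      simp only [orient]
      ring
    have hflip : orient a r b = - orient a b r := by
      simp only [orient]
      ring
    have hflip2 : orient (g 0) r a = - orient (g 0) a r := by
      simp only [orient]
      ring
    have hflip3 : orient b a r = - orient a b r := by
      simp only [orient]
      ring
    have hflip4 : orient (g 0) b r = - orient (g 0) r b := by
      simp only [orient]
      ring
    constructor
    · by_contra hcon
      push Not at hcon
      exact ha0 (eq_of_mem_extremePoints_of_orient hK ha h0 hr.1 hb.1 (by linarith) (by linarith)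
        hab.le (by linarith)).symm
    · by_contra hcon
      push Not at hcon
      exact hb0 (eq_of_mem_extremePoints_of_orient hK hb h0 ha.1 hr.1 (by linarith) (by linarith)
        (by linarith) hab.le).symm
  have hbefore : ∀ i, 1 ≤ i → i < M → 0 < orient (g 0) (g i) r := by
    have hlast : 1 ≤ M - 1 → 0 < orient (g 0) (g (M - 1)) r := by
      intro h1
      split_ifs at ho with hlt
      · exact (hfour _ _ (h.extreme _ (by omega)) (h.extreme _ hlt) (h.ne _ h1 (by omega))
          (h.ne _ (by omega) hlt) (h.ccw _ _ h1 (by omega) hlt) ho).1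
      · simp only [orient] at ho ⊢
        linarith
    intro i hi hiM
    rcases Nat.lt_or_ge i (M - 1) with hlt | hge
    · exact h.orient_trans (h.mem (by omega)) (h.mem (i := M - 1) (by omega)) hr.1
        (h.ne _ hi (by omega)) (h.ne _ (by omega) (by omega)) hne
        (h.ccw i (M - 1) hi hlt (by omega)) (hlast (by omega))
    · have : i = M - 1 := by omega
      subst this
      exact hlast hi
  have hafter : ∀ j, M ≤ j → j < P → 0 < orient (g 0) r (g j) := by
    intro j hj hjP
    have hfirst : 0 < orient (g 0) r (g M) := by
      rw [if_pos (by omega)] at ho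
      rcases hM.eq_or_lt with rfl | hM'
      · simp only [orient] at ho ⊢
        linarith
      · exact (hfour _ _ (h.extreme _ (by omega)) (h.extreme _ (by omega))
          (h.ne _ (by omega) (by omega)) (h.ne _ (by omega) (by omega))
          (h.ccw _ _ (by omega) (by omega) (by omega)) ho).2
    rcases hj.eq_or_lt with rfl | hlt
    · exact hfirst
    · exact h.orient_trans hr.1 (h.mem (i := M) (by omega)) (h.mem hjP) hne
        (h.ne _ hM (by omega)) (h.ne _ (by omega) hjP) hfirst (h.ccw M j hM hlt hjP)
  have h0M : 0 < M := hM
  refine ⟨hM, by omega, fun i hi => ?_, fun i j hi hij hj => ?_, fun i hi hiP => ?_, ?_,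
    fun i hi z hz => ?_⟩
  · split_ifs with h1 h2
    · exact h.extreme i (by omega)
    · exact hr
    · exact h.extreme (i - 1) (by omega)
  · simp only [h0M, if_true]
    by_cases hiM : i < M
    · rw [if_pos hiM]
      split_ifs with h1 h2
      · exact h.ccw i j hi hij (by omega)
      · exact hbefore i hi hiM
      · exact h.ccw i (j - 1) hi (by omega) (by omega)
    · rw [if_neg hiM, if_neg (by omega : ¬ j < M), if_neg (by omega : ¬ j = M)]
      split_ifs with h1
      · exact hafter (j - 1) (by omega) (by omega)
      · exact h.ccw (i - 1) (j - 1) (by omega) (by omega) (by omega)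
  · simp only [h0M, if_true]
    split_ifs with h1 h2
    · exact h.ne i hi (by omega)
    · exact hne
    · exact h.ne (i - 1) (by omega) (by omega)
  · simp only [h0M, if_true]
    exact h.leftmost
  · simp only [hi, if_true, (by omega : i < M)]
    exact h.support i hi z hz

theorem injOn (h : HullChain K g P M) {i j : ℕ} (hij : i < j) (hj : j < P) : g i ≠ g j := by
  rcases Nat.eq_zero_or_pos i with rfl | hi
  · exact (h.ne j hij hj).symm
  · intro heq
    have := h.ccw i j hi hij hj
    rw [heq] at this
    simp only [orient] at this
    linarith

theorem injective (h : HullChain K g P M) : Function.Injective fun j : Fin P => g j := by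
  intro i j hij
  rcases lt_trichotomy i j with hlt | heq | hgt
  · exact absurd hij (h.injOn hlt j.2)
  · exact heq
  · exact absurd hij.symm (h.injOn hgt i.2)

theorem le_ncard (h : HullChain K g P M) (hfin : (K.extremePoints ℝ).Finite) :
    P ≤ (K.extremePoints ℝ).ncard := by
  have h1 : Set.range (fun j : Fin P => g j) ⊆ K.extremePoints ℝ := by
    rintro _ ⟨j, rfl⟩
    exact h.extreme j j.2
  have h2 := Set.ncard_le_ncard h1 hfin
  rwa [← Set.image_univ, Set.ncard_image_of_injective _ h.injective, Set.ncard_univ,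
    Nat.card_fin] at h2

/-- A missing extreme point v would lie between two consecutive rays from `g 0` and on the inner
side of the edge joining their points, hence in the triangle they form with `g 0`. If it is not
strictly before the last ray, the closing edge forces it onto the line of that ray. -/
theorem listsVerticesCCW (h : HullChain K g P P) (hK : Convex ℝ K) (hP : 2 ≤ P)
    (hclose : ∀ z ∈ K, 0 ≤ orient (g (P - 1)) (g 0) z) :
    ListsVerticesCCW (fun j : Fin P => g j) K := by
  have h0 := h.mem (i := 0) (by omega)
  refine ⟨h.injective, Set.Subset.antisymm ?_ ?_, ?_⟩
  · rintro _ ⟨j, rfl⟩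
    exact h.extreme j j.2
  · intro v hv
    by_contra hcon
    have hvg : ∀ i < P, v ≠ g i := fun i hi hvi => hcon ⟨⟨i, hi⟩, hvi.symm⟩
    have hv0 := hvg 0 (by omega)
    -- A ray with v on it or to its left, such that the next ray, if any, has v strictly to its
    -- right. The ray through `g 1` starts the search, since the first edge supports K.
    have hex : ∃ j, 1 ≤ j ∧ j < P ∧ 0 ≤ orient (g 0) (g j) v ∧
        (j + 1 < P → orient (g 0) (g (j + 1)) v < 0) := by
      by_contra hno
      push Not at hno
      have hall : ∀ j, j + 1 < P → 0 ≤ orient (g 0) (g (j + 1)) v := by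
        intro j
        induction j with
        | zero => exact fun hj => h.support 0 hj v hv.1
        | succ j ih =>
          intro hj
          exact (hno (j + 1) (by omega) (by omega) (ih (by omega))).2
      have := hno (P - 1) (by omega) (by omega) (by
        have := hall (P - 2) (by omega)
        rwa [(by omega : P - 2 + 1 = P - 1)] at this)
      omega
    obtain ⟨j, hj1, hjP, hj, hnext⟩ := hex
    rcases Nat.lt_or_ge (j + 1) P with hlt | hge
    · have h1 := h.ccw j (j + 1) hj1 (by omega) hlt
      have h2 := hnext hlt
      have h3 := h.support j hlt v hv.1
      refine hvg j hjP (eq_of_mem_extremePoints_of_orient hK hv (h.mem hjP) (h.mem hlt) h0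
        ?_ ?_ ?_ h3).symm
      · simp only [orient] at h1 ⊢
        linarith
      · simp only [orient] at h2 ⊢
        linarith
      · simp only [orient] at hj ⊢
        linarith
    · have hjP' : j = P - 1 := by omega
      have hz := hclose v hv.1
      rw [← hjP'] at hz
      have hzero : orient (g 0) (g j) v = 0 := by
        simp only [orient] at hz hj ⊢
        linarith
      -- `g 0`, `g j` and `v` are on a line
      have hs : ∃ s : ℝ, 0 < s ∧ v.1 - (g 0).1 = s * ((g j).1 - (g 0).1) ∧
          v.2 - (g 0).2 = s * ((g j).2 - (g 0).2) := by
        have ha := h.leftmost (g j) (h.mem hjP) (h.ne j hj1 hjP)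
        have hb := h.leftmost v hv.1 hv0
        simp only [orient] at hzero
        rcases ha with ha | ⟨ha, ha'⟩
        · have ha2 : 0 < (g j).1 - (g 0).1 := by linarith
          have hb2 : 0 < v.1 - (g 0).1 := by
            rcases hb with hb | ⟨hb, hb'⟩
            · linarith
            · exfalso
              rw [← hb, sub_self, mul_zero, sub_zero] at hzero
              rcases mul_eq_zero.1 hzero with h1 | h1 <;> linarith
          refine ⟨(v.1 - (g 0).1) / ((g j).1 - (g 0).1), by positivity, by field_simp, ?_⟩
          field_simp
          linarith
        · have ha2 : 0 < (g j).2 - (g 0).2 := by linarith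
          rw [← ha, sub_self, zero_mul, zero_sub, neg_eq_zero] at hzero
          have hb1 : v.1 - (g 0).1 = 0 := (mul_eq_zero.1 hzero).resolve_left ha2.ne'
          have hb2 : 0 < v.2 - (g 0).2 := by
            rcases hb with hb | ⟨hb, hb'⟩ <;> linarith
          refine ⟨(v.2 - (g 0).2) / ((g j).2 - (g 0).2), by positivity, ?_, by field_simp⟩
          rw [hb1, ← ha, sub_self, mul_zero]
      obtain ⟨s, hs0, hs1, hs2⟩ := hs
      -- Of the collinear points `g 0`, `g j` and v, the one in the middle would not be extreme.
      rcases lt_trichotomy s 1 with hs | hs | hs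
      · refine hv0 (eq_of_mem_extremePoints_of_combination hK hv h0 (h.mem hjP) h0
          (l := 1 - s) (m := s) (n := 0) (by linarith) hs0.le le_rfl (by ring) ?_ ?_).symm <;> linarith
      · subst hs
        exact hvg j hjP (Prod.ext (by linarith) (by linarith))
      · have hsne : s ≠ 0 := hs0.ne'
        have hinv : s⁻¹ < 1 := inv_lt_one_of_one_lt₀ hs
        refine h.ne j hj1 hjP (eq_of_mem_extremePoints_of_combination hK (h.extreme j hjP) h0 hv.1 h0
          (l := 1 - s⁻¹) (m := s⁻¹) (n := 0) (by linarith) (by positivity) le_rfl (by ring) ?_ ?_).symm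
        · field_simp
          linarith
        · field_simp
          linarith
  · intro a b c hab hbc
    change 0 < orient (g a) (g b) (g c)
    have hab' : (a : ℕ) < b := hab
    have hbc' : (b : ℕ) < c := hbc
    rcases Nat.eq_zero_or_pos (a : ℕ) with ha | ha
    · rw [ha]
      exact h.ccw b c (by omega) hbc' c.2
    -- Otherwise `g b` would lie in the triangle `g a`, `g c`, `g 0`.
    · by_contra hneg
      push Not at hneg
      have h1 := h.ccw a b ha hab' b.2
      have h2 := h.ccw b c (by omega) hbc' c.2
      have h3 := h.ccw a c ha (by omega) c.2
      refine h.injOn hab' b.2 (eq_of_mem_extremePoints_of_orient hK (h.extreme b b.2) (h.mem a.2)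
        (h.mem c.2) h0 ?_ ?_ ?_ ?_)
      · simp only [orient] at h3 ⊢
        linarith
      · simp only [orient] at h2 ⊢
        linarith
      · simp only [orient] at h1 ⊢
        linarith
      · simp only [orient] at hneg ⊢
        linarith

end HullChain

namespace RealRAM

/-! ### A program for the vertices of a polygon

The natural arrays `3` and `10` hold the length of the output and the height of a stack of points,
the real arrays `4`, `5` the output and `18`, `19` the stack. -/

abbrev numOut : NatExpr := NatExpr.var 3
abbrev numStack : NatExpr := NatExpr.var 10
abbrev lastOut : NatExpr := NatExpr.sub numOut (NatExpr.const 1)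
abbrev topStack : NatExpr := NatExpr.sub numStack (NatExpr.const 1)
abbrev pointX : RealExpr := RealExpr.read 16 (NatExpr.const 0)
abbrev pointY : RealExpr := RealExpr.read 17 (NatExpr.const 0)

def setDirection (p q : RealExpr) : Prog :=
  Prog.seq (Prog.setReal 6 (NatExpr.const 0) p) (Prog.setReal 7 (NatExpr.const 0) q)

/-- Choose the direction to the right of the line from the last output point to the top of the
stack. -/
def turnRight : Prog :=
  setDirection (RealExpr.sub (RealExpr.read 19 topStack) (RealExpr.read 5 lastOut))
    (RealExpr.sub (RealExpr.read 4 lastOut) (RealExpr.read 18 topStack))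

def storePoint (a b : ℕ) (i : NatExpr) : Prog :=
  Prog.seq (Prog.setReal a i pointX) (Prog.setReal b i pointY)

def dirValue (x y : RealExpr) : RealExpr :=
  RealExpr.add (RealExpr.mul (RealExpr.read 6 (NatExpr.const 0)) x)
    (RealExpr.mul (RealExpr.read 7 (NatExpr.const 0)) y)

/-- Move the top of the stack to the output, unless it is the bottom of the stack. -/
def popStack : Prog :=
  Prog.seq (Prog.setNat 10 (NatExpr.const 0) topStack)
    (Prog.branch (Test.natLe (NatExpr.const 1) numStack)
      (Prog.seq (Prog.setReal 4 numOut (RealExpr.read 18 numStack))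
        (Prog.seq (Prog.setReal 5 numOut (RealExpr.read 19 numStack))
          (Prog.setNat 3 (NatExpr.const 0) (NatExpr.add numOut (NatExpr.const 1)))))
      Prog.skip)

def pushStack : Prog :=
  Prog.seq (storePoint 18 19 numStack)
    (Prog.setNat 10 (NatExpr.const 0) (NatExpr.add numStack (NatExpr.const 1)))

def noPointBeyond : Test :=
  Test.realLe (dirValue pointX pointY)
    (dirValue (RealExpr.read 4 lastOut) (RealExpr.read 5 lastOut))

/-- One query tests the candidate edge from the last output point to the top of the stack. If no
point lies beyond, the edge is confirmed and the top is popped; otherwise the vertex found beyond it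
becomes the new top. -/
def hullStep : Prog :=
  Prog.seq turnRight (Prog.seq oracle (Prog.branch noPointBeyond popStack pushStack))

/-- The directions (-1, 0) and (1, 0) give the lowest leftmost and the highest rightmost vertex. The
former is the first output point and also the bottom of the stack, so that the closing edge is
tested like every other. If the two coincide, the polygon is a point. -/
def hullStart : Prog :=
  Prog.seq (setDirection (RealExpr.const (-1)) zeroReal)
    (Prog.seq oracle
      (Prog.seq
        (Prog.seq (storePoint 4 5 (NatExpr.const 0))
          (Prog.seq (storePoint 18 19 (NatExpr.const 0))
            (Prog.seq (Prog.setNat 3 (NatExpr.const 0) (NatExpr.const 1))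
              (setDirection (RealExpr.const 1) zeroReal))))
        (Prog.seq oracle
          (Prog.branch
            (Test.and
              (Test.and (Test.realLe pointX (RealExpr.read 4 (NatExpr.const 0)))
                (Test.realLe (RealExpr.read 4 (NatExpr.const 0)) pointX))
              (Test.and (Test.realLe pointY (RealExpr.read 5 (NatExpr.const 0)))
                (Test.realLe (RealExpr.read 5 (NatExpr.const 0)) pointY)))
            (Prog.setNat 10 (NatExpr.const 0) (NatExpr.const 0))
            (Prog.seq (storePoint 18 19 (NatExpr.const 1))
              (Prog.setNat 10 (NatExpr.const 0) (NatExpr.const 2)))))))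

/-- Output the vertices of the polygon. -/
def hullProg : Prog :=
  Prog.seq hullStart (Prog.loop (Test.natLe (NatExpr.const 1) numStack) hullStep)

structure SameInput (s₀ s : State) : Prop where
  nat : ∀ a < 3, s.nat a = s₀.nat a
  real : ∀ a < 4, s.real a = s₀.real a

theorem SameInput.trans {s s' s'' : State} (h : SameInput s s') (h' : SameInput s' s'') :
    SameInput s s'' :=
  ⟨fun a ha => (h'.nat a ha).trans (h.nat a ha), fun a ha => (h'.real a ha).trans (h.real a ha)⟩

theorem Agree.sameInput {s s' : State} (h : Agree s s') : SameInput s s' := ⟨h.nat, h.real⟩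

def Prog.sparesInput (p : Prog) : Bool :=
  p.natWrites.all (fun a => Nat.ble 3 a) && p.realWrites.all fun a => Nat.ble 4 a

theorem SameInput.run {p : Prog} (hp : p.sparesInput = true) (hf : p.loopFree = true)
    {s₀ s : State} (hs : SameInput s₀ s) : SameInput s₀ (p.run s) := by
  obtain ⟨t, h, -⟩ := Prog.exec_run hf s
  obtain ⟨hn, hr⟩ := h.frame
  simp only [Prog.sparesInput, Bool.and_eq_true, List.all_eq_true, Nat.ble_eq] at hp
  refine hs.trans ⟨fun a ha => hn a fun h => ?_, fun a ha => hr a fun h => ?_⟩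
  · have := hp.1 a h
    omega
  · have := hp.2 a h
    omega

def State.outPoint (s : State) (i : ℕ) : ℝ × ℝ := (s.real 4 i, s.real 5 i)

def State.stackPoint (s : State) (i : ℕ) : ℝ × ℝ := (s.real 18 i, s.real 19 i)

/-- The output followed by the stack, read downwards. -/
def State.chain (s : State) (i : ℕ) : ℝ × ℝ :=
  if i < s.nat 3 0 then s.outPoint i else s.stackPoint (s.nat 10 0 - 1 - (i - s.nat 3 0))

/-- The bottom of the stack repeats the first output point. -/
def State.chainLength (s : State) : ℕ := s.nat 3 0 + (s.nat 10 0 - 1)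

/-- The oracle finds lexicographically maximal points of `A`. -/
def OracleFor (A : Set (ℝ × ℝ)) (s₀ : State) (T : ℕ) : Prop :=
  ∀ s, SameInput s₀ s → Runs oracle s T fun s' => SameInput s₀ s' ∧ s'.point ∈ A ∧
    ∀ z ∈ A, lexKey (s.real 6 0) (s.real 7 0) z ≤ lexKey (s.real 6 0) (s.real 7 0) s'.point

/-- `s'` has the same output, stack and direction as `s`. -/
structure SameHull (s s' : State) : Prop where
  num : s'.nat 3 = s.nat 3
  height : s'.nat 10 = s.nat 10
  outX : s'.real 4 = s.real 4
  outY : s'.real 5 = s.real 5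
  dirX : s'.real 6 = s.real 6
  dirY : s'.real 7 = s.real 7
  stackX : s'.real 18 = s.real 18
  stackY : s'.real 19 = s.real 19

theorem OracleFor.runs {A : Set (ℝ × ℝ)} {s₀ : State} {T : ℕ} (hO : OracleFor A s₀ T) {s : State}
    (hs : SameInput s₀ s) : Runs oracle s T fun s' => SameHull s s' ∧ SameInput s₀ s' ∧
      s'.point ∈ A ∧
      ∀ z ∈ A, lexKey (s.real 6 0) (s.real 7 0) z ≤ lexKey (s.real 6 0) (s.real 7 0) s'.point := by
  refine (hO s hs).frame.mono le_rfl fun s' hs' => ⟨?_, hs'.1⟩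
  obtain ⟨-, hn, hr⟩ := hs'
  exact ⟨hn 3 (by decide), hn 10 (by decide), hr 4 (by decide), hr 5 (by decide), hr 6 (by decide),
    hr 7 (by decide), hr 18 (by decide), hr 19 (by decide)⟩

def HullInvariant (K : Set (ℝ × ℝ)) (s₀ s : State) : Prop :=
  SameInput s₀ s ∧ ((s.nat 10 0 = 0 ∧ s.Outputs K) ∨ (1 ≤ s.nat 10 0 ∧
    s.stackPoint 0 = s.outPoint 0 ∧ 2 ≤ s.chainLength ∧
    HullChain K s.chain s.chainLength (s.nat 3 0)))

theorem outputs_of_listsVerticesCCW {K : Set (ℝ × ℝ)} {s : State} {M : ℕ} (hM : s.nat 3 0 = M)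
    {g : ℕ → ℝ × ℝ} (hg : ∀ j < M, s.outPoint j = g j)
    (h : ListsVerticesCCW (fun j : Fin M => g j) K) : s.Outputs K := by
  subst hM
  have : (fun j : Fin (s.nat 3 0) => (s.real 4 j, s.real 5 j)) =
      fun j : Fin (s.nat 3 0) => g j := funext fun j => hg j j.2
  rw [State.Outputs, this]
  exact h

/-- A push raises the height of the stack by one but lengthens the chain, which counts double and is
limited by the number of extreme points. A pop lowers the height and keeps the length of the chain.
-/
theorem runs_hullStep {A : Set (ℝ × ℝ)} {s₀ : State} {T : ℕ} (hO : OracleFor A s₀ T)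
    (hfin : ((convexHull ℝ A).extremePoints ℝ).Finite) {s : State}
    (hs : HullInvariant (convexHull ℝ A) s₀ s) (hH : 1 ≤ s.nat 10 0) :
    Runs hullStep s (T + 200) fun s' => HullInvariant (convexHull ℝ A) s₀ s' ∧
      2 * (((convexHull ℝ A).extremePoints ℝ).ncard - s'.chainLength) + s'.nat 10 0 <
      2 * (((convexHull ℝ A).extremePoints ℝ).ncard - s.chainLength) + s.nat 10 0 := by
  obtain ⟨hI, h⟩ := hs
  obtain ⟨-, hbot, hP2, hC⟩ := h.resolve_left fun h => by omega
  set K := convexHull ℝ A with hK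
  have hconv : Convex ℝ K := convex_convexHull ℝ A
  set M := s.nat 3 0 with hM
  set H := s.nat 10 0 with hHdef
  set P := s.chainLength with hP
  set c := s.outPoint (M - 1) with hc
  set t := s.stackPoint (H - 1) with ht
  have hP' : P = M + (H - 1) := rfl
  have hM1 := hC.one_le
  have hcg : s.chain (M - 1) = c := by
    rw [State.chain, if_pos (by omega)]
  have htg : (if M < P then s.chain M else s.chain 0) = t := by
    split_ifs with hlt
    · rw [State.chain, if_neg (by omega), ← hM, Nat.sub_self, Nat.sub_zero]
    · rw [State.chain, if_pos (by omega), ← hbot, ht, (by omega : H - 1 = 0)]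
  have hct : c ≠ t := by
    rw [← hcg, ← htg]
    split_ifs with hlt
    · exact hC.injOn (by omega) hlt
    · exact (hC.injOn (by omega : 0 < M - 1) (by omega)).symm
  have h1 : Runs turnRight s 30 fun s' => s' = turnRight.run s := Runs.of_loopFree rfl (by decide) rfl
  refine (Runs.seq h1 (B' := T + 150) ?_).mono (by omega) fun _ h => h
  rintro _ rfl
  set s₁ := turnRight.run s with hs₁
  have hI1 : SameInput s₀ s₁ := hI.run rfl rfl
  have e6 : s₁.real 6 0 = t.2 - c.2 := by
    simp [hs₁, turnRight, setDirection, Prog.run, RealExpr.eval, NatExpr.eval, ht, hc,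
      State.stackPoint, State.outPoint, hM, hHdef]
  have e7 : s₁.real 7 0 = c.1 - t.1 := by
    simp [hs₁, turnRight, setDirection, Prog.run, RealExpr.eval, NatExpr.eval, ht, hc,
      State.stackPoint, State.outPoint, hM, hHdef]
  have f4 : s₁.real 4 = s.real 4 := by
    funext i
    simp [hs₁, turnRight, setDirection, Prog.run]
  have f5 : s₁.real 5 = s.real 5 := by
    funext i
    simp [hs₁, turnRight, setDirection, Prog.run]
  have f18 : s₁.real 18 = s.real 18 := by
    funext i
    simp [hs₁, turnRight, setDirection, Prog.run]
  have f19 : s₁.real 19 = s.real 19 := by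
    funext i
    simp [hs₁, turnRight, setDirection, Prog.run]
  have fn : s₁.nat = s.nat := by
    simp [hs₁, turnRight, setDirection, Prog.run]
  refine (Runs.seq (hO.runs hI1) (B' := 150) ?_).mono le_rfl fun _ h => h
  rintro s₂ ⟨hS, hI2, hrA, hmax⟩
  set r := s₂.point with hr
  rw [e6, e7] at hmax
  have hdir : t.2 - c.2 ≠ 0 ∨ c.1 - t.1 ≠ 0 := by
    by_contra hcon
    push Not at hcon
    exact hct (Prod.ext (by linarith [hcon.2]) (by linarith [hcon.1]))
  obtain ⟨hrext, hrmax⟩ := mem_extremePoints_of_lexKey_max hdir hrA hmax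
  have hout : ∀ i, s₂.outPoint i = s.outPoint i := by
    intro i
    simp only [State.outPoint, hS.outX, hS.outY, f4, f5]
  have hst : ∀ i, s₂.stackPoint i = s.stackPoint i := by
    intro i
    simp only [State.stackPoint, hS.stackX, hS.stackY, f18, f19]
  have hnum : s₂.nat 3 0 = M := by rw [hS.num, fn]
  have hheight : s₂.nat 10 0 = H := by rw [hS.height, fn]
  -- The side of the line c t on which z lies is measured by the objective in the direction chosen
  -- by `turnRight`.
  have horient : ∀ z, orient c t z = ((t.2 - c.2) * c.1 + (c.1 - t.1) * c.2) -
      ((t.2 - c.2) * z.1 + (c.1 - t.1) * z.2) := by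
    intro z
    simp only [orient]
    ring
  have htest : noPointBeyond.Holds s₂ ↔ 0 ≤ orient c t r := by
    rw [horient, sub_nonneg, ← e6, ← e7, ← hS.dirX, ← hS.dirY, hr, hc, ← hout, ← hnum]
    rfl
  refine Runs.of_loopFree rfl (by decide) ?_
  have hI3 : SameInput s₀ ((Prog.branch noPointBeyond popStack pushStack).run s₂) := hI2.run rfl rfl
  by_cases hb : noPointBeyond.Holds s₂
  · have hsupp : ∀ z ∈ K, 0 ≤ orient c t z := by
      intro z hz
      have h1 := htest.1 hb
      have h2 := hrmax z hz
      rw [horient] at h1 ⊢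
      simp only [lexKey, Prod.Lex.toLex_le_toLex] at h2
      have h3 := h2.elim le_of_lt fun h => h.1.le
      linarith
    by_cases hH1 : H = 1
    · have hPM : P = M := by omega
      have hrun : (Prog.branch noPointBeyond popStack pushStack).run s₂ = s₂.writeNat 10 0 0 := by
        simp [Prog.run, hb, popStack, Test.Holds, NatExpr.eval, hheight, hH1]
      rw [hrun] at hI3 ⊢
      -- By truncated subtraction an empty stack contributes 0, as did its last remaining point.
      have hlen : (s₂.writeNat 10 0 0).chainLength = M := by
        simp [State.chainLength, hnum]
      refine ⟨⟨hI3, Or.inl ⟨by simp, ?_⟩⟩, ?_⟩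
      · rw [hPM] at hC hP2
        refine outputs_of_listsVerticesCCW (M := M) (g := s.chain) (by simp [hnum]) ?_
          (hC.listsVerticesCCW hconv hP2 ?_)
        · intro j hj
          rw [State.chain, if_pos hj, ← hout]
          rfl
        · rw [hcg]
          rw [if_neg (by omega)] at htg
          rwa [htg]
      · rw [hlen]
        simp only [State.writeNat_nat, and_self, if_true]
        omega
    · have hrun : (Prog.branch noPointBeyond popStack pushStack).run s₂ =
          (((s₂.writeNat 10 0 (H - 1)).writeReal 4 M t.1).writeReal 5 M t.2).writeNat 3 0 (M + 1) := by
        have e1 : s₂.real 18 (H - 1) = t.1 := congrArg Prod.fst (hst (H - 1))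
        have e2 : s₂.real 19 (H - 1) = t.2 := congrArg Prod.snd (hst (H - 1))
        have e3 : 1 ≤ H - 1 := by omega
        simp [Prog.run, hb, popStack, Test.Holds, NatExpr.eval, RealExpr.eval, hheight, hnum, e1, e2, e3]
      rw [hrun] at hI3 ⊢
      set s₃ := (((s₂.writeNat 10 0 (H - 1)).writeReal 4 M t.1).writeReal 5 M t.2).writeNat 3 0 (M + 1)
        with hs₃
      have n3 : s₃.nat 3 0 = M + 1 := by simp [hs₃]
      have n10 : s₃.nat 10 0 = H - 1 := by simp [hs₃]
      have o3 : ∀ i, s₃.outPoint i = if i = M then t else s.outPoint i := by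
        intro i
        rw [← hout]
        by_cases hi : i = M <;> simp [hs₃, State.outPoint, hi]
      have st3 : ∀ i, s₃.stackPoint i = s.stackPoint i := by
        intro i
        rw [← hst]
        simp [hs₃, State.stackPoint]
      have hlen : s₃.chainLength = P := by
        rw [State.chainLength, n3, n10]
        omega
      have hMP : M < P := by omega
      rw [if_pos hMP] at htg
      refine ⟨⟨hI3, Or.inr ⟨by omega, ?_, by omega, ?_⟩⟩, by omega⟩
      · rw [st3, o3, if_neg (by omega), hbot]
      · rw [hlen, n3]
        refine (hC.advance hMP (by rwa [hcg, htg])).congr fun i hi => ?_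
        rw [State.chain, n3, n10, o3]
        rcases lt_trichotomy i M with h1 | h1 | h1
        · rw [if_pos (by omega), if_neg (by omega), State.chain, if_pos h1]
        · subst h1
          rw [if_pos (by omega), if_pos rfl, htg]
        · rw [if_neg (by omega), st3, State.chain, if_neg (by omega)]
          congr 1
          omega
  · have hrun : (Prog.branch noPointBeyond popStack pushStack).run s₂ =
        ((s₂.writeReal 18 H r.1).writeReal 19 H r.2).writeNat 10 0 (H + 1) := by
      simp [Prog.run, hb, pushStack, storePoint, NatExpr.eval, RealExpr.eval, hheight, hr, State.point]
    rw [hrun] at hI3 ⊢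
    set s₃ := ((s₂.writeReal 18 H r.1).writeReal 19 H r.2).writeNat 10 0 (H + 1) with hs₃
    have n3 : s₃.nat 3 0 = M := by simp [hs₃, hnum]
    have n10 : s₃.nat 10 0 = H + 1 := by simp [hs₃]
    have o3 : ∀ i, s₃.outPoint i = s.outPoint i := by
      intro i
      rw [← hout]
      simp [hs₃, State.outPoint]
    have st3 : ∀ i, s₃.stackPoint i = if i = H then r else s.stackPoint i := by
      intro i
      rw [← hst]
      by_cases hi : i = H <;> simp [hs₃, State.stackPoint, hi]
    have hlen : s₃.chainLength = P + 1 := by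
      rw [State.chainLength, n3, n10]
      omega
    have hlt : orient c t r < 0 := by
      rw [htest, not_le] at hb
      exact hb
    have hnew : HullChain K s₃.chain (P + 1) M := by
      refine (hC.insert hconv hrext (by rwa [hcg, htg])).congr fun i hi => ?_
      rw [State.chain, n3, n10, o3, st3]
      rcases lt_trichotomy i M with h1 | h1 | h1
      · rw [if_pos h1, if_pos h1, State.chain, if_pos h1]
      · subst h1
        rw [if_neg (by omega), if_pos (by omega), if_neg (by omega), if_pos rfl]
      · rw [if_neg (by omega), if_neg (by omega), if_neg (by omega), if_neg (by omega),
          State.chain, if_neg (by omega)]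
        congr 1
        omega
    refine ⟨⟨hI3, Or.inr ⟨by omega, ?_, by omega, ?_⟩⟩, ?_⟩
    · rw [st3, o3, if_neg (by omega), hbot]
    · rw [hlen, n3]
      exact hnew
    · have := hnew.le_ncard hfin
      omega

end RealRAM

namespace RealRAM

theorem runs_hullStart {A : Set (ℝ × ℝ)} {s₀ : State} {T : ℕ} (hO : OracleFor A s₀ T) :
    Runs hullStart s₀ (2 * T + 200) fun s =>
      HullInvariant (convexHull ℝ A) s₀ s ∧ s.nat 10 0 ≤ 2 := by
  have hI0 : SameInput s₀ s₀ := ⟨fun _ _ => rfl, fun _ _ => rfl⟩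
  have h1 : Runs (setDirection (RealExpr.const (-1)) zeroReal) s₀ 10 fun s' =>
      s' = (setDirection (RealExpr.const (-1)) zeroReal).run s₀ :=
    Runs.of_loopFree rfl (by decide) rfl
  refine (Runs.seq h1 (B' := 2 * T + 190) ?_).mono (by omega) fun _ h => h
  rintro _ rfl
  set s₁ := (setDirection (RealExpr.const (-1)) zeroReal).run s₀ with hs₁
  have hI1 : SameInput s₀ s₁ := hI0.run rfl rfl
  have e6 : s₁.real 6 0 = -1 := by
    simp [hs₁, setDirection, Prog.run, RealExpr.eval, NatExpr.eval]
  have e7 : s₁.real 7 0 = 0 := by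
    simp [hs₁, setDirection, Prog.run, RealExpr.eval, NatExpr.eval, zeroReal]
  refine (Runs.seq (hO.runs hI1) (B' := T + 190) ?_).mono (by omega) fun _ h => h
  rintro s₂ ⟨-, hI2, haA, hamax⟩
  rw [e6, e7] at hamax
  set a := s₂.point with ha
  obtain ⟨haext, hamax⟩ := mem_extremePoints_of_lexKey_max (by norm_num) haA hamax
  set mid := (Prog.seq (storePoint 4 5 (NatExpr.const 0))
          (Prog.seq (storePoint 18 19 (NatExpr.const 0))
            (Prog.seq (Prog.setNat 3 (NatExpr.const 0) (NatExpr.const 1))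
              (setDirection (RealExpr.const 1) zeroReal)))) with hmid
  have h3 : Runs mid s₂ 40 fun s' => s' = mid.run s₂ := Runs.of_loopFree rfl (by decide) rfl
  refine (Runs.seq h3 (B' := T + 150) ?_).mono (by omega) fun _ h => h
  rintro _ rfl
  set s₃ := mid.run s₂ with hs₃
  have hI3 : SameInput s₀ s₃ := hI2.run rfl rfl
  have e6 : s₃.real 6 0 = 1 := by
    simp [hs₃, hmid, setDirection, Prog.run, RealExpr.eval, NatExpr.eval]
  have e7 : s₃.real 7 0 = 0 := by
    simp [hs₃, hmid, setDirection, Prog.run, RealExpr.eval, NatExpr.eval, zeroReal]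
  have en : s₃.nat 3 0 = 1 := by
    simp [hs₃, hmid, setDirection, storePoint, Prog.run, NatExpr.eval]
  have eo : s₃.outPoint 0 = a := by
    simp [hs₃, hmid, setDirection, storePoint, Prog.run, RealExpr.eval, NatExpr.eval,
      State.outPoint, ha, State.point]
  have es : s₃.stackPoint 0 = a := by
    simp [hs₃, hmid, setDirection, storePoint, Prog.run, RealExpr.eval, NatExpr.eval,
      State.stackPoint, ha, State.point]
  refine (Runs.seq (hO.runs hI3) (B' := 150) ?_).mono (by omega) fun _ h => h
  rintro s₄ ⟨hS, hI4, hbA, hbmax⟩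
  rw [e6, e7] at hbmax
  set b := s₄.point with hb
  obtain ⟨hbext, hbmax⟩ := mem_extremePoints_of_lexKey_max (by norm_num) hbA hbmax
  have hleft : ∀ z ∈ convexHull ℝ A, z ≠ a → a.1 < z.1 ∨ (a.1 = z.1 ∧ a.2 < z.2) := by
    intro z hz hne
    have h := hamax z hz
    simp only [lexKey, Prod.Lex.toLex_le_toLex] at h
    rcases h with h | ⟨h, h'⟩
    · left
      linarith
    · have h1 : a.1 = z.1 := by linarith
      refine Or.inr ⟨h1, lt_of_le_of_ne (by linarith) fun h2 => hne ?_⟩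
      exact Prod.ext h1.symm h2.symm
  have hn4 : s₄.nat 3 0 = 1 := by rw [hS.num, en]
  have ho4 : s₄.outPoint 0 = a := by
    rw [← eo]
    simp only [State.outPoint, hS.outX, hS.outY]
  have hs4 : s₄.stackPoint 0 = a := by
    rw [← es]
    simp only [State.stackPoint, hS.stackX, hS.stackY]
  set test := (Test.and
              (Test.and (Test.realLe pointX (RealExpr.read 4 (NatExpr.const 0)))
                (Test.realLe (RealExpr.read 4 (NatExpr.const 0)) pointX))
              (Test.and (Test.realLe pointY (RealExpr.read 5 (NatExpr.const 0)))
                (Test.realLe (RealExpr.read 5 (NatExpr.const 0)) pointY))) with htest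
  have hT : test.Holds s₄ ↔ b = a := by
    rw [← ho4, Prod.ext_iff, le_antisymm_iff, le_antisymm_iff (a := b.2)]
    rfl
  refine Runs.of_loopFree rfl (by decide) ?_
  by_cases hba : test.Holds s₄
  · rw [Prog.run, if_pos hba]
    have hI5 : SameInput s₀ ((Prog.setNat 10 (NatExpr.const 0) (NatExpr.const 0)).run s₄) :=
      hI4.run rfl rfl
    have hrun : (Prog.setNat 10 (NatExpr.const 0) (NatExpr.const 0)).run s₄ =
        s₄.writeNat 10 0 0 := rfl
    rw [hrun] at hI5 ⊢
    refine ⟨⟨hI5, Or.inl ⟨by simp, ?_⟩⟩, by simp⟩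
    -- The lexicographically least and greatest points coincide, so there is no other point.
    have hK : convexHull ℝ A = {a} := by
      refine Set.Subset.antisymm (fun z hz => ?_) (by simpa using haext.1)
      by_contra hne
      have h1 := hbmax z hz
      rw [hT.1 hba] at h1
      simp only [lexKey, Prod.Lex.toLex_le_toLex] at h1
      rcases hleft z hz hne with h2 | h2 <;> rcases h1 with h1 | h1 <;> linarith
    refine outputs_of_listsVerticesCCW (M := 1) (g := fun _ => a) (by simp [hn4]) ?_ ?_
    · intro j hj
      obtain rfl : j = 0 := by omega
      rw [← ho4]
      rfl
    · rw [hK, ListsVerticesCCW, extremePoints_singleton]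
      refine ⟨Function.injective_of_subsingleton _, by simp, fun i j k h1 h2 => ?_⟩
      have := i.2
      have := j.2
      omega
  · rw [Prog.run, if_neg hba]
    rw [hT] at hba
    set p := (Prog.seq (storePoint 18 19 (NatExpr.const 1))
              (Prog.setNat 10 (NatExpr.const 0) (NatExpr.const 2))) with hp
    have hI5 : SameInput s₀ (p.run s₄) := hI4.run rfl rfl
    set s₅ := p.run s₄ with hs₅
    have n3 : s₅.nat 3 0 = 1 := by
      simp [hs₅, hp, storePoint, Prog.run, NatExpr.eval, hn4]
    have n10 : s₅.nat 10 0 = 2 := by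
      simp [hs₅, hp, storePoint, Prog.run, NatExpr.eval]
    have o5 : s₅.outPoint 0 = a := by
      rw [← ho4]
      simp [hs₅, hp, storePoint, Prog.run, NatExpr.eval, State.outPoint]
    have st0 : s₅.stackPoint 0 = a := by
      rw [← hs4]
      simp [hs₅, hp, storePoint, Prog.run, NatExpr.eval, State.stackPoint]
    have st1 : s₅.stackPoint 1 = b := by
      simp [hs₅, hp, storePoint, Prog.run, NatExpr.eval, RealExpr.eval, State.stackPoint, hb,
        State.point]
    have hlen : s₅.chainLength = 2 := by
      rw [State.chainLength, n3, n10]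
    have c0 : s₅.chain 0 = a := by simp [State.chain, n3, o5]
    have c1 : s₅.chain 1 = b := by simp [State.chain, n3, n10, st1]
    refine ⟨⟨hI5, Or.inr ⟨by omega, by rw [st0, o5], hlen.ge, ?_⟩⟩, n10.le⟩
    rw [hlen, n3]
    refine ⟨le_rfl, by omega, fun i hi => ?_, fun i j hi hij hj => by omega, fun i hi hi' => ?_,
      c0 ▸ hleft, fun i hi => by omega⟩
    · interval_cases i
      · rwa [c0]
      · rwa [c1]
    · obtain rfl : i = 1 := by omega
      rwa [c0, c1]

theorem runs_hullProg {A : Set (ℝ × ℝ)} {s₀ : State} {T : ℕ} (hO : OracleFor A s₀ T)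
    (hfin : ((convexHull ℝ A).extremePoints ℝ).Finite) :
    Runs hullProg s₀ ((2 * ((convexHull ℝ A).extremePoints ℝ).ncard + 5) * (T + 205))
      fun s => s.Outputs (convexHull ℝ A) := by
  set N := ((convexHull ℝ A).extremePoints ℝ).ncard with hN
  refine (Runs.seq (runs_hullStart hO) (B' := (2 * N + 3) * (T + 205)) ?_).mono ?_ fun _ h => h
  · rintro s ⟨hs, h2⟩
    refine (Runs.loop (HullInvariant (convexHull ℝ A) s₀)
      (fun s => 2 * (N - s.chainLength) + s.nat 10 0) (B := T + 200) ?_ s hs).mono ?_ ?_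
    · intro s hs hb
      exact runs_hullStep hO hfin hs hb
    -- The stack starts with at most two points, so the initial measure is at most 2 * N + 2; the
    -- loop test costs 4.
    · change (_ + 1) * (4 + 1 + (T + 200)) ≤ _
      refine Nat.mul_le_mul ?_ (by omega)
      omega
    · rintro s' ⟨⟨-, h⟩, hb⟩
      have h0 : ¬ 1 ≤ s'.nat 10 0 := hb
      rcases h with h | h
      · exact h.2
      · exact absurd h.1 h0
  · nlinarith

end RealRAM

/-! ### Selections computed from the input as lower sets of the incidence poset -/

namespace GraphCode

open RealRAM IncidencePoset

variable {V : Type*} [Fintype V] {G : SimpleGraph V}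

theorem numEdges_le (c : GraphCode G) : c.numEdges ≤ Fintype.card V ^ 2 := by
  have h : Function.Injective fun k => (c.src k, c.tgt k) := fun j k hjk => by
    refine c.edg.injective (Subtype.ext ?_)
    simp only [Prod.mk.injEq] at hjk
    rw [c.endpoints, c.endpoints, hjk.1, hjk.2]
  simpa [pow_two] using Fintype.card_le_of_injective _ h

theorem src_ne_tgt (c : GraphCode G) (k : Fin c.numEdges) : c.src k ≠ c.tgt k := by
  intro h
  have h1 := (c.edg k).2
  rw [c.endpoints, h, SimpleGraph.mem_edgeSet] at h1
  exact G.loopless.irrefl _ h1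

theorem isNetwork_input (c : GraphCode G) (wt : IncidencePoset G → ℝ × ℝ) :
    (c.input wt).IsNetwork := by
  have hm : (c.input wt).nat 0 1 = c.numEdges := rfl
  have h1 : ∀ j (h : j < c.numEdges), (c.input wt).nat 1 j = c.src ⟨j, h⟩ := fun j h => dif_pos h
  have h2 : ∀ j (h : j < c.numEdges), (c.input wt).nat 2 j = c.tgt ⟨j, h⟩ := fun j h => dif_pos h
  refine ⟨fun j hj => ?_, fun j hj => ?_, fun j hj => ?_⟩
  · rw [hm] at hj
    rw [h1 j hj]
    exact (c.src ⟨j, hj⟩).2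
  · rw [hm] at hj
    rw [h2 j hj]
    exact (c.tgt ⟨j, hj⟩).2
  · rw [hm] at hj
    rw [h1 j hj, h2 j hj]
    exact fun h => c.src_ne_tgt ⟨j, hj⟩ (Fin.ext h)

def elements (c : GraphCode G) :
    Fin (Fintype.card V) ⊕ Fin c.numEdges ≃ IncidencePoset G where
  toFun := Sum.elim (fun i => vertex (c.vtx i)) fun k => edge (c.edg k)
  invFun x := match x with
    | vertex v => Sum.inl (c.vtx.symm v)
    | edge e => Sum.inr (c.edg.symm e)
  left_inv := by rintro (i | k) <;> simp
  right_inv := by rintro (v | e) <;> simp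

theorem sum_elements (c : GraphCode G) (f : IncidencePoset G → ℝ × ℝ) :
    ∑ x, f x = ∑ i, f (vertex (c.vtx i)) + ∑ k, f (edge (c.edg k)) := by
  rw [← Fintype.sum_equiv c.elements (fun x => f (c.elements x)) f fun _ => rfl,
    Fintype.sum_sum_type]
  rfl

theorem mem_edg {c : GraphCode G} {L : LowerSet (IncidencePoset G)} {k : Fin c.numEdges}
    (h : edge (c.edg k) ∈ L) : vertex (c.vtx (c.src k)) ∈ L ∧ vertex (c.vtx (c.tgt k)) ∈ L := by
  refine ⟨L.lower (vertex_le_edge_iff.2 ?_) h, L.lower (vertex_le_edge_iff.2 ?_) h⟩ <;>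
    simp [c.endpoints]

open Classical in
theorem selection_input (c : GraphCode G) (wt : IncidencePoset G → ℝ × ℝ) {s : State}
    (hs : SameInput (c.input wt) s) (S : ℕ → Prop) : s.selection S =
      (∑ i, if S (i : Fin (Fintype.card V)) then wt (vertex (c.vtx i)) else 0) +
      ∑ k, if S (c.src k) ∧ S (c.tgt k) ∧ 0 < s.key (wt (edge (c.edg k)))
        then wt (edge (c.edg k)) else 0 := by
  rw [State.selection, hs.nat 0 (by norm_num), hs.nat 1 (by norm_num), hs.nat 2 (by norm_num)]
  have hn : (c.input wt).nat 0 0 = Fintype.card V := rfl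
  have hm : (c.input wt).nat 0 1 = c.numEdges := rfl
  rw [hn, hm, Finset.sum_range, Finset.sum_range]
  congr 1
  · refine Finset.sum_congr rfl fun i _ => ?_
    have : s.vertexWeight i = wt (vertex (c.vtx i)) := by
      simp [State.vertexWeight, hs.real, GraphCode.input]
    rw [this]
  · refine Finset.sum_congr rfl fun k _ => ?_
    have h1 : s.edgeWeight k = wt (edge (c.edg k)) := by
      simp [State.edgeWeight, hs.real, GraphCode.input]
    have h2 : (c.input wt).nat 1 k = c.src k := dif_pos k.2
    have h3 : (c.input wt).nat 2 k = c.tgt k := dif_pos k.2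
    rw [h1, h2, h3]

/-- The vertices with numbers in `S` and the edges of positive weight that they span. -/
def selectedSet (c : GraphCode G) (S : ℕ → Prop) (pos : IncidencePoset G → Prop) :
    LowerSet (IncidencePoset G) where
  carrier := {x | match x with
    | vertex v => S (c.vtx.symm v)
    | edge e => S (c.src (c.edg.symm e)) ∧ S (c.tgt (c.edg.symm e)) ∧ pos (edge e)}
  lower' := by
    intro x y hyx hx
    rcases hyx with rfl | ⟨v, e, rfl, rfl, hv⟩
    · exact hx
    · obtain ⟨k, rfl⟩ := c.edg.surjective e
      rw [c.endpoints, Sym2.mem_iff] at hv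
      simp only [Set.mem_ofPred_eq, Equiv.symm_apply_apply] at hx ⊢
      rcases hv with rfl | rfl
      · simpa using hx.1
      · simpa using hx.2.1

open Classical in
theorem selection_eq_lowerSetWeight (c : GraphCode G) (wt : IncidencePoset G → ℝ × ℝ) {s : State}
    (hs : SameInput (c.input wt) s) (S : ℕ → Prop) : s.selection S =
      lowerSetWeight wt (c.selectedSet S fun x => 0 < s.key (wt x)) := by
  rw [lowerSetWeight_eq_sum_ite, c.sum_elements, c.selection_input wt hs]
  congr 1
  · refine Finset.sum_congr rfl fun i _ => ?_
    have : vertex (c.vtx i) ∈ c.selectedSet S (fun x => 0 < s.key (wt x)) ↔ S i := by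
      change S (c.vtx.symm (c.vtx i)) ↔ S i
      rw [Equiv.symm_apply_apply]
    exact if_congr this.symm rfl rfl
  · refine Finset.sum_congr rfl fun k _ => ?_
    have : edge (c.edg k) ∈ c.selectedSet S (fun x => 0 < s.key (wt x)) ↔
        S (c.src k) ∧ S (c.tgt k) ∧ 0 < s.key (wt (edge (c.edg k))) := by
      change S (c.src (c.edg.symm (c.edg k))) ∧ S (c.tgt (c.edg.symm (c.edg k))) ∧ _ ↔ _
      rw [Equiv.symm_apply_apply]
    exact if_congr this.symm rfl rfl

-- Considering only selections loses nothing: for a fixed set of vertices, dropping the edges of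
-- nonpositive key and adding all spanned edges of positive key cannot lower the key.
open Classical in
theorem key_lowerSetWeight_le (c : GraphCode G) (wt : IncidencePoset G → ℝ × ℝ) {s : State}
    (hs : SameInput (c.input wt) s) (L : LowerSet (IncidencePoset G)) :
    s.key (lowerSetWeight wt L) ≤ s.key (s.selection fun v => v ∈
      (Finset.univ.filter fun i => vertex (c.vtx i) ∈ L).image Fin.val) := by
  have hadd : ∀ z z', s.key (z + z') = s.key z + s.key z' := lexKey_add _ _
  rw [lowerSetWeight_eq_sum_ite, c.sum_elements, c.selection_input wt hs, hadd, hadd, key_sum,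
    key_sum, key_sum, key_sum]
  have hmem : ∀ i : Fin (Fintype.card V), (i : ℕ) ∈
      (Finset.univ.filter fun i => vertex (c.vtx i) ∈ L).image Fin.val ↔ vertex (c.vtx i) ∈ L := by
    intro i
    simp [Fin.val_inj]
  refine add_le_add (le_of_eq ?_) (Finset.sum_le_sum fun k _ => ?_)
  · refine Finset.sum_congr rfl fun i _ => ?_
    simp only [hmem]
  · simp only [hmem]
    have h0 : s.key 0 = 0 := lexKey_zero _ _
    by_cases hk : edge (c.edg k) ∈ L
    · rw [if_pos hk]
      obtain ⟨h1, h2⟩ := mem_edg hk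
      split_ifs with h
      · exact le_rfl
      · rw [h0]
        exact not_lt.1 fun h' => h ⟨h1, h2, h'⟩
    · rw [if_neg hk, h0]
      split_ifs with h
      · exact h.2.2.le
      · exact h0.ge

/-- The result is the weight of a lower set by `selection_eq_lowerSetWeight`, and no lower set beats
it by `key_lowerSetWeight_le`. -/
theorem oracleFor [Nonempty V] (c : GraphCode G) (wt : IncidencePoset G → ℝ × ℝ) :
    OracleFor (Set.range (lowerSetWeight wt)) (c.input wt) (200000 * Fintype.card V ^ 7) := by
  intro s hs
  have e0 := hs.nat 0 (by norm_num)
  have hn : s.nat 0 0 = Fintype.card V := by rw [e0]; rfl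
  have hm : s.nat 0 1 = c.numEdges := by rw [e0]; rfl
  have hN : s.IsNetwork := by
    rw [State.IsNetwork, e0, hs.nat 1 (by norm_num), hs.nat 2 (by norm_num)]
    exact c.isNetwork_input wt
  have h := runs_oracle hN (by rw [hn]; exact Fintype.card_pos)
    (by rw [hn, hm]; exact c.numEdges_le)
  rw [hn] at h
  refine h.mono le_rfl ?_
  rintro s' ⟨hA, T, hT, hmax⟩
  refine ⟨hs.trans hA.sameInput, ⟨_, (hT.trans (c.selection_eq_lowerSetWeight wt hs _)).symm⟩, ?_⟩
  rintro _ ⟨L, rfl⟩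
  classical
  refine (c.key_lowerSetWeight_le wt hs L).trans (le_trans (le_of_eq ?_) (hmax
    ((Finset.univ.filter fun i => vertex (c.vtx i) ∈ L).image Fin.val)))
  congr!

end GraphCode

/-! ### Assembly of the two bounds -/

theorem mainTheorem6 :
    ∃ (prog : RealRAM.Prog) (C : ℕ),
      ∀ (V : Type*) [Fintype V] [Nonempty V] (G : SimpleGraph V) (n w : ℕ),
        Fintype.card V = n → treewidth G = w →
        ∀ wt : IncidencePoset G → ℝ × ℝ,
          ((polygon wt).extremePoints ℝ).encard ≤ ((C * n ^ (C * max w 1) : ℕ) : ℕ∞) ∧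
          ∀ c : GraphCode G, ∃ (t : ℕ) (s : RealRAM.State),
            RealRAM.Exec prog (c.input wt) t s ∧
            t ≤ C * n ^ (C * max w 1) ∧
            s.Outputs (polygon wt) := by
  refine ⟨RealRAM.hullProg, 14000000, ?_⟩
  rintro V _ _ G n w rfl rfl wt
  have hfin : ((polygon wt).extremePoints ℝ).Finite :=
    (finite_range_lowerSetWeight wt).subset extremePoints_convexHull_subset
  have hN := IncidencePoset.ncard_extremePoints_polygon_le wt
  have hn : 1 ≤ Fintype.card V := Fintype.card_pos
  set n := Fintype.card V
  set W := max (treewidth G) 1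
  have hW : 1 ≤ W := le_max_right _ _
  set N := ((polygon wt).extremePoints ℝ).ncard with hNdef
  have hmul : ∀ k c : ℕ, c ≤ 14000000 → k ≤ 14 * W → c * n ^ k ≤ 14000000 * n ^ (14000000 * W) :=
    fun k c hc hk => Nat.mul_le_mul hc (Nat.pow_le_pow_right hn (by omega))
  refine ⟨?_, fun c => ?_⟩
  · rw [← hfin.cast_ncard_eq, ← hNdef]
    exact_mod_cast hN.trans (hmul _ _ (by norm_num) (by omega))
  · obtain ⟨t, s, h, ht, hs⟩ := RealRAM.runs_hullProg (c.oracleFor wt) hfin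
    refine ⟨t, s, h, ht.trans ?_, hs⟩
    have h1 : 1 ≤ n ^ (7 * W) := Nat.one_le_pow _ _ hn
    have h2 : n ^ 7 ≤ n ^ (7 * W) := Nat.pow_le_pow_right hn (by omega)
    -- With N ≤ 32 * n ^ (7 * W) the first factor is at most 2 * 32 + 5 = 69 times that power; the
    -- product 69 * 200205 dictates the constant 14000000.
    calc (2 * N + 5) * (200000 * n ^ 7 + 205)
        ≤ (69 * n ^ (7 * W)) * (200205 * n ^ (7 * W)) := Nat.mul_le_mul (by omega) (by omega)
      _ = 13814145 * n ^ (14 * W) := by ring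
      _ ≤ _ := hmul _ _ (by norm_num) le_rfl
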